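/- **Setting.** Let $X$ be a proper metric space and $\mathscr H$ an $X$-module, i.e. a complex Hilbert space with a nondegenerate $*$-representation of $C_0(X)$ (ample or not). It extends to bounded Borel functions; $\chi_S$ denotes the projection by which the indicator function of a Borel set $S\subseteq X$ acts. An operator $T\in B(\mathscr H)$ is *locally compact* if $\chi_S T$ and $T\chi_S$ are compact for all bounded Borel sets $S$, and has *finite propagation* if for some $r\ge 0$ one has $\chi_V T\chi_{V'}=0$ for all Borel sets $V,V'$ with $d(V,V')>r$. The Roe algebra $C^*_{\mathrm{Roe}}(X)$ is the norm closure of the algebra of locally compact operators of finite propagation. For $Z\subseteq X$ let $\{Z\}$ be the family of all subsets of the thickenings $B_r(Z)$, $r>0$; for families of subsets put $\mathcal Y\cap\mathcal Z=\{S\cap S' : S\in\mathcal Y, S'\in\mathcal Z\}$, and let $\partial Z=\{Z\}\cap\{X\setminus Z\}$ (the coarse boundary). $C^*_{\mathrm{Roe}}(\mathcal Y)$ is the norm closure of the set of those $T\in C^*_{\mathrm{Roe}}(X)$ for which there is $S\in\mathcal Y$ with $fT=Tf=0$ for all $f$ supported in $X\setminus S$. Let $Y,W\subseteq X$ be Borel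 sets that are transversal: every member of $\partial Y\cap\partial W$ is bounded. Write $A=C^*_{\mathrm{Roe}}(X)$, $I_1=C^*_{\mathrm{Roe}}(\{Y\})$, $I_2=C^*_{\mathrm{Roe}}(\{X\setminus Y\})$, $J=C^*_{\mathrm{Roe}}(\partial Y)=I_1\cap I_2$, and let ${}^+$ denote unitalization. * The *Mayer–Vietoris boundary map* $\partial:K_0(A)\to K_1(J)$ is the homomorphism with $\partial([p]-[q])=[e^{2\pi i \tilde p}]-[e^{2\pi i\tilde q}]$ for all projections $p,q\in M_n(A^+)$ with $p-q\in M_n(A)$ and all self-adjoint $\tilde p,\tilde q\in M_n(I_1^+)$ with the same scalar parts as $p,q$ and with $p-\tilde p,\ q-\tilde q\in M_n(I_2)$. (It is the composition of $K_0(A)\to K_0(A/I_2)\cong K_0(I_1/J)$ with the exponential map $K_0(I_1/J)\to K_1(J)$.) * The functional $\theta_W:K_1(J)\to\mathbb Z$ is the homomorphism $[u]\mapsto\operatorname{index}(F_u)$, where for a unitary $u\in M_n(J^+)$ the operator $F_u=\chi_W u\chi_W+\chi_{X\setminus W}$ on $\mathscr H^n$ is Fredholm. Let $H=H^*\in A$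 be a bounded Hamiltonian that is insulating at energy $E\in\mathbb R$, i.e. $E\notin\operatorname{spec}(H)$, and let $p_E$ be its spectral projection for the spectrum below $E$. Then $p_E\in A$ or $1-p_E\in A$. Let $[p_E]\in K_0(A)$ be its class; if $p_E\notin A$ this means the component $[p_E]-[1]=-[1-p_E]$ of $[p_E]$ in $K_0(A^+)=K_0(A)\oplus\mathbb Z[1]$. Let $\tilde H=\tilde H^*\in I_1$ be adapted to $H$: $f(\tilde H)\in I_1$ and $f(H)-f(\tilde H)\in I_2$ for all $f\in C_0(\mathbb R)$ with $f(0)=0$. **Theorem.** The homomorphisms $\partial$ and $\theta_W$ are well defined: self-adjoint lifts $\tilde p$ as above exist for all $p$, the unitaries $e^{2\pi i\tilde p}$ lie in $M_n(J^+)$, and all $F_u$ are Fredholm. Let $(a,b)\ni E$ be an open interval disjoint from $\operatorname{spec}(H)$, and let $\varphi:\mathbb R\to\mathbb C$ be continuous with compact support in $(a,b)$ and $\int_{\mathbb R}\varphi=1$. If the operator $\varphi(\tilde H)\cdot i[\tilde H,\chi_W]$ is trace class, then $$\theta_W\bigl(\partial([p_E])\bigr)=-2\pi\cdot\operatorname{Tr}\bigl(\varphi(\tilde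 H)\cdot i[\tilde H,\chi_W]\bigr).$$ -/

import Mathlib

open scoped ZeroAtInfty

noncomputable section

namespace CoarseEdge

/-! ### K-theory of C*-algebras -/

section KTheory

/-- Projections in `M_n(B)`. -/
abbrev ProjMat (B : Type*) [Ring B] [StarRing B] (n : ℕ) : Type _ :=
  {p : Matrix (Fin n) (Fin n) B // IsStarProjection p}

/-- Unitaries in `M_n(B)`. -/
abbrev UnitaryMat (B : Type*) [Ring B] [StarRing B] (n : ℕ) : Type _ :=
  unitary (Matrix (Fin n) (Fin n) B)

/-- The block sum `a ⊕ b ∈ M_{m+n}(B)`. -/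
def blockSum {B : Type*} [Zero B] {m n : ℕ} (a : Matrix (Fin m) (Fin m) B)
    (b : Matrix (Fin n) (Fin n) B) : Matrix (Fin (m + n)) (Fin (m + n)) B :=
  Matrix.reindex finSumFinEquiv finSumFinEquiv (Matrix.fromBlocks a 0 0 b)

variable (B : Type*) [Ring B] [StarRing B] [TopologicalSpace B]

/-- The relations of `K_0` of a unital algebra: zero projections are trivial, block sums are sums,
and projections in `M_n(B)` joined by a norm continuous path of projections are identified
(the norm topology of `M_n(B)` is the topology of entrywise convergence). -/
def k0Relators : Set (FreeAbelianGroup (Σ n, ProjMat B n)) :=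
  {x | ∃ (n : ℕ) (p : ProjMat B n), p.1 = 0 ∧ x = .of ⟨n, p⟩} ∪
  {x | ∃ (m n : ℕ) (p : ProjMat B m) (q : ProjMat B n) (r : ProjMat B (m + n)),
    r.1 = blockSum p.1 q.1 ∧ x = .of ⟨m + n, r⟩ - .of ⟨m, p⟩ - .of ⟨n, q⟩} ∪
  {x | ∃ (n : ℕ) (p q : ProjMat B n), Joined p q ∧ x = .of ⟨n, p⟩ - .of ⟨n, q⟩}

/-- `K_0` of a unital C*-algebra: formal differences of homotopy classes of projections in matrix
algebras, i.e. the universal abelian group on such classes. -/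
abbrev K0Unital : Type _ :=
  FreeAbelianGroup (Σ n, ProjMat B n) ⧸ AddSubgroup.closure (k0Relators B)

/-- The relations of `K_1` of a unital algebra: identity matrices are trivial, block sums are sums,
and unitaries in `M_n(B)` joined by a norm continuous path of unitaries are identified. -/
def k1Relators : Set (FreeAbelianGroup (Σ n, UnitaryMat B n)) :=
  {x | ∃ (n : ℕ) (u : UnitaryMat B n), u = 1 ∧ x = .of ⟨n, u⟩} ∪
  {x | ∃ (m n : ℕ) (u : UnitaryMat B m) (v : UnitaryMat B n) (w : UnitaryMat B (m + n)),
    w.1 = blockSum u.1 v.1 ∧ x = .of ⟨m + n, w⟩ - .of ⟨m, u⟩ - .of ⟨n, v⟩} ∪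
  {x | ∃ (n : ℕ) (u v : UnitaryMat B n), Joined u v ∧ x = .of ⟨n, u⟩ - .of ⟨n, v⟩}

/-- `K_1` of a unital C*-algebra: homotopy classes of unitaries in matrix algebras. -/
abbrev K1Unital : Type _ :=
  FreeAbelianGroup (Σ n, UnitaryMat B n) ⧸ AddSubgroup.closure (k1Relators B)

variable {B}

/-- The class `[p]` of a projection `p ∈ M_n(B)`. -/
def k0Class {n : ℕ} (p : ProjMat B n) : K0Unital B :=
  QuotientAddGroup.mk (FreeAbelianGroup.of ⟨n, p⟩)

/-- The class `[u]` of a unitary `u ∈ M_n(B)`. -/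
def k1Class {n : ℕ} (u : UnitaryMat B n) : K1Unital B :=
  QuotientAddGroup.mk (FreeAbelianGroup.of ⟨n, u⟩)

end KTheory

section NonUnital

variable (A : Type*) [NonUnitalNormedRing A] [StarRing A] [CStarRing A] [NormedSpace ℂ A]
  [IsScalarTower ℂ A A] [SMulCommClass ℂ A A] [StarModule ℂ A]

/-- `K_1(A)` of a possibly non-unital C*-algebra: `K_1` of its unitalization. -/
abbrev K1 : Type _ := K1Unital (Unitization ℂ A)

/-- `K_0(A)` of a possibly non-unital C*-algebra: the subgroup of `K_0` of the unitalization `A⁺`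
consisting of the elements of virtual scalar rank zero; it is generated by the differences
`[p] - [q]` of projections `p, q ∈ M_n(A⁺)` with `p - q ∈ M_n(A)`. -/
def K0 : AddSubgroup (K0Unital (Unitization ℂ A)) :=
  AddSubgroup.closure {x | ∃ (n : ℕ) (p q : ProjMat (Unitization ℂ A) n),
    (∀ i j, (p.1 i j).fst = (q.1 i j).fst) ∧ x = k0Class p - k0Class q}

variable {A}

/-- The element `[p] - [q]` of `K_0(A)`, for projections with `p - q ∈ M_n(A)`. -/
def k0Diff {n : ℕ} (p q : ProjMat (Unitization ℂ A) n)
    (h : ∀ i j, (p.1 i j).fst = (q.1 i j).fst) : K0 A :=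
  ⟨k0Class p - k0Class q, AddSubgroup.subset_closure ⟨n, p, q, h, rfl⟩⟩

/-- A projection `e ∈ A` as a projection in `M_1(A⁺)`. -/
def projMatOfProj (e : A) (he : IsStarProjection e) : ProjMat (Unitization ℂ A) 1 :=
  ⟨Matrix.of fun _ _ => Unitization.inr e, by
    refine ⟨?_, ?_⟩
    · refine Matrix.ext fun i j => ?_
      rw [Matrix.mul_apply]
      simp only [Matrix.of_apply, Finset.univ_unique, Finset.sum_const, Finset.card_singleton,
        one_smul]
      rw [← Unitization.inr_mul, he.isIdempotentElem.eq]
    · refine Matrix.ext fun i j => ?_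
      rw [Matrix.star_apply]
      simp only [Matrix.of_apply]
      rw [← Unitization.inr_star, he.isSelfAdjoint.star_eq]⟩

/-- The class `[e] ∈ K_0(A)` of a projection `e ∈ A`. -/
def projClass (e : A) (he : IsStarProjection e) : K0 A :=
  k0Diff (projMatOfProj e he) ⟨0, IsStarProjection.zero _⟩
    (by intro i j; simp [projMatOfProj])

end NonUnital

/-! ### Modules over a metric space and Roe algebras -/

variable {X : Type*} [MetricSpace X] [MeasurableSpace X]
  {𝓗 : Type*} [NormedAddCommGroup 𝓗] [InnerProductSpace ℂ 𝓗] [CompleteSpace 𝓗]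

/-- An `X`-module: a Hilbert space with a nondegenerate action of `C_0(X)`. -/
structure XModule (X : Type*) [MetricSpace X] (𝓗 : Type*) [NormedAddCommGroup 𝓗]
    [InnerProductSpace ℂ 𝓗] [CompleteSpace 𝓗] where
  rep : C₀(X, ℂ) →⋆ₙₐ[ℂ] (𝓗 →L[ℂ] 𝓗)
  nondegenerate : (Submodule.span ℂ {w : 𝓗 | ∃ f v, rep f v = w}).topologicalClosure = ⊤

/-- `P` is the operator by which the indicator function of `S` acts: `⟨v, P v⟩ = μ_v(S)` where
`μ_v` is the finite Borel measure with `⟨v, f v⟩ = ∫ f dμ_v` for all `f ∈ C_0(X)`. -/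
def XModule.IsIndicator (M : XModule X 𝓗) (S : Set X) (P : 𝓗 →L[ℂ] 𝓗) : Prop :=
  ∀ (v : 𝓗) (μ : MeasureTheory.Measure X), MeasureTheory.IsFiniteMeasure μ →
    (∀ f : C₀(X, ℂ), ∫ x, f x ∂μ = inner ℂ v (M.rep f v)) → inner ℂ v (P v) = (μ.real S : ℂ)

open Classical in
/-- The projection `χ_S` on `𝓗`, for a Borel set `S ⊆ X`: the action of the indicator function of
`S` under the extension of the action of `C_0(X)` to bounded Borel functions. -/
def XModule.chi (M : XModule X 𝓗) (S : Set X) : 𝓗 →L[ℂ] 𝓗 :=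
  if h : ∃ P, M.IsIndicator S P then h.choose else 0

def XModule.LocallyCompact (M : XModule X 𝓗) (T : 𝓗 →L[ℂ] 𝓗) : Prop :=
  ∀ S : Set X, MeasurableSet S → Bornology.IsBounded S →
    IsCompactOperator (M.chi S * T) ∧ IsCompactOperator (T * M.chi S)

def XModule.FinitePropagation (M : XModule X 𝓗) (T : 𝓗 →L[ℂ] 𝓗) : Prop :=
  ∃ r : ℝ, 0 ≤ r ∧ ∀ V W : Set X, MeasurableSet V → MeasurableSet W →
    (∀ x ∈ V, ∀ y ∈ W, r < dist x y) → M.chi V * T * M.chi W = 0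

/-- The Roe algebra: the norm closure of the algebra of locally compact operators of finite
propagation. -/
def XModule.roe (M : XModule X 𝓗) : NonUnitalStarSubalgebra ℂ (𝓗 →L[ℂ] 𝓗) :=
  (NonUnitalStarAlgebra.adjoin ℂ
    {T | M.LocallyCompact T ∧ M.FinitePropagation T}).topologicalClosure

/-- The closed thickening `B_r(Y)`. -/
def thickening (r : ℝ) (Y : Set X) : Set X := {x | ∃ y ∈ Y, dist x y ≤ r}

/-- The big family `{Y}` of all subsets of uniform thickenings of `Y`. -/
def bigFamily (Y : Set X) : Set (Set X) := {Z | ∃ r > 0, Z ⊆ thickening r Y}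

/-- The intersection of two big families. -/
def familyInter (𝒴 𝒵 : Set (Set X)) : Set (Set X) := Set.image2 (· ∩ ·) 𝒴 𝒵

/-- The coarse boundary `∂Y = {Y} ∩ {X \ Y}`. -/
def coarseBoundary (Y : Set X) : Set (Set X) := familyInter (bigFamily Y) (bigFamily Yᶜ)

/-- `T` is supported in the family `𝒴`: for some `Z ∈ 𝒴`, `f T = T f = 0` for all `f` supported in
`X \ Z`. As `f = f χ_S` for `S = {f ≠ 0}`, it suffices to take for `f` the indicator functions. -/
def XModule.SupportedIn (M : XModule X 𝓗) (𝒴 : Set (Set X)) (T : 𝓗 →L[ℂ] 𝓗) : Prop :=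
  ∃ Z ∈ 𝒴, ∀ S : Set X, MeasurableSet S → S ⊆ Zᶜ → M.chi S * T = 0 ∧ T * M.chi S = 0

/-- The Roe algebra localized at a big family. -/
def XModule.localizedRoe (M : XModule X 𝓗) (𝒴 : Set (Set X)) :
    NonUnitalStarSubalgebra ℂ (𝓗 →L[ℂ] 𝓗) :=
  (NonUnitalStarAlgebra.adjoin ℂ
    {T | T ∈ M.roe ∧ M.SupportedIn 𝒴 T}).topologicalClosure

/-- `Y` and `W` are transversal: every member of `∂Y ∩ ∂W` is bounded. -/
def Transversal (Y W : Set X) : Prop :=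
  ∀ Z ∈ familyInter (coarseBoundary Y) (coarseBoundary W), Bornology.IsBounded Z

/-! ### The Mayer–Vietoris boundary map -/

/-- The inclusion `M_n(S⁺) → M_n(B(𝓗)⁺)` for a subalgebra `S` of `B(𝓗)`. -/
def matIncl (S : NonUnitalStarSubalgebra ℂ (𝓗 →L[ℂ] 𝓗)) {n : ℕ}
    (a : Matrix (Fin n) (Fin n) (Unitization ℂ S)) :
    Matrix (Fin n) (Fin n) (Unitization ℂ (𝓗 →L[ℂ] 𝓗)) :=
  a.map (Unitization.starMap (NonUnitalStarSubalgebraClass.subtype S))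

/-- For `A = I₁ + I₂` with ideals `I₁, I₂`, the self-adjoint matrix `a ∈ M_n(I₁⁺)` lifts the image
of `p ∈ M_n(A⁺)` in `M_n((A/I₂)⁺) = M_n((I₁/(I₁ ∩ I₂))⁺)`. -/
def IsLift {A I₁ : NonUnitalStarSubalgebra ℂ (𝓗 →L[ℂ] 𝓗)}
    (I₂ : NonUnitalStarSubalgebra ℂ (𝓗 →L[ℂ] 𝓗)) {n : ℕ}
    (p : Matrix (Fin n) (Fin n) (Unitization ℂ A))
    (a : Matrix (Fin n) (Fin n) (Unitization ℂ I₁)) : Prop :=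
  IsSelfAdjoint a ∧ ∀ i j, (a i j).fst = (p i j).fst ∧
    ((p i j).snd : 𝓗 →L[ℂ] 𝓗) - ((a i j).snd : 𝓗 →L[ℂ] 𝓗) ∈ I₂

/-- `d : K_0(A) → K_1(J)` is the Mayer–Vietoris boundary map of `A = I₁ + I₂`, `J = I₁ ∩ I₂`, i.e.
the composition of `K_0(A) → K_0(A/I₂) = K_0(I₁/J)` with the exponential map
`K_0(I₁/J) → K_1(J)`, `[q] ↦ [exp(2πi a)]`, where `a` is any self-adjoint lift of `q`. -/
def IsMayerVietorisBoundary (A I₁ I₂ J : NonUnitalStarSubalgebra ℂ (𝓗 →L[ℂ] 𝓗))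
    (d : K0 A →+ K1 J) : Prop :=
  (∀ (n : ℕ) (p : ProjMat (Unitization ℂ A) n),
    ∃ a : Matrix (Fin n) (Fin n) (Unitization ℂ I₁), IsLift I₂ p.1 a) ∧
  ∀ (n : ℕ) (p q : ProjMat (Unitization ℂ A) n) (h : ∀ i j, (p.1 i j).fst = (q.1 i j).fst)
    (a b : Matrix (Fin n) (Fin n) (Unitization ℂ I₁)), IsLift I₂ p.1 a → IsLift I₂ q.1 b →
    ∃ u v : UnitaryMat (Unitization ℂ J) n,
      matIncl J u.1 = NormedSpace.exp ((2 * Real.pi * Complex.I : ℂ) • matIncl I₁ a) ∧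
      matIncl J v.1 = NormedSpace.exp ((2 * Real.pi * Complex.I : ℂ) • matIncl I₁ b) ∧
      d (k0Diff p q h) = k1Class u - k1Class v

open Classical in
/-- The Mayer–Vietoris boundary map `∂ : K_0(C*_Roe(X)) → K_1(C*_Roe(∂Y))`. -/
def XModule.mvBoundary (M : XModule X 𝓗) (Y : Set X) :
    K0 M.roe →+ K1 (M.localizedRoe (coarseBoundary Y)) :=
  if h : ∃ d, IsMayerVietorisBoundary M.roe (M.localizedRoe (bigFamily Y))
      (M.localizedRoe (bigFamily Yᶜ)) (M.localizedRoe (coarseBoundary Y)) d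
  then h.choose else 0

/-! ### The index functional -/

/-- The operator on `𝓗ⁿ` given by a matrix of operators. -/
def matrixOp {n : ℕ} (T : Matrix (Fin n) (Fin n) (𝓗 →L[ℂ] 𝓗)) :
    (Fin n → 𝓗) →L[ℂ] (Fin n → 𝓗) :=
  ContinuousLinearMap.pi fun i => ∑ j, (T i j).comp (ContinuousLinearMap.proj j)

/-- The index of a Fredholm operator. -/
def fredholmIndex {E : Type*} [NormedAddCommGroup E] [NormedSpace ℂ E] (T : E →L[ℂ] E) : ℤ :=
  (Module.finrank ℂ (LinearMap.ker (T : E →ₗ[ℂ] E)) : ℤ) -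
    (Module.finrank ℂ (E ⧸ LinearMap.range (T : E →ₗ[ℂ] E)) : ℤ)

/-- The operator `F_u = χ_W u χ_W + χ_{X \ W}` on `𝓗ⁿ`, for `u ∈ M_n(J⁺)`. -/
def XModule.compression (M : XModule X 𝓗) (W : Set X)
    {J : NonUnitalStarSubalgebra ℂ (𝓗 →L[ℂ] 𝓗)} {n : ℕ}
    (u : Matrix (Fin n) (Fin n) (Unitization ℂ J)) : (Fin n → 𝓗) →L[ℂ] (Fin n → 𝓗) :=
  matrixOp fun i j =>
    M.chi W * Unitization.starLift (NonUnitalStarSubalgebraClass.subtype J) (u i j) * M.chi W +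
      if i = j then M.chi Wᶜ else 0

/-- `θ` is the homomorphism `[u] ↦ index(F_u)`. -/
def XModule.IsIndexMap (M : XModule X 𝓗) (W : Set X)
    (J : NonUnitalStarSubalgebra ℂ (𝓗 →L[ℂ] 𝓗)) (θ : K1 J →+ ℤ) : Prop :=
  ∀ (n : ℕ) (u : UnitaryMat (Unitization ℂ J) n),
    (M.compression W u.1).IsFredholm ∧ θ (k1Class u) = fredholmIndex (M.compression W u.1)

open Classical in
/-- The functional `θ_W : K_1(C*_Roe(∂Y)) → ℤ`, `[u] ↦ index(F_u)`. -/
def XModule.theta (M : XModule X 𝓗) (Y W : Set X) :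
    K1 (M.localizedRoe (coarseBoundary Y)) →+ ℤ :=
  if h : ∃ θ, M.IsIndexMap W (M.localizedRoe (coarseBoundary Y)) θ then h.choose else 0

/-! ### Trace class operators -/

/-- `T` is trace class: `∑ ⟨b_i, |T| b_i⟩ < ∞` for an orthonormal basis `b`. -/
def IsTraceClass (T : 𝓗 →L[ℂ] 𝓗) : Prop :=
  ∃ (w : Set 𝓗) (b : HilbertBasis w ℂ 𝓗),
    Summable fun i => (inner ℂ (b i) (CFC.abs T (b i))).re

/-- The trace `∑ ⟨b_i, T b_i⟩` of a trace class operator, in some orthonormal basis `b`. -/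
def opTrace (T : 𝓗 →L[ℂ] 𝓗) : ℂ :=
  ∑' i, inner ℂ ((exists_hilbertBasis ℂ 𝓗).choose_spec.choose i)
    (T ((exists_hilbertBasis ℂ 𝓗).choose_spec.choose i))

/-! ### Hamiltonians -/

/-- `f(T)` for a self-adjoint operator `T` and a complex-valued function `f` on the real line. -/
def funcCalc (f : ℝ → ℂ) (T : 𝓗 →L[ℂ] 𝓗) : 𝓗 →L[ℂ] 𝓗 := cfc (fun z : ℂ => f z.re) T

/-- The Fermi projection `p_E`: the spectral projection of `H` for the spectrum below `E`. -/
def fermiProj (H : 𝓗 →L[ℂ] 𝓗) (E : ℝ) : 𝓗 →L[ℂ] 𝓗 :=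
  cfc (fun x : ℝ => if x < E then (1 : ℝ) else 0) H

theorem isStarProjection_fermiProj (H : 𝓗 →L[ℂ] 𝓗) (E : ℝ) :
    IsStarProjection (fermiProj H E) := by
  refine ⟨?_, IsSelfAdjoint.cfc⟩
  unfold fermiProj IsIdempotentElem
  by_cases hc : ContinuousOn (fun x : ℝ => if x < E then (1 : ℝ) else 0) (spectrum ℝ H)
  · rw [← cfc_mul _ _ H hc hc]
    congr 1
    ext x
    split_ifs <;> simp
  · rw [cfc_apply_of_not_continuousOn _ hc, mul_zero]

theorem fermiProj_mem_or {A : NonUnitalStarSubalgebra ℂ (𝓗 →L[ℂ] 𝓗)}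
    (hA : IsClosed (A : Set (𝓗 →L[ℂ] 𝓗))) {H : 𝓗 →L[ℂ] 𝓗} (hH : H ∈ A)
    (hsa : IsSelfAdjoint H) {E : ℝ} (hE : E ∉ spectrum ℝ H) :
    fermiProj H E ∈ A ∨ 1 - fermiProj H E ∈ A := by
  have hcl : IsClosed (spectrum ℝ H) := spectrum.isClosed H
  have hloc : ∀ x : ℝ, x ≠ E → ContinuousAt (fun x : ℝ => if x < E then (1 : ℝ) else 0) x := by
    intro x hx
    rcases lt_or_gt_of_ne hx with h | h
    · refine (continuousAt_const (y := (1 : ℝ))).congr ?_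
      filter_upwards [Iio_mem_nhds h] with y hy
      exact (if_pos hy).symm
    · refine (continuousAt_const (y := (0 : ℝ))).congr ?_
      filter_upwards [Ioi_mem_nhds h] with y hy
      exact (if_neg (not_lt.mpr (le_of_lt hy))).symm
  have hq : ContinuousOn (fun x : ℝ => if x < E then (1 : ℝ) else 0) (quasispectrum ℝ H) := by
    intro x hx
    by_cases hxE : x = E
    · rw [quasispectrum_eq_spectrum_union_zero] at hx ⊢
      subst hxE
      have h0 : x = 0 := by simpa [hE] using hx
      have : nhdsWithin x (spectrum ℝ H ∪ {0}) = pure x := by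
        rw [nhdsWithin_union, h0, nhdsWithin_singleton, sup_eq_right, ← h0]
        have : nhdsWithin x (spectrum ℝ H) = ⊥ := by
          rw [← notMem_closure_iff_nhdsWithin_eq_bot, hcl.closure_eq]
          exact hE
        rw [this]; exact bot_le
      rw [ContinuousWithinAt, this]
      exact tendsto_pure_nhds _ _
    · exact (hloc x hxE).continuousWithinAt
  have hs : ContinuousOn (fun x : ℝ => if x < E then (1 : ℝ) else 0) (spectrum ℝ H) :=
    hq.mono (spectrum_subset_quasispectrum ℝ H)
  by_cases h0 : (0 : ℝ) < E
  · right
    have h1 : 1 - fermiProj H E = cfc (fun x : ℝ => 1 - if x < E then (1 : ℝ) else 0) H := by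
      rw [cfc_sub _ _ H continuousOn_const hs, cfc_const_one ℝ H]
      rfl
    have hq' : ContinuousOn (fun x : ℝ => 1 - if x < E then (1 : ℝ) else 0)
        (quasispectrum ℝ H) := continuousOn_const.sub hq
    rw [h1, ← cfcₙ_eq_cfc hq' (by simp [h0])]
    exact cfcₙ_mem (𝕜' := ℂ) (hs := hA) _ hH
  · left
    rw [fermiProj, ← cfcₙ_eq_cfc hq (by simp [h0])]
    exact cfcₙ_mem (𝕜' := ℂ) (hs := hA) _ hH

open Classical in
/-- The class `[p_E] ∈ K_0(A)` of the Fermi projection of a Hamiltonian `H ∈ A`. If `p_E ∉ A`,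
which can only happen if `A` has no unit, then `p_E ∈ A⁺` and `1 - p_E ∈ A`; in this case `[p_E]`
stands for the component `[p_E] - [1] = -[1 - p_E]` of `[p_E]` in
`K_0(A⁺) = K_0(A) ⊕ ℤ[1]`. -/
def fermiClass {A : NonUnitalStarSubalgebra ℂ (𝓗 →L[ℂ] 𝓗)}
    (hA : IsClosed (A : Set (𝓗 →L[ℂ] 𝓗))) {H : 𝓗 →L[ℂ] 𝓗} (hH : H ∈ A)
    (hsa : IsSelfAdjoint H) {E : ℝ} (hE : E ∉ spectrum ℝ H) : K0 A :=
  if h : fermiProj H E ∈ A then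
    projClass (⟨fermiProj H E, h⟩ : A)
      ⟨Subtype.ext (isStarProjection_fermiProj H E).isIdempotentElem,
        Subtype.ext (isStarProjection_fermiProj H E).isSelfAdjoint⟩
  else
    -projClass (⟨1 - fermiProj H E, (fermiProj_mem_or hA hH hsa hE).resolve_left h⟩ : A)
      ⟨Subtype.ext (isStarProjection_fermiProj H E).one_sub.isIdempotentElem,
        Subtype.ext (isStarProjection_fermiProj H E).one_sub.isSelfAdjoint⟩

theorem XModule.isClosed_roe (M : XModule X 𝓗) :
    IsClosed (M.roe : Set (𝓗 →L[ℂ] 𝓗)) :=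
  NonUnitalStarSubalgebra.isClosed_topologicalClosure _

/-- The bounded self-adjoint operator `H'` is a Hamiltonian on `Y` adapted to the bounded
Hamiltonian `H`. Functions of bounded operators belong to the (in general non-unital) Roe algebras
only if they vanish at `0`, hence this condition on `f`. -/
def XModule.IsAdapted (M : XModule X 𝓗) (Y : Set X) (H H' : 𝓗 →L[ℂ] 𝓗) : Prop :=
  IsSelfAdjoint H' ∧ ∀ f : C₀(ℝ, ℂ), f 0 = 0 →
    funcCalc f H' ∈ M.localizedRoe (bigFamily Y) ∧
    funcCalc f H - funcCalc f H' ∈ M.localizedRoe (bigFamily Yᶜ)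

end CoarseEdge

end

open CoarseEdge

open scoped ZeroAtInfty

noncomputable section

set_option linter.unusedSectionVars false
set_option linter.unusedSimpArgs false

namespace CoarseEdge

/-! Write h for the adapted Hamiltonian, P for χ_W, [x, P] for xP - Px, and c for the integer
θ_W(∂[p_E]). A topological half of the argument produces a whole family of unitaries whose
compressions by P have index c. An analytic half computes this index as a trace.

Topological half. Let g be any continuous step that is 1 on (-∞, a] and 0 on [b, ∞). Because of the
gap p_E = g(H), and because h is adapted to H the operator g(h) is, up to the scalar g(0), a
self-adjoint lift of p_E. Put u = exp(2πi g(h)). Modulo I₂ it is exp(2πi p_E) = 1, and modulo I₁ it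
is a scalar, so [u, P] lies in I₁ ∩ I₂ and is localized at ∂Y. Commutators with P are also localized
at ∂W, and by transversality an operator localized at both boundaries is compact. Hence PuP + (1 -
P) is Fredholm, and its index is c whichever step g is taken (`HasStepIndex`,
`XModule.hasStepIndex_theta`). The scalar g(0) is the delicate point: it is removed by a homotopy if
the Roe algebra contains 1, and by passing to 1 - p_E if p_E is not in the algebra.

Analytic half. If [u, P] is nuclear, Fedosov's formula gives c = Tr(u*[u, P])
(`fredholmIndex_compression`). Under the trace, commutation with P obeys the chain rule: Tr(G
η(h)[f(h), P]) = Tr(G f'(h) η(h)[h, P]) for G commuting with h. This holds for f(x) = x, passes to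
products and absolutely convergent series, hence to exponentials and to Fourier series of C³
functions (`HasCommDeriv`). For f = exp(2πi g) it yields c = 2πi Tr(g'(h) η(h)[h, P]), provided that
η(h)[h, P] is nuclear and η = 1 around the interval on which g descends (`fredholmIndex_step`).

Only φ(h)[h, P] is known to be nuclear, and φ is merely continuous and complex-valued. On an
interval where φ has no zero, multiplication by a local inverse of φ supplies η. Put D = φ(h) i[h,
P]. Since c does not depend on g, the functional ψ ↦ Tr(ψ(h) D) agrees with ψ ↦ -(c/2π) ∫ ψφ, first
for special ψ supported in such an interval, then by linearity, approximation and a partition of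
unity for all continuous ψ with compact support in {φ ≠ 0}. Letting ψ tend to 1 on {φ ≠ 0} gives Tr
D = -c/2π (`index_eq_opTrace`). -/

/-! ### The index of linear maps with finite-dimensional kernel and cokernel -/

section LinearIndex

variable {E F G : Type*} [AddCommGroup E] [Module ℂ E] [AddCommGroup F] [Module ℂ F]
  [AddCommGroup G] [Module ℂ G]

/-- `dim ker f - dim coker f`. -/
def linIndex (f : E →ₗ[ℂ] F) : ℤ :=
  (Module.finrank ℂ (LinearMap.ker f) : ℤ) - (Module.finrank ℂ (F ⧸ LinearMap.range f) : ℤ)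

theorem finite_of_ker_range (f : E →ₗ[ℂ] F) [Module.Finite ℂ (LinearMap.ker f)]
    [Module.Finite ℂ (LinearMap.range f)] : Module.Finite ℂ E :=
  have : Module.Finite ℂ (E ⧸ LinearMap.ker f) := Module.Finite.equiv f.quotKerEquivRange.symm
  Module.Finite.of_submodule_quotient (LinearMap.ker f)

/-- The sequence 0 → ker f → ker gf → ker g → coker f → coker gf → coker g → 0 is exact, so the
alternating sum of the dimensions vanishes. The connecting map ker g → coker f is `κ`; its kernel
ker g ∩ ran f and its cokernel F/(ran f + ker g) are shared with the two outer pieces. -/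
theorem linIndex_comp (g : F →ₗ[ℂ] G) (f : E →ₗ[ℂ] F)
    [hkf : Module.Finite ℂ (LinearMap.ker f)] [hcf : Module.Finite ℂ (F ⧸ LinearMap.range f)]
    [hkg : Module.Finite ℂ (LinearMap.ker g)] [hcg : Module.Finite ℂ (G ⧸ LinearMap.range g)] :
    linIndex (g ∘ₗ f) = linIndex g + linIndex f := by
  -- kernel of the composition
  set φ : LinearMap.ker (g ∘ₗ f) →ₗ[ℂ] F := f.domRestrict (LinearMap.ker (g ∘ₗ f)) with hφ
  have hφr : LinearMap.range φ = LinearMap.ker g ⊓ LinearMap.range f := by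
    rw [hφ, LinearMap.range_domRestrict, LinearMap.ker_comp, Submodule.map_comap_eq, inf_comm]
  have hφk : LinearMap.ker φ ≃ₗ[ℂ] LinearMap.ker f := by
    rw [hφ, LinearMap.ker_domRestrict]
    exact Submodule.comapSubtypeEquivOfLe (LinearMap.ker_le_ker_comp f g)
  have : Module.Finite ℂ (LinearMap.ker φ) := Module.Finite.equiv hφk.symm
  have : Module.Finite ℂ (LinearMap.range φ) := by
    rw [hφr]; exact Submodule.finiteDimensional_inf_left _ _
  have : Module.Finite ℂ (LinearMap.ker (g ∘ₗ f)) := finite_of_ker_range φ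
  have h1 := φ.finrank_range_add_finrank_ker
  rw [hφr, hφk.finrank_eq] at h1
  -- cokernel of the composition
  set ψ : F →ₗ[ℂ] G ⧸ LinearMap.range (g ∘ₗ f) := (Submodule.mkQ _) ∘ₗ g with hψ
  set q : (G ⧸ LinearMap.range (g ∘ₗ f)) →ₗ[ℂ] (G ⧸ LinearMap.range g) :=
    Submodule.factor (LinearMap.range_comp_le_range f g) with hq
  have hψk : LinearMap.ker ψ = LinearMap.range f ⊔ LinearMap.ker g := by
    rw [hψ, LinearMap.ker_comp, Submodule.ker_mkQ, LinearMap.range_comp, Submodule.comap_map_eq]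
  have hψr : LinearMap.range ψ = LinearMap.ker q := by
    ext x
    obtain ⟨y, rfl⟩ := Submodule.mkQ_surjective _ x
    simp only [LinearMap.mem_range, LinearMap.mem_ker, hψ, hq, LinearMap.comp_apply]
    constructor
    · rintro ⟨z, hz⟩
      rw [← hz]
      simp
    · intro h
      have : y ∈ LinearMap.range g := by simpa [Submodule.factor_mk] using h
      obtain ⟨z, rfl⟩ := this
      exact ⟨z, rfl⟩
  have hqr : LinearMap.range q = ⊤ := LinearMap.range_eq_top.mpr (Submodule.factor_surjective _)
  -- the intermediate quotient
  set κ : LinearMap.ker g →ₗ[ℂ] F ⧸ LinearMap.range f :=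
    (Submodule.mkQ _) ∘ₗ (LinearMap.ker g).subtype with hκ
  set r : (F ⧸ LinearMap.range f) →ₗ[ℂ] (F ⧸ (LinearMap.range f ⊔ LinearMap.ker g)) :=
    Submodule.factor le_sup_left with hr
  have hκk : LinearMap.ker κ ≃ₗ[ℂ] (LinearMap.ker g ⊓ LinearMap.range f : Submodule ℂ F) := by
    rw [hκ, LinearMap.ker_comp, Submodule.ker_mkQ]
    exact (Submodule.equivSubtypeMap _ _).trans
      (LinearEquiv.ofEq _ _ (Submodule.map_comap_subtype _ _))
  have hκr : LinearMap.range κ = LinearMap.ker r := by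
    ext x
    obtain ⟨y, rfl⟩ := Submodule.mkQ_surjective _ x
    simp only [LinearMap.mem_range, LinearMap.mem_ker, hκ, hr, LinearMap.comp_apply]
    constructor
    · rintro ⟨⟨z, hz'⟩, hz⟩
      rw [← hz]
      simpa [Submodule.factor_mk] using Submodule.mem_sup_right hz'
    · intro h
      have : y ∈ LinearMap.range f ⊔ LinearMap.ker g := by simpa [Submodule.factor_mk] using h
      obtain ⟨a, ha, b, hb, rfl⟩ := Submodule.mem_sup.1 this
      refine ⟨⟨b, hb⟩, ?_⟩
      rw [eq_comm, ← sub_eq_zero, ← map_sub]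
      simpa using ha
  have hrr : LinearMap.range r = ⊤ := LinearMap.range_eq_top.mpr (Submodule.factor_surjective _)
  have h3 := κ.finrank_range_add_finrank_ker
  have h4 := r.finrank_range_add_finrank_ker
  have : Module.Finite ℂ (F ⧸ (LinearMap.range f ⊔ LinearMap.ker g)) :=
    Module.Finite.of_surjective r (Submodule.factor_surjective _)
  have e5 : (F ⧸ (LinearMap.range f ⊔ LinearMap.ker g)) ≃ₗ[ℂ] LinearMap.ker q :=
    (Submodule.quotEquivOfEq _ _ hψk.symm).trans
      (ψ.quotKerEquivRange.trans (LinearEquiv.ofEq _ _ hψr))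
  have : Module.Finite ℂ (LinearMap.ker q) := Module.Finite.equiv e5
  have : Module.Finite ℂ (G ⧸ LinearMap.range (g ∘ₗ f)) := finite_of_ker_range q
  have h2 := q.finrank_range_add_finrank_ker
  rw [hqr, finrank_top, ← e5.finrank_eq] at h2
  rw [hrr, finrank_top, ← hκr] at h4
  rw [hκk.finrank_eq] at h3
  unfold linIndex
  omega

/-- On E/R, with R the range of f, the map id - f is the identity. Its kernel therefore lies in R
and its cokernel is a quotient of R, so the index is that of an endomorphism of the
finite-dimensional space R, which is zero. -/
theorem linIndex_id_sub (f : E →ₗ[ℂ] E) [Module.Finite ℂ (LinearMap.range f)] :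
    linIndex (LinearMap.id - f) = 0 := by
  set R := LinearMap.range f
  set T : E →ₗ[ℂ] E := LinearMap.id - f
  have hT : ∀ x, T x = x - f x := fun x => rfl
  set g : R →ₗ[ℂ] R := T.restrict (p := R) (q := R) (fun x hx => by
    rw [hT]; exact R.sub_mem hx (LinearMap.mem_range_self f x)) with hg
  have hk : LinearMap.ker T ≤ R := fun x hx => by
    have : x - f x = 0 := hx
    rw [sub_eq_zero.1 this]; exact LinearMap.mem_range_self f x
  have e1 : LinearMap.ker g ≃ₗ[ℂ] LinearMap.ker T := by
    rw [hg, LinearMap.ker_restrict]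
    exact Submodule.comapSubtypeEquivOfLe hk
  set c : R →ₗ[ℂ] E ⧸ LinearMap.range T := (Submodule.mkQ _) ∘ₗ R.subtype with hc
  have hck : LinearMap.ker c = LinearMap.range g := by
    ext ⟨x, hx⟩
    simp only [hc, LinearMap.mem_ker, LinearMap.comp_apply, Submodule.subtype_apply,
      Submodule.mkQ_apply, Submodule.Quotient.mk_eq_zero]
    constructor
    · rintro ⟨y, rfl⟩
      have hy : y ∈ R := by
        have := R.add_mem hx (LinearMap.mem_range_self f y)
        simpa [hT] using this
      exact ⟨⟨y, hy⟩, rfl⟩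
    · rintro ⟨y, hy⟩
      exact ⟨y, congrArg Subtype.val hy⟩
  have hcs : Function.Surjective c := by
    intro x
    obtain ⟨y, rfl⟩ := Submodule.mkQ_surjective _ x
    refine ⟨⟨f y, LinearMap.mem_range_self f y⟩, ?_⟩
    rw [hc, eq_comm, ← sub_eq_zero, LinearMap.comp_apply, ← map_sub]
    change (Submodule.mkQ _) (T y) = 0
    simp
  have e2 : (R ⧸ LinearMap.range g) ≃ₗ[ℂ] (E ⧸ LinearMap.range T) :=
    (Submodule.quotEquivOfEq _ _ hck.symm).trans (c.quotKerEquivOfSurjective hcs)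
  have h1 := g.finrank_range_add_finrank_ker
  have h2 := (LinearMap.range g).finrank_quotient_add_finrank
  rw [e1.finrank_eq] at h1
  rw [e2.finrank_eq] at h2
  unfold linIndex
  omega

theorem linIndex_of_bijective (f : E →ₗ[ℂ] F) (hf : Function.Bijective f) : linIndex f = 0 := by
  have h1 : LinearMap.ker f = ⊥ := LinearMap.ker_eq_bot.2 hf.1
  have h2 : LinearMap.range f = ⊤ := LinearMap.range_eq_top.2 hf.2
  unfold linIndex
  rw [h1, h2]
  have : Subsingleton (F ⧸ (⊤ : Submodule ℂ F)) := Submodule.Quotient.subsingleton_iff.2 rfl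
  simp [Module.finrank_zero_of_subsingleton]

theorem linIndex_conj {E' F' : Type*} [AddCommGroup E'] [Module ℂ E'] [AddCommGroup F']
    [Module ℂ F'] (f : E →ₗ[ℂ] F) (f' : E' →ₗ[ℂ] F') (e : E ≃ₗ[ℂ] E') (e' : F ≃ₗ[ℂ] F')
    (h : ∀ x, e' (f x) = f' (e x)) : linIndex f = linIndex f' := by
  have hk : LinearMap.ker f ≃ₗ[ℂ] LinearMap.ker f' := by
    refine e.ofSubmodules _ _ ?_
    ext x
    simp only [Submodule.mem_map, LinearMap.mem_ker]
    constructor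
    · rintro ⟨y, hy, rfl⟩
      change f' (e y) = 0
      rw [← h, hy, map_zero]
    · intro hx
      refine ⟨e.symm x, ?_, by simp⟩
      apply e'.injective
      rw [h, map_zero, LinearEquiv.apply_symm_apply, hx]
  have hc : (F ⧸ LinearMap.range f) ≃ₗ[ℂ] (F' ⧸ LinearMap.range f') := by
    refine Submodule.Quotient.equiv _ _ e' ?_
    ext x
    simp only [Submodule.mem_map, LinearMap.mem_range]
    constructor
    · rintro ⟨y, ⟨z, rfl⟩, rfl⟩
      exact ⟨e z, (h z).symm⟩
    · rintro ⟨z, rfl⟩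
      refine ⟨f (e.symm z), ⟨_, rfl⟩, ?_⟩
      change e' (f (e.symm z)) = _
      rw [h, LinearEquiv.apply_symm_apply]
  unfold linIndex
  rw [hk.finrank_eq, hc.finrank_eq]

theorem linIndex_prodMap {E' F' : Type*} [AddCommGroup E'] [Module ℂ E'] [AddCommGroup F']
    [Module ℂ F'] (f : E →ₗ[ℂ] F) (f' : E' →ₗ[ℂ] F')
    [Module.Finite ℂ (LinearMap.ker f)] [Module.Finite ℂ (F ⧸ LinearMap.range f)]
    [Module.Finite ℂ (LinearMap.ker f')] [Module.Finite ℂ (F' ⧸ LinearMap.range f')] :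
    linIndex (f.prodMap f') = linIndex f + linIndex f' := by
  have hk : LinearMap.ker (f.prodMap f') ≃ₗ[ℂ] LinearMap.ker f × LinearMap.ker f' := by
    rw [LinearMap.ker_prodMap]
    exact
      { toFun := fun x => (⟨x.1.1, x.2.1⟩, ⟨x.1.2, x.2.2⟩)
        invFun := fun x => ⟨(x.1.1, x.2.1), ⟨x.1.2, x.2.2⟩⟩
        map_add' := fun _ _ => rfl
        map_smul' := fun _ _ => rfl
        left_inv := fun _ => rfl
        right_inv := fun _ => rfl }
  have hc : ((F × F') ⧸ LinearMap.range (f.prodMap f')) ≃ₗ[ℂ]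
      (F ⧸ LinearMap.range f) × (F' ⧸ LinearMap.range f') := by
    refine (Submodule.quotEquivOfEq _ _ ?_).trans (LinearMap.quotKerEquivOfSurjective
      ((LinearMap.range f).mkQ.prodMap (LinearMap.range f').mkQ)
      ((Submodule.mkQ_surjective _).prodMap (Submodule.mkQ_surjective _)))
    rw [LinearMap.ker_prodMap, Submodule.ker_mkQ, Submodule.ker_mkQ, LinearMap.range_prodMap]
  unfold linIndex
  rw [hk.finrank_eq, hc.finrank_eq, Module.finrank_prod, Module.finrank_prod]
  push_cast
  ring

end LinearIndex

/-! ### Fredholm operators on Banach spaces -/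

section Fredholm

open scoped LinearMap.FiniteRangeSetoid

variable {E : Type*} [NormedAddCommGroup E] [NormedSpace ℂ E]

/-- Operators of finite rank. -/
def FiniteRank (T : E →L[ℂ] E) : Prop := Module.Finite ℂ (LinearMap.range (T : E →ₗ[ℂ] E))

theorem FiniteRank.mul_left {T : E →L[ℂ] E} (hT : FiniteRank T) (S : E →L[ℂ] E) :
    FiniteRank (S * T) := by
  unfold FiniteRank at *
  have : LinearMap.range ((S * T : E →L[ℂ] E) : E →ₗ[ℂ] E) =
      (LinearMap.range (T : E →ₗ[ℂ] E)).map (S : E →ₗ[ℂ] E) := LinearMap.range_comp _ _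
  rw [this]
  infer_instance

theorem FiniteRank.mul_right {T : E →L[ℂ] E} (hT : FiniteRank T) (S : E →L[ℂ] E) :
    FiniteRank (T * S) := by
  unfold FiniteRank at *
  exact Submodule.finiteDimensional_of_le (LinearMap.range_comp_le_range (S : E →ₗ[ℂ] E)
    (T : E →ₗ[ℂ] E))

theorem FiniteRank.add {S T : E →L[ℂ] E} (hS : FiniteRank S) (hT : FiniteRank T) :
    FiniteRank (S + T) := by
  unfold FiniteRank at *
  exact Submodule.finiteDimensional_of_le (LinearMap.range_add_le (S : E →ₗ[ℂ] E) (T : E →ₗ[ℂ] E))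

theorem FiniteRank.zero : FiniteRank (0 : E →L[ℂ] E) := by
  unfold FiniteRank
  have : LinearMap.range ((0 : E →L[ℂ] E) : E →ₗ[ℂ] E) = ⊥ := LinearMap.range_zero
  rw [this]
  infer_instance

theorem FiniteRank.sum {ι : Type*} (s : Finset ι) (T : ι → E →L[ℂ] E)
    (h : ∀ i ∈ s, FiniteRank (T i)) : FiniteRank (∑ i ∈ s, T i) :=
  Finset.sum_induction _ FiniteRank (fun _ _ => FiniteRank.add) FiniteRank.zero h

/-- Atkinson's criterion with a parametrix modulo finite rank; together with the converse below it
is the form in which Fredholmness is used throughout. -/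
theorem isFredholm_of_finiteRank (T S : E →L[ℂ] E) (h1 : FiniteRank (1 - S * T))
    (h2 : FiniteRank (1 - T * S)) : T.IsFredholm := by
  refine ContinuousLinearMap.IsFredholm.of_isQuasiInverse (v := S) ⟨?_, ?_⟩
  · unfold LinearMap.IsLeftQuasiInverse
    rw [Setoid.comm, LinearMap.FiniteRangeSetoid.equiv_iff_hasFiniteRange,
      LinearMap.hasFiniteRange_iff_range]
    exact Module.Finite.iff_fg.1 h1
  · unfold LinearMap.IsRightQuasiInverse
    rw [Setoid.comm, LinearMap.FiniteRangeSetoid.equiv_iff_hasFiniteRange,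
      LinearMap.hasFiniteRange_iff_range]
    exact Module.Finite.iff_fg.1 h2

theorem exists_finiteRank_of_isFredholm {T : E →L[ℂ] E} (h : T.IsFredholm) :
    ∃ S : E →L[ℂ] E, FiniteRank (1 - S * T) ∧ FiniteRank (1 - T * S) := by
  obtain ⟨S, h1, h2⟩ := h.exists_isQuasiInverse
  refine ⟨S, ?_, ?_⟩
  · unfold LinearMap.IsLeftQuasiInverse at h1
    rw [Setoid.comm, LinearMap.FiniteRangeSetoid.equiv_iff_hasFiniteRange,
      LinearMap.hasFiniteRange_iff_range] at h1
    exact Module.Finite.iff_fg.2 h1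
  · unfold LinearMap.IsRightQuasiInverse at h2
    rw [Setoid.comm, LinearMap.FiniteRangeSetoid.equiv_iff_hasFiniteRange,
      LinearMap.hasFiniteRange_iff_range] at h2
    exact Module.Finite.iff_fg.2 h2

theorem fredholmIndex_mul {S T : E →L[ℂ] E} (hS : S.IsFredholm) (hT : T.IsFredholm) :
    fredholmIndex (S * T) = fredholmIndex S + fredholmIndex T := by
  have := hS.finite_ker
  have := hT.finite_ker
  have : Module.Finite ℂ (E ⧸ LinearMap.range (S : E →ₗ[ℂ] E)) := hS.finite_coker
  have : Module.Finite ℂ (E ⧸ LinearMap.range (T : E →ₗ[ℂ] E)) := hT.finite_coker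
  exact linIndex_comp (S : E →ₗ[ℂ] E) (T : E →ₗ[ℂ] E)

theorem fredholmIndex_of_isUnit {V : E →L[ℂ] E} (hV : IsUnit V) :
    V.IsFredholm ∧ fredholmIndex V = 0 := by
  obtain ⟨V, rfl⟩ := hV
  refine ⟨isFredholm_of_finiteRank _ (V⁻¹ : (E →L[ℂ] E)ˣ) (by simpa using FiniteRank.zero)
    (by simpa using FiniteRank.zero), linIndex_of_bijective _ ?_⟩
  refine Function.bijective_iff_has_inverse.2 ⟨((V⁻¹ : (E →L[ℂ] E)ˣ) : E →L[ℂ] E), ?_, ?_⟩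
  · intro x
    exact congrArg (fun T : E →L[ℂ] E => T x) V.inv_mul
  · intro x
    exact congrArg (fun T : E →L[ℂ] E => T x) V.mul_inv

theorem fredholmIndex_unit_sub {V F : E →L[ℂ] E} (hV : IsUnit V) (hF : FiniteRank F) :
    (V - F).IsFredholm ∧ fredholmIndex (V - F) = 0 := by
  obtain ⟨V, rfl⟩ := hV
  set G : E →L[ℂ] E := (V⁻¹ : (E →L[ℂ] E)ˣ) * F with hG
  have hGf : FiniteRank G := hF.mul_left _
  have h1 : (V : E →L[ℂ] E) - F = V * (1 - G) := by
    rw [hG, mul_sub, ← mul_assoc, Units.mul_inv, one_mul, mul_one]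
  have h2 : (1 - G).IsFredholm := isFredholm_of_finiteRank _ 1 (by simpa using hGf)
    (by simpa using hGf)
  have h4 : Module.Finite ℂ (LinearMap.range (G : E →ₗ[ℂ] E)) := hGf
  have h3 : fredholmIndex (1 - G) = 0 := linIndex_id_sub (G : E →ₗ[ℂ] E)
  have hU := fredholmIndex_of_isUnit V.isUnit
  refine ⟨isFredholm_of_finiteRank _ (V⁻¹ : (E →L[ℂ] E)ˣ) ?_ ?_, ?_⟩
  · simpa [mul_sub] using hF.mul_left _
  · simpa [sub_mul] using hF.mul_right _
  · rw [h1, fredholmIndex_mul hU.1 h2, hU.2, h3, add_zero]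

variable [CompleteSpace E]

/-- The index is locally constant on the (open) set of Fredholm operators. -/
theorem fredholmIndex_eventually_eq {T : E →L[ℂ] E} (hT : T.IsFredholm) :
    ∃ ε > 0, ∀ T' : E →L[ℂ] E, ‖T' - T‖ < ε → T'.IsFredholm →
      fredholmIndex T' = fredholmIndex T := by
  obtain ⟨S, h1, h2⟩ := exists_finiteRank_of_isFredholm hT
  have hS : S.IsFredholm := isFredholm_of_finiteRank S T h2 h1
  have key : ∀ T' : E →L[ℂ] E, ‖T' - T‖ < (‖S‖ + 1)⁻¹ → T'.IsFredholm →
      fredholmIndex T' = - fredholmIndex S := by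
    intro T' h hT'
    have hlt : ‖S * (T - T')‖ < 1 := by
      have hpos : 0 < ‖S‖ + 1 := by positivity
      calc ‖S * (T - T')‖ ≤ ‖S‖ * ‖T - T'‖ := norm_mul_le _ _
        _ ≤ (‖S‖ + 1) * ‖T' - T‖ := by
          rw [norm_sub_rev]; gcongr; linarith
        _ < (‖S‖ + 1) * (‖S‖ + 1)⁻¹ := by gcongr
        _ = 1 := mul_inv_cancel₀ hpos.ne'
    -- The product S T' is the invertible operator 1 - S(T - T') minus the finite rank operator 1 -
    -- S T, so it has index zero and the index of T' is forced to be minus that of S.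
    have hV : IsUnit (1 - S * (T - T')) := isUnit_one_sub_of_norm_lt_one hlt
    have h5 := (fredholmIndex_unit_sub hV h1).2
    have h6 : 1 - S * (T - T') - (1 - S * T) = S * T' := by noncomm_ring
    rw [h6, fredholmIndex_mul hS hT'] at h5
    linarith
  refine ⟨(‖S‖ + 1)⁻¹, by positivity, fun T' h hT' => ?_⟩
  rw [key T' h hT', key T (by simp; positivity) hT]

/-- The index is constant along norm continuous paths of Fredholm operators. -/
theorem fredholmIndex_path (T : unitInterval → E →L[ℂ] E) (hc : Continuous T)
    (hT : ∀ t, (T t).IsFredholm) : fredholmIndex (T 0) = fredholmIndex (T 1) := by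
  have : IsLocallyConstant fun t => fredholmIndex (T t) := by
    rw [IsLocallyConstant.iff_eventually_eq]
    intro t
    obtain ⟨ε, hε, h⟩ := fredholmIndex_eventually_eq (hT t)
    have := (hc.tendsto t).eventually (Metric.ball_mem_nhds (T t) hε)
    filter_upwards [this] with s hs
    exact h _ (by rwa [← dist_eq_norm]) (hT s)
  exact this.apply_eq_of_preconnectedSpace 0 1

/-- A defect within distance 1 of a finite rank operator F makes S T = V - F with V invertible, and
V⁻¹S is then a parametrix modulo finite rank. This is how compact defects are reduced to finite rank
ones. -/
theorem isFredholm_of_approx {T S : E →L[ℂ] E}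
    (h1 : ∃ F, FiniteRank F ∧ ‖1 - S * T - F‖ < 1) (h2 : ∃ F, FiniteRank F ∧ ‖1 - T * S - F‖ < 1) :
    T.IsFredholm := by
  obtain ⟨F, hF, hF1⟩ := h1
  obtain ⟨G, hG, hG1⟩ := h2
  obtain ⟨V, hV⟩ := isUnit_one_sub_of_norm_lt_one hF1
  obtain ⟨U, hU⟩ := isUnit_one_sub_of_norm_lt_one hG1
  -- left and right quasi-inverses
  set L : E →L[ℂ] E := (V⁻¹ : (E →L[ℂ] E)ˣ) * S with hL
  set R : E →L[ℂ] E := S * (U⁻¹ : (E →L[ℂ] E)ˣ) with hR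
  have hLT : 1 - L * T = (V⁻¹ : (E →L[ℂ] E)ˣ) * F := by
    have : S * T = V - F := by rw [hV]; abel
    rw [hL, mul_assoc, this, mul_sub, Units.inv_mul]; abel
  have hTR : 1 - T * R = G * (U⁻¹ : (E →L[ℂ] E)ˣ) := by
    have : T * S = U - G := by rw [hU]; abel
    rw [hR, ← mul_assoc, this, sub_mul, Units.mul_inv]; abel
  have hneg : ∀ K : E →L[ℂ] E, FiniteRank K → FiniteRank (-K) := fun K hK => by
    simpa using hK.mul_left (-1)
  have f1 : FiniteRank (1 - L * T) := hLT ▸ hF.mul_left _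
  have f2 : FiniteRank (1 - T * R) := hTR ▸ hG.mul_right _
  refine isFredholm_of_finiteRank T L f1 ?_
  -- A left parametrix L and a right parametrix R differ by finite rank, so L works on both sides.
  have : 1 - T * L = (1 - T * R) + (T * ((1 - L * T) * R) + -(T * (L * (1 - T * R)))) := by
    noncomm_ring
  rw [this]
  exact f2.add (((f1.mul_right _).mul_left _).add (hneg _ ((f2.mul_left _).mul_left _)))

end Fredholm

/-! ### Finite rank approximation of compact operators -/

section CompactApprox

variable {𝓗 : Type*} [NormedAddCommGroup 𝓗] [InnerProductSpace ℂ 𝓗]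

/-- Compact operators on a Hilbert space are norm limits of operators of finite rank. -/
theorem exists_finiteRank_norm_sub_lt {T : 𝓗 →L[ℂ] 𝓗} (hT : IsCompactOperator T) {ε : ℝ}
    (hε : 0 < ε) : ∃ F : 𝓗 →L[ℂ] 𝓗, FiniteRank F ∧ ‖T - F‖ < ε := by
  have hc := hT.isCompact_closure_image_closedBall (𝕜₁ := ℂ) (f := (T : 𝓗 →ₗ[ℂ] 𝓗)) 1
  have htb := (hc.totallyBounded.subset subset_closure)
  -- Project onto the span of a finite ε/2-net of the image of the unit ball.
  obtain ⟨s, hs, hcov⟩ := Metric.totallyBounded_iff.1 htb (ε / 2) (by positivity)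
  set U := Submodule.span ℂ s
  have : FiniteDimensional ℂ U := FiniteDimensional.span_of_finite ℂ hs
  refine ⟨U.starProjection * T, ?_, ?_⟩
  · refine FiniteRank.mul_right ?_ T
    unfold FiniteRank
    exact Submodule.finiteDimensional_of_le (S₂ := U) (by rintro _ ⟨x, rfl⟩; simp)
  · refine lt_of_le_of_lt (ContinuousLinearMap.opNorm_le_of_unit_norm (C := ε / 2)
      (by positivity) ?_) (by linarith)
    intro x hx
    have : T x ∈ ⋃ y ∈ s, Metric.ball y (ε / 2) := hcov ⟨x, by simp [hx], rfl⟩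
    simp only [Set.mem_iUnion, Metric.mem_ball] at this
    obtain ⟨y, hy, hd⟩ := this
    have h1 : ‖T x - U.starProjection (T x)‖ ≤ ‖T x - y‖ := by
      rw [Submodule.starProjection_minimal]
      exact ciInf_le ⟨0, by rintro _ ⟨z, rfl⟩; positivity⟩ (⟨y, Submodule.subset_span hy⟩ : U)
    rw [dist_eq_norm] at hd
    exact h1.trans hd.le

end CompactApprox

/-! ### Weak limits of operators -/

section WeakLimit

open Filter Topology

variable {𝓗 : Type*} [NormedAddCommGroup 𝓗] [InnerProductSpace ℂ 𝓗] [CompleteSpace 𝓗]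

theorem inner_polarization (T : 𝓗 →L[ℂ] 𝓗) (x y : 𝓗) :
    inner ℂ x (T y) = (inner ℂ (x + y) (T (x + y)) - inner ℂ (x - y) (T (x - y))
      - Complex.I * inner ℂ (x + Complex.I • y) (T (x + Complex.I • y))
      + Complex.I * inner ℂ (x - Complex.I • y) (T (x - Complex.I • y))) / 4 := by
  simp only [map_add, map_sub, map_smul, inner_add_left, inner_add_right, inner_sub_left,
    inner_sub_right, inner_smul_left, inner_smul_right, Complex.conj_I]
  ring_nf
  simp only [Complex.I_sq]
  ring

theorem clm_ext_inner {S T : 𝓗 →L[ℂ] 𝓗} (h : ∀ v, inner ℂ v (S v) = inner ℂ v (T v)) : S = T := by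
  ext y
  refine ext_inner_left ℂ fun x => ?_
  rw [inner_polarization S, inner_polarization T]
  simp only [h]

theorem tendsto_inner_of_quadratic {T : ℕ → 𝓗 →L[ℂ] 𝓗} {ℓ : 𝓗 → ℂ}
    (h : ∀ v, Tendsto (fun n => inner ℂ v (T n v)) atTop (𝓝 (ℓ v))) (x y : 𝓗) :
    Tendsto (fun n => inner ℂ x (T n y)) atTop (𝓝 ((ℓ (x + y) - ℓ (x - y)
      - Complex.I * ℓ (x + Complex.I • y) + Complex.I * ℓ (x - Complex.I • y)) / 4)) := by
  simp_rw [fun n => inner_polarization (T n) x y]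
  exact ((((h _).sub (h _)).sub ((h _).const_mul _)).add ((h _).const_mul _)).div_const _

/-- By polarization the matrix coefficients converge as soon as the quadratic forms do, and the
limit is a bounded sesquilinear form. Combined with dominated convergence this extends the action of
continuous functions to their pointwise limits. -/
theorem exists_weak_limit {T : ℕ → 𝓗 →L[ℂ] 𝓗} {ℓ : 𝓗 → ℂ}
    (h : ∀ v, Tendsto (fun n => inner ℂ v (T n v)) atTop (𝓝 (ℓ v))) {C : ℝ}
    (hC : ∀ n, ‖T n‖ ≤ C) : ∃ S : 𝓗 →L[ℂ] 𝓗, ∀ v, inner ℂ v (S v) = ℓ v := by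
  choose b hb using fun x y => (⟨_, tendsto_inner_of_quadratic h x y⟩ :
    ∃ l, Tendsto (fun n => inner ℂ x (T n y)) atTop (𝓝 l))
  have hb' : ∀ x y, Tendsto (fun n => inner ℂ (T n y) x) atTop (𝓝 (star (b x y))) := by
    intro x y
    simpa using (hb x y).star
  -- The conjugate form ⟨T y, x⟩ is used because it is conjugate linear in the first variable, as
  -- required for representing it by an operator.
  let B : 𝓗 →ₗ⋆[ℂ] 𝓗 →ₗ[ℂ] ℂ := LinearMap.mk₂'ₛₗ (starRingEnd ℂ) (RingHom.id ℂ)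
    (fun y x => star (b x y))
    (fun y y' x => tendsto_nhds_unique (hb' x (y + y'))
      (by simpa [inner_add_left] using (hb' x y).add (hb' x y')))
    (fun c y x => tendsto_nhds_unique (hb' x (c • y))
      (by simpa [inner_smul_left, mul_comm] using (hb' x y).const_mul (starRingEnd ℂ c)))
    (fun y x x' => tendsto_nhds_unique (hb' (x + x') y)
      (by simpa [inner_add_right] using (hb' x y).add (hb' x' y)))
    (fun c y x => tendsto_nhds_unique (hb' (c • x) y)
      (by simpa [inner_smul_right] using (hb' x y).const_mul c))
  have hB : ∀ y x, ‖B y x‖ ≤ C * ‖y‖ * ‖x‖ := by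
    intro y x
    refine le_of_tendsto (hb' x y).norm (Eventually.of_forall fun n => ?_)
    refine (norm_inner_le_norm _ _).trans ?_
    gcongr
    exact (T n).le_of_opNorm_le (hC n) y
  refine ⟨InnerProductSpace.continuousLinearMapOfBilin (B.mkContinuous₂ C hB), fun v => ?_⟩
  have h1 := InnerProductSpace.continuousLinearMapOfBilin_apply (B.mkContinuous₂ C hB) v v
  rw [← inner_conj_symm, h1]
  have h2 : (B.mkContinuous₂ C hB) v v = star (b v v) := rfl
  rw [h2, tendsto_nhds_unique (h v) (hb v v)]
  simp

/-- The bounds on the quadratic form say that 0 ≤ T ≤ 1 in the operator order. -/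
theorem norm_le_one_of_quadratic {T : 𝓗 →L[ℂ] 𝓗} {q : 𝓗 → ℝ} (h : ∀ v, inner ℂ v (T v) = (q v : ℂ))
    (h0 : ∀ v, 0 ≤ q v) (h1 : ∀ v, q v ≤ ‖v‖ ^ 2) : ‖T‖ ≤ 1 := by
  have h' : ∀ v, inner ℂ (T v) v = (q v : ℂ) := fun v => by
    rw [← inner_conj_symm, h, Complex.conj_ofReal]
  have hT : 0 ≤ T := by
    rw [ContinuousLinearMap.nonneg_iff_isPositive, ContinuousLinearMap.isPositive_iff_complex]
    intro x
    rw [h']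
    simpa using h0 x
  rw [CStarAlgebra.norm_le_one_iff_of_nonneg _ hT, ← sub_nonneg,
    ContinuousLinearMap.nonneg_iff_isPositive, ContinuousLinearMap.isPositive_iff_complex]
  intro x
  have : inner ℂ ((1 - T) x) x = ((‖x‖ ^ 2 - q x : ℝ) : ℂ) := by
    rw [sub_apply, inner_sub_left, h']
    simp [inner_self_eq_norm_sq_to_K]
  rw [this]
  refine ⟨by simp only [Complex.coe_algebraMap, RCLike.re_to_complex, Complex.ofReal_re], ?_⟩
  simpa only [RCLike.re_to_complex, Complex.ofReal_re, sub_nonneg] using h1 x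

end WeakLimit

/-! ### The spectral measures of an `X`-module -/

section Spectral

open Filter Topology MeasureTheory
open scoped CompactlySupported

variable {X : Type*} [MetricSpace X]
  {𝓗 : Type*} [NormedAddCommGroup 𝓗] [InnerProductSpace ℂ 𝓗] [CompleteSpace 𝓗]

/-- A real function of compact support as an element of `C_0(X)`. -/
def ofCc (f : C_c(X, ℝ)) : C₀(X, ℂ) :=
  ⟨⟨fun x => (f x : ℂ), by fun_prop⟩, by
    have : HasCompactSupport fun x => (f x : ℂ) := f.hasCompactSupport.comp_left Complex.ofReal_zero
    exact this.is_zero_at_infty⟩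

@[simp] theorem ofCc_apply (f : C_c(X, ℝ)) (x : X) : ofCc f x = (f x : ℂ) := rfl

theorem ofCc_mul (f g : C_c(X, ℝ)) : ofCc (f * g) = ofCc f * ofCc g := by
  ext x; simp

theorem star_ofCc (f : C_c(X, ℝ)) : star (ofCc f) = ofCc f := by
  ext x; simp

theorem norm_ofCc_le (f : C_c(X, ℝ)) {C : ℝ} (hC : 0 ≤ C) (h : ∀ x, |f x| ≤ C) : ‖ofCc f‖ ≤ C := by
  rw [← ZeroAtInftyContinuousMap.norm_toBCF_eq_norm, BoundedContinuousFunction.norm_le hC]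
  intro x
  change ‖(f x : ℂ)‖ ≤ C
  simpa using h x

theorem XModule.norm_rep_le (M : XModule X 𝓗) (f : C₀(X, ℂ)) : ‖M.rep f‖ ≤ ‖f‖ :=
  NonUnitalStarAlgHom.norm_apply_le M.rep f

/-- With s the square root of f one has f = s*s, so the number is ‖s v‖². This is the positivity
that the Riesz representation theorem requires. -/
theorem XModule.inner_rep_ofCc_of_nonneg (M : XModule X 𝓗) (f : C_c(X, ℝ)) (hf : 0 ≤ f) (v : 𝓗) :
    ∃ r : ℝ, 0 ≤ r ∧ inner ℂ v (M.rep (ofCc f) v) = (r : ℂ) := by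
  set s : C_c(X, ℝ) := f.compLeft ⟨Real.sqrt, Real.continuous_sqrt⟩ with hs
  have hs' : ∀ x, s x = Real.sqrt (f x) := fun x => by
    rw [hs, CompactlySupportedContinuousMap.compLeft_apply (by simp)]; rfl
  have h1 : ofCc f = star (ofCc s) * ofCc s := by
    ext x
    rw [star_ofCc]
    simp only [ofCc_apply, ZeroAtInftyContinuousMap.mul_apply, hs']
    rw [← Complex.ofReal_mul, Real.mul_self_sqrt (hf x)]
  refine ⟨‖M.rep (ofCc s) v‖ ^ 2, by positivity, ?_⟩
  rw [h1, map_mul, map_star, ContinuousLinearMap.star_eq_adjoint, mul_apply_eq_comp,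
    ContinuousLinearMap.adjoint_inner_right, inner_self_eq_norm_sq_to_K]
  simp

/-- The positive functional `f ↦ ⟨v, f v⟩`. -/
def XModule.functional (M : XModule X 𝓗) (v : 𝓗) : C_c(X, ℝ) →ₚ[ℝ] ℝ :=
  PositiveLinearMap.mk₀
    { toFun := fun f => (inner ℂ v (M.rep (ofCc f) v)).re
      map_add' := fun f g => by
        have : ofCc (f + g) = ofCc f + ofCc g := by ext x; simp
        simp [this, inner_add_right]
      map_smul' := fun c f => by
        have : ofCc (c • f) = (c : ℂ) • ofCc f := by ext x; simp
        simp [this, inner_smul_right] }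
    (fun f hf => by
      obtain ⟨r, hr, h⟩ := M.inner_rep_ofCc_of_nonneg f hf v
      change 0 ≤ (inner ℂ v (M.rep (ofCc f) v)).re
      rw [h]; simpa using hr)

theorem XModule.isSelfAdjoint_rep_ofCc (M : XModule X 𝓗) (f : C_c(X, ℝ)) :
    IsSelfAdjoint (M.rep (ofCc f)) := by
  rw [IsSelfAdjoint, ← map_star, star_ofCc]

theorem XModule.inner_rep_ofCc (M : XModule X 𝓗) (f : C_c(X, ℝ)) (v : 𝓗) :
    inner ℂ v (M.rep (ofCc f) v) = (M.functional v f : ℂ) := by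
  have h : M.functional v f = (inner ℂ v (M.rep (ofCc f) v)).re := rfl
  rw [h, eq_comm, ← Complex.conj_eq_iff_re, inner_conj_symm]
  have := M.isSelfAdjoint_rep_ofCc f
  rw [IsSelfAdjoint, ContinuousLinearMap.star_eq_adjoint] at this
  nth_rewrite 1 [← this]
  rw [ContinuousLinearMap.adjoint_inner_left]

variable [ProperSpace X] [MeasurableSpace X] [BorelSpace X]

/-- The measure `μ_v` with `⟨v, f v⟩ = ∫ f dμ_v`. -/
def XModule.specMeasure (M : XModule X 𝓗) (v : 𝓗) : Measure X :=
  RealRMK.rieszMeasure (M.functional v)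

theorem exists_cc_one (K : Set X) (hK : IsCompact K) :
    ∃ f : C_c(X, ℝ), (∀ x ∈ K, f x = 1) ∧ (∀ x, 0 ≤ f x) ∧ ∀ x, f x ≤ 1 := by
  obtain ⟨f, h1, h2, h3, h4⟩ :=
    exists_continuousMap_one_of_isCompact_subset_isOpen hK isOpen_univ (Set.subset_univ K)
  exact ⟨⟨f, hasCompactSupport_def.mpr h2⟩, fun x hx => h1 hx, fun x => (h4 x).1, fun x => (h4 x).2⟩

/-- By inner regularity compact sets suffice. A compact set has measure at most ⟨v, f v⟩ for a
cutoff 0 ≤ f ≤ 1 that is 1 on it, and the representation is contractive. -/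
theorem XModule.specMeasure_univ_le (M : XModule X 𝓗) (v : 𝓗) :
    M.specMeasure v Set.univ ≤ ENNReal.ofReal (‖v‖ ^ 2) := by
  refine le_of_forall_lt fun r hr => ?_
  have hreg : (M.specMeasure v).Regular := by unfold XModule.specMeasure; infer_instance
  obtain ⟨K, -, hK, hrK⟩ := hreg.innerRegular isOpen_univ r hr
  obtain ⟨f, h1, h2, h3⟩ := exists_cc_one K hK
  refine hrK.trans_le ((RealRMK.rieszMeasure_le_of_eq_one _ h2 hK h1).trans ?_)
  apply ENNReal.ofReal_le_ofReal
  have h4 : ‖ofCc f‖ ≤ 1 := norm_ofCc_le f zero_le_one fun x => by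
    rw [abs_of_nonneg (h2 x)]; exact h3 x
  have h5 : M.functional v f = (inner ℂ v (M.rep (ofCc f) v)).re := rfl
  rw [h5]
  calc (inner ℂ v (M.rep (ofCc f) v)).re ≤ ‖inner ℂ v (M.rep (ofCc f) v)‖ := Complex.re_le_norm _
    _ ≤ ‖v‖ * (1 * ‖v‖) := (norm_inner_le_norm _ _).trans (by
        gcongr; exact (M.rep (ofCc f)).le_of_opNorm_le ((M.norm_rep_le _).trans h4) v)
    _ = ‖v‖ ^ 2 := by ring

instance (M : XModule X 𝓗) (v : 𝓗) : IsFiniteMeasure (M.specMeasure v) :=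
  ⟨(M.specMeasure_univ_le v).trans_lt ENNReal.ofReal_lt_top⟩

theorem XModule.integral_specMeasure_cc (M : XModule X 𝓗) (v : 𝓗) (f : C_c(X, ℝ)) :
    inner ℂ v (M.rep (ofCc f) v) = ((∫ x, f x ∂(M.specMeasure v) : ℝ) : ℂ) := by
  rw [M.inner_rep_ofCc, XModule.specMeasure, RealRMK.integral_rieszMeasure]

theorem exists_cc_approx (f : C₀(X, ℂ)) {ε : ℝ} (hε : 0 < ε) :
    ∃ g h : C_c(X, ℝ), ‖f - (ofCc g + Complex.I • ofCc h)‖ ≤ ε := by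
  have h0 : ∀ᶠ x in cocompact X, ‖f x‖ < ε := by
    have := (zero_at_infty f).norm
    rw [norm_zero] at this
    exact this.eventually (gt_mem_nhds hε)
  obtain ⟨K, hK, hKf⟩ := mem_cocompact.1 h0
  obtain ⟨e, h1, h2, h3⟩ := exists_cc_one K hK
  let g : C_c(X, ℝ) := ⟨⟨fun x => (f x).re * e x, by fun_prop⟩, e.hasCompactSupport.mul_left⟩
  let h : C_c(X, ℝ) := ⟨⟨fun x => (f x).im * e x, by fun_prop⟩, e.hasCompactSupport.mul_left⟩
  refine ⟨g, h, ?_⟩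
  rw [← ZeroAtInftyContinuousMap.norm_toBCF_eq_norm, BoundedContinuousFunction.norm_le hε.le]
  intro x
  have h5 : (f - (ofCc g + Complex.I • ofCc h)) x = f x * (1 - e x : ℝ) := by
    have hg : g x = (f x).re * e x := rfl
    have hh : h x = (f x).im * e x := rfl
    simp only [ZeroAtInftyContinuousMap.sub_apply, ZeroAtInftyContinuousMap.add_apply,
      ZeroAtInftyContinuousMap.smul_apply, ofCc_apply, hg, hh, smul_eq_mul]
    have h6 := Complex.re_add_im (f x)
    push_cast
    linear_combination (-(e x : ℂ)) * h6
  change ‖(f - (ofCc g + Complex.I • ofCc h)) x‖ ≤ ε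
  rw [h5, norm_mul, Complex.norm_real, Real.norm_eq_abs, abs_of_nonneg (by linarith [h3 x])]
  by_cases hx : x ∈ K
  · rw [h1 x hx]; simpa using hε.le
  · have : ‖f x‖ < ε := hKf hx
    nlinarith [h2 x, h3 x, norm_nonneg (f x)]

theorem integrable_zeroAtInfty (f : C₀(X, ℂ)) (μ : Measure X) [IsFiniteMeasure μ] :
    Integrable (fun x => f x) μ :=
  BoundedContinuousFunction.integrable μ f.toBCF

theorem XModule.integral_specMeasure (M : XModule X 𝓗) (v : 𝓗) (f : C₀(X, ℂ)) :
    ∫ x, f x ∂(M.specMeasure v) = inner ℂ v (M.rep f v) := by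
  set μ := M.specMeasure v
  rw [← sub_eq_zero, ← norm_le_zero_iff]
  refine le_of_forall_pos_le_add fun δ hδ => ?_
  set C := μ.real Set.univ + ‖v‖ ^ 2
  have hC : 0 ≤ C := by positivity
  -- The denominator is C + 1 because C may vanish.
  obtain ⟨g, h, hgh⟩ := exists_cc_approx f (ε := δ / (C + 1)) (by positivity)
  set k := ofCc g + Complex.I • ofCc h with hk
  have hinteg : ∀ f' : C_c(X, ℝ), ∫ x, ofCc f' x ∂μ = inner ℂ v (M.rep (ofCc f') v) := by
    intro f'
    rw [M.integral_specMeasure_cc]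
    simp only [ofCc_apply]
    exact integral_ofReal
  have hkk : ∫ x, k x ∂μ = inner ℂ v (M.rep k v) := by
    have h1 : ∀ x, k x = ofCc g x + Complex.I * ofCc h x := fun x => rfl
    simp_rw [h1]
    rw [integral_add (integrable_zeroAtInfty _ _) ((integrable_zeroAtInfty _ _).const_mul _),
      integral_const_mul, hinteg, hinteg]
    simp [hk, inner_add_right, inner_smul_right]
  have e1 : ∫ x, f x ∂μ - inner ℂ v (M.rep f v) =
      ∫ x, (f - k) x ∂μ - inner ℂ v (M.rep (f - k) v) := by
    have h1 : ∀ x, (f - k) x = f x - k x := fun x => rfl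
    simp_rw [h1]
    rw [integral_sub (integrable_zeroAtInfty _ _) (integrable_zeroAtInfty _ _), hkk]
    simp [inner_sub_right]
  have e2 : ‖∫ x, (f - k) x ∂μ‖ ≤ δ / (C + 1) * μ.real Set.univ :=
    norm_integral_le_of_norm_le_const (ae_of_all _ fun x =>
      ((f - k).toBCF.norm_coe_le_norm x).trans (by
        rw [ZeroAtInftyContinuousMap.norm_toBCF_eq_norm]; exact hgh))
  have e3 : ‖inner ℂ v (M.rep (f - k) v)‖ ≤ δ / (C + 1) * ‖v‖ ^ 2 := by
    refine (norm_inner_le_norm _ _).trans ?_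
    have := (M.rep (f - k)).le_of_opNorm_le ((M.norm_rep_le _).trans hgh) v
    calc ‖v‖ * ‖M.rep (f - k) v‖ ≤ ‖v‖ * (δ / (C + 1) * ‖v‖) := by gcongr
      _ = _ := by ring
  rw [e1]
  calc _ ≤ δ / (C + 1) * μ.real Set.univ + δ / (C + 1) * ‖v‖ ^ 2 :=
        (norm_sub_le _ _).trans (add_le_add e2 e3)
    _ = δ * (C / (C + 1)) := by simp only [C]; ring
    _ ≤ δ * 1 := by
        gcongr
        rw [div_le_one (by positivity)]; linarith
    _ = 0 + δ := by ring

/-- Uniqueness in the Riesz theorem. The definition of `IsIndicator` quantifies over all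
representing measures; this reduces it to a single one. -/
theorem XModule.eq_specMeasure (M : XModule X 𝓗) (v : 𝓗) (μ : Measure X) [IsFiniteMeasure μ]
    (h : ∀ f : C₀(X, ℂ), ∫ x, f x ∂μ = inner ℂ v (M.rep f v)) : μ = M.specMeasure v := by
  refine Measure.ext_of_integral_eq_on_compactlySupported fun f => ?_
  have h1 := (h (ofCc f)).trans (M.integral_specMeasure_cc v f)
  simp only [ofCc_apply] at h1
  have h2 : ∫ x, (f x : ℂ) ∂μ = ((∫ x, f x ∂μ : ℝ) : ℂ) := integral_ofReal
  rw [h2] at h1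
  exact_mod_cast h1

/-- `T` is the operator by which the bounded Borel function `f` acts. -/
def XModule.Acts (M : XModule X 𝓗) (f : X → ℝ) (T : 𝓗 →L[ℂ] 𝓗) : Prop :=
  ∀ v, inner ℂ v (T v) = ((∫ x, f x ∂(M.specMeasure v) : ℝ) : ℂ)

theorem XModule.isIndicator_iff (M : XModule X 𝓗) {S : Set X} (hS : MeasurableSet S)
    (P : 𝓗 →L[ℂ] 𝓗) : M.IsIndicator S P ↔ M.Acts (S.indicator 1) P := by
  have h0 : ∀ v, ∫ x, S.indicator (1 : X → ℝ) x ∂(M.specMeasure v) = (M.specMeasure v).real S :=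
    fun v => integral_indicator_one hS
  constructor
  · intro h v
    rw [h0, h v (M.specMeasure v) inferInstance (M.integral_specMeasure v)]
  · intro h v μ hμ hf
    rw [h v, h0, M.eq_specMeasure v μ hf]

theorem XModule.Acts.unique {M : XModule X 𝓗} {f : X → ℝ} {S T : 𝓗 →L[ℂ] 𝓗} (hS : M.Acts f S)
    (hT : M.Acts f T) : S = T :=
  clm_ext_inner fun v => (hS v).trans (hT v).symm

theorem integrable_bdd {f : X → ℝ} (hf : Measurable f) {C : ℝ} (h : ∀ x, |f x| ≤ C)
    (μ : Measure X) [IsFiniteMeasure μ] : Integrable f μ :=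
  Integrable.of_bound hf.aestronglyMeasurable C (ae_of_all _ h)

theorem tendsto_integral_bdd {f : ℕ → X → ℝ} {g : X → ℝ} (hf : ∀ n, Measurable (f n)) {C : ℝ}
    (h : ∀ n x, |f n x| ≤ C) (hlim : ∀ x, Tendsto (fun n => f n x) atTop (𝓝 (g x)))
    (μ : Measure X) [IsFiniteMeasure μ] :
    Tendsto (fun n => ∫ x, f n x ∂μ) atTop (𝓝 (∫ x, g x ∂μ)) :=
  tendsto_integral_of_dominated_convergence (fun _ => C) (fun n => (hf n).aestronglyMeasurable)
    (integrable_const C) (fun n => ae_of_all _ (h n)) (ae_of_all _ hlim)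

theorem XModule.Acts.norm_le_one {M : XModule X 𝓗} {f : X → ℝ} {T : 𝓗 →L[ℂ] 𝓗} (hT : M.Acts f T)
    (hf : Measurable f) (h0 : ∀ x, 0 ≤ f x) (h1 : ∀ x, f x ≤ 1) : ‖T‖ ≤ 1 := by
  refine norm_le_one_of_quadratic hT (fun v => integral_nonneg h0) fun v => ?_
  have h2 : (M.specMeasure v).real Set.univ ≤ ‖v‖ ^ 2 :=
    ENNReal.toReal_le_of_le_ofReal (by positivity) (M.specMeasure_univ_le v)
  refine le_trans ?_ h2
  calc ∫ x, f x ∂(M.specMeasure v) ≤ ∫ _, (1 : ℝ) ∂(M.specMeasure v) :=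
        integral_mono (integrable_bdd hf (fun x => by rw [abs_of_nonneg (h0 x)]; exact h1 x) _)
          (integrable_const _) h1
    _ = _ := by simp

theorem XModule.Acts.exists_lim {M : XModule X 𝓗} {f : ℕ → X → ℝ} {g : X → ℝ}
    {T : ℕ → 𝓗 →L[ℂ] 𝓗} (hT : ∀ n, M.Acts (f n) (T n)) (hf : ∀ n, Measurable (f n))
    (h0 : ∀ n x, 0 ≤ f n x) (h1 : ∀ n x, f n x ≤ 1)
    (hlim : ∀ x, Tendsto (fun n => f n x) atTop (𝓝 (g x))) : ∃ S, M.Acts g S := by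
  refine exists_weak_limit (T := T) (C := 1) (fun v => ?_)
    fun n => (hT n).norm_le_one (hf n) (h0 n) (h1 n)
  simp_rw [fun n => hT n v]
  exact (Complex.continuous_ofReal.tendsto _).comp (tendsto_integral_bdd hf
    (C := 1) (fun n x => by rw [abs_of_nonneg (h0 n x)]; exact h1 n x) hlim _)

theorem XModule.Acts.tendsto {M : XModule X 𝓗} {f : ℕ → X → ℝ} {g : X → ℝ}
    {T : ℕ → 𝓗 →L[ℂ] 𝓗} {S : 𝓗 →L[ℂ] 𝓗} (hT : ∀ n, M.Acts (f n) (T n)) (hS : M.Acts g S)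
    (hf : ∀ n, Measurable (f n)) {C : ℝ} (hC : ∀ n x, |f n x| ≤ C)
    (hlim : ∀ x, Tendsto (fun n => f n x) atTop (𝓝 (g x))) (v w : 𝓗) :
    Tendsto (fun n => inner ℂ v (T n w)) atTop (𝓝 (inner ℂ v (S w))) := by
  have := tendsto_inner_of_quadratic (T := T) (ℓ := fun v => inner ℂ v (S v)) (fun v => by
    simp_rw [fun n => hT n v, hS v]
    exact (Complex.continuous_ofReal.tendsto _).comp (tendsto_integral_bdd hf hC hlim _)) v w
  rwa [← inner_polarization] at this

/-- Continuous functions decreasing to the indicator of F are multiplied by cutoffs of a compact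
exhaustion, which exists because X is proper. -/
theorem exists_cc_approx_isClosed {F : Set X} (hF : IsClosed F) :
    ∃ f : ℕ → C_c(X, ℝ), (∀ n x, 0 ≤ f n x) ∧ (∀ n x, f n x ≤ 1) ∧
      ∀ x, Tendsto (fun n => f n x) atTop (𝓝 (F.indicator 1 x)) := by
  choose e he1 he2 he3 using fun n => exists_cc_one (compactCovering X n)
    (isCompact_compactCovering X n)
  refine ⟨fun n => ⟨⟨fun x => (hF.apprSeq n x : ℝ) * e n x, by fun_prop⟩,
    (e n).hasCompactSupport.mul_left⟩, fun n x => ?_, fun n x => ?_, fun x => ?_⟩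
  · exact mul_nonneg (NNReal.coe_nonneg _) (he2 n x)
  · exact mul_le_one₀ (by exact_mod_cast HasOuterApproxClosed.apprSeq_apply_le_one hF n x)
      (he2 n x) (he3 n x)
  · change Tendsto (fun n => (hF.apprSeq n x : ℝ) * e n x) atTop _
    have h1 := tendsto_pi_nhds.1 (HasOuterApproxClosed.tendsto_apprSeq hF) x
    have h2 : Tendsto (fun n => (hF.apprSeq n x : ℝ)) atTop (𝓝 (F.indicator 1 x)) := by
      have := (NNReal.continuous_coe.tendsto _).comp h1
      have h4 : ((F.indicator (fun _ => (1 : NNReal)) x : NNReal) : ℝ) = F.indicator 1 x := by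
        by_cases hx : x ∈ F <;> simp [hx]
      rwa [h4] at this
    have h3 : Tendsto (fun n => e n x) atTop (𝓝 1) := by
      obtain ⟨N, hN⟩ := exists_mem_compactCovering x
      refine tendsto_const_nhds.congr' ?_
      filter_upwards [eventually_ge_atTop N] with n hn
      exact (he1 n x (compactCovering_subset X hn hN)).symm
    simpa using h2.mul h3

theorem XModule.acts_ofCc (M : XModule X 𝓗) (f : C_c(X, ℝ)) : M.Acts f (M.rep (ofCc f)) :=
  fun v => M.integral_specMeasure_cc v f

theorem XModule.Acts.sub {M : XModule X 𝓗} {f g : X → ℝ} {S T : 𝓗 →L[ℂ] 𝓗} (hS : M.Acts f S)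
    (hT : M.Acts g T) (hf : ∀ v, Integrable f (M.specMeasure v))
    (hg : ∀ v, Integrable g (M.specMeasure v)) : M.Acts (fun x => f x - g x) (S - T) := fun v => by
  rw [integral_sub (hf v) (hg v), sub_apply, inner_sub_right, hS v, hT v]
  push_cast
  rfl

theorem XModule.Acts.add {M : XModule X 𝓗} {f g : X → ℝ} {S T : 𝓗 →L[ℂ] 𝓗} (hS : M.Acts f S)
    (hT : M.Acts g T) (hf : ∀ v, Integrable f (M.specMeasure v))
    (hg : ∀ v, Integrable g (M.specMeasure v)) : M.Acts (fun x => f x + g x) (S + T) := fun v => by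
  rw [integral_add (hf v) (hg v), add_apply, inner_add_right, hS v, hT v]
  push_cast
  rfl

theorem XModule.acts_zero (M : XModule X 𝓗) : M.Acts (fun _ => 0) 0 := fun v => by simp

theorem XModule.Acts.adjoint {M : XModule X 𝓗} {f : X → ℝ} {T : 𝓗 →L[ℂ] 𝓗} (hT : M.Acts f T) :
    M.Acts f (star T) := fun v => by
  rw [ContinuousLinearMap.star_eq_adjoint, ContinuousLinearMap.adjoint_inner_right,
    ← inner_conj_symm, hT v, Complex.conj_ofReal]

/-- Nondegeneracy enters here. The weak limit T of an increasingly large family of cutoffs satisfies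
T f = f for f in C_c(X), hence for f in C₀(X). The vectors f v span a dense subspace, so T = 1. -/
theorem XModule.acts_one (M : XModule X 𝓗) : M.Acts (fun _ => 1) 1 := by
  obtain ⟨f, h0, h1, hlim⟩ := exists_cc_approx_isClosed (isClosed_univ (X := X))
  simp only [Set.indicator_univ, Pi.one_apply] at hlim
  have hm : ∀ n, Measurable (f n) := fun n => (f n).continuous.measurable
  have hb : ∀ n x, |f n x| ≤ 1 := fun n x => by rw [abs_of_nonneg (h0 n x)]; exact h1 n x
  obtain ⟨T, hT⟩ := XModule.Acts.exists_lim (fun n => M.acts_ofCc (f n)) hm h0 h1 hlim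
  have hwk := XModule.Acts.tendsto (fun n => M.acts_ofCc (f n)) hT hm hb hlim
  have hTg : ∀ g : C_c(X, ℝ), T * M.rep (ofCc g) = M.rep (ofCc g) := by
    intro g
    refine clm_ext_inner fun v => tendsto_nhds_unique (hwk v (M.rep (ofCc g) v)) ?_
    have h3 : ∀ n, inner ℂ v (M.rep (ofCc (f n)) (M.rep (ofCc g) v)) =
        ((∫ x, f n x * g x ∂(M.specMeasure v) : ℝ) : ℂ) := fun n => by
      rw [← mul_apply_eq_comp, ← map_mul, ← ofCc_mul, M.integral_specMeasure_cc]; rfl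
    simp_rw [h3, M.integral_specMeasure_cc v g]
    refine (Complex.continuous_ofReal.tendsto _).comp ?_
    obtain ⟨C, hC⟩ : ∃ C, ∀ x, ‖g x‖ ≤ C := g.hasCompactSupport.exists_bound_of_continuous g.continuous
    refine tendsto_integral_bdd (C := 1 * C) (fun n => ((f n).continuous.mul g.continuous).measurable)
      (fun n x => ?_) (fun x => by simpa using (hlim x).mul_const (g x)) _
    change |f n x * g x| ≤ _
    rw [abs_mul]
    exact mul_le_mul (hb n x) (hC x) (abs_nonneg _) zero_le_one
  have hTf : ∀ g : C₀(X, ℂ), T * M.rep g = M.rep g := by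
    intro g
    rw [← sub_eq_zero, ← norm_le_zero_iff]
    refine le_of_forall_pos_le_add fun δ hδ => ?_
    obtain ⟨g1, g2, hg⟩ := exists_cc_approx g (ε := δ / (‖T - 1‖ + 1)) (by positivity)
    set k := ofCc g1 + Complex.I • ofCc g2 with hk
    have hk' : T * M.rep k = M.rep k := by
      rw [hk, map_add, map_smul, mul_add, mul_smul_comm, hTg, hTg]
    have e1 : T * M.rep g - M.rep g = (T - 1) * M.rep (g - k) := by
      rw [map_sub, sub_mul, one_mul, mul_sub, hk']; abel
    rw [e1]
    calc _ ≤ ‖T - 1‖ * (δ / (‖T - 1‖ + 1)) :=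
          (norm_mul_le _ _).trans (by gcongr; exact (M.norm_rep_le _).trans hg)
      _ = δ * (‖T - 1‖ / (‖T - 1‖ + 1)) := by ring
      _ ≤ δ * 1 := by
          gcongr
          rw [div_le_one (by positivity)]; linarith
      _ = 0 + δ := by ring
  have hT1 : T = 1 := by
    refine ContinuousLinearMap.ext_on (s := {w : 𝓗 | ∃ f v, M.rep f v = w}) ?_ ?_
    · have := M.nondegenerate
      rw [Submodule.dense_iff_topologicalClosure_eq_top]
      exact this
    · rintro _ ⟨g, v, rfl⟩
      exact congrArg (fun S : 𝓗 →L[ℂ] 𝓗 => S v) (hTf g)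
  exact hT1 ▸ hT

theorem indicator_measurable {S : Set X} (hS : MeasurableSet S) :
    Measurable (S.indicator (1 : X → ℝ)) := measurable_one.indicator hS

theorem indicator_nonneg' (S : Set X) (x : X) : 0 ≤ S.indicator (1 : X → ℝ) x :=
  Set.indicator_nonneg (fun _ _ => zero_le_one) x

theorem indicator_le_one' (S : Set X) (x : X) : S.indicator (1 : X → ℝ) x ≤ 1 :=
  Set.indicator_le_self' (fun _ _ => zero_le_one) x

theorem abs_indicator_le_one (S : Set X) (x : X) : |S.indicator (1 : X → ℝ) x| ≤ 1 := by
  rw [abs_of_nonneg (indicator_nonneg' S x)]; exact indicator_le_one' S x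

theorem indicator_partialUnion (f : ℕ → Set X) (hd : Pairwise (Function.onFun Disjoint f)) (n : ℕ)
    (x : X) : (⋃ i < n + 1, f i).indicator (1 : X → ℝ) x =
      (⋃ i < n, f i).indicator 1 x + (f n).indicator 1 x := by
  have h1 : (⋃ i < n + 1, f i) = (⋃ i < n, f i) ∪ f n := by
    ext y
    simp only [Set.mem_iUnion, Set.mem_union, exists_prop, Nat.lt_succ_iff_lt_or_eq, or_and_right,
      exists_or, exists_eq_left]
  have h2 : Disjoint (⋃ i < n, f i) (f n) := by
    simp only [Set.disjoint_iUnion_left]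
    exact fun i hi => hd hi.ne
  rw [h1, Set.indicator_union_of_disjoint h2]

theorem tendsto_indicator_partialUnion (f : ℕ → Set X) (x : X) :
    Tendsto (fun n => (⋃ i < n, f i).indicator (1 : X → ℝ) x) atTop
      (𝓝 ((⋃ i, f i).indicator 1 x)) := by
  by_cases hx : x ∈ ⋃ i, f i
  · obtain ⟨N, hN⟩ := Set.mem_iUnion.1 hx
    refine tendsto_const_nhds.congr' ?_
    filter_upwards [eventually_gt_atTop N] with n hn
    rw [Set.indicator_of_mem hx, Set.indicator_of_mem]
    exact Set.mem_biUnion hn hN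
  · have : ∀ n, x ∉ ⋃ i < n, f i := fun n h => hx (by
      simp only [Set.mem_iUnion] at h ⊢
      obtain ⟨i, -, hi⟩ := h
      exact ⟨i, hi⟩)
    simp [hx, this]

theorem measurableSet_partialUnion {f : ℕ → Set X} (hf : ∀ i, MeasurableSet (f i)) (n : ℕ) :
    MeasurableSet (⋃ i < n, f i) :=
  MeasurableSet.iUnion fun i => MeasurableSet.iUnion fun _ => hf i

theorem XModule.integrable_indicator (M : XModule X 𝓗) {S : Set X} (hS : MeasurableSet S) (v : 𝓗) :
    Integrable (S.indicator (1 : X → ℝ)) (M.specMeasure v) :=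
  integrable_bdd (indicator_measurable hS) (abs_indicator_le_one S) _

/-- Dynkin's π-λ argument starting from closed sets: indicators of closed sets are pointwise limits
of functions in C_c(X), complements use the action of 1, and disjoint unions are limits of partial
sums. -/
theorem XModule.exists_acts (M : XModule X 𝓗) {S : Set X} (hS : MeasurableSet S) :
    ∃ T, M.Acts (S.indicator 1) T := by
  refine MeasurableSpace.induction_on_inter (C := fun S _ => ∃ T, M.Acts (S.indicator 1) T)
    (BorelSpace.measurable_eq.trans borel_eq_generateFrom_isClosed) isPiSystem_isClosed
    ?_ ?_ ?_ ?_ S hS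
  · exact ⟨0, by simpa using M.acts_zero⟩
  · intro F hF
    obtain ⟨f, h0, h1, hlim⟩ := exists_cc_approx_isClosed hF
    exact XModule.Acts.exists_lim (fun n => M.acts_ofCc (f n)) (fun n => (f n).continuous.measurable)
      h0 h1 hlim
  · rintro S hS ⟨T, hT⟩
    refine ⟨1 - T, ?_⟩
    have := M.acts_one.sub hT (fun v => integrable_const _) (M.integrable_indicator hS)
    convert this using 2 with x
    by_cases hx : x ∈ S <;> simp [hx]
  · intro f hd hm hT
    choose T hT using hT
    refine XModule.Acts.exists_lim (T := fun n => ∑ i ∈ Finset.range n, T i) (fun n => ?_)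
      (fun n => indicator_measurable (measurableSet_partialUnion hm n))
      (fun n => indicator_nonneg' _) (fun n => indicator_le_one' _)
      (tendsto_indicator_partialUnion f)
    induction n with
    | zero => simpa using M.acts_zero
    | succ n ih =>
      rw [Finset.sum_range_succ]
      have := ih.add (hT n) (M.integrable_indicator (measurableSet_partialUnion hm n))
        (M.integrable_indicator (hm n))
      convert this using 2 with x
      exact indicator_partialUnion f hd n x

theorem XModule.acts_chi (M : XModule X 𝓗) {S : Set X} (hS : MeasurableSet S) :
    M.Acts (S.indicator 1) (M.chi S) := by
  obtain ⟨T, hT⟩ := M.exists_acts hS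
  have h : ∃ P, M.IsIndicator S P := ⟨T, (M.isIndicator_iff hS T).2 hT⟩
  rw [← M.isIndicator_iff hS, XModule.chi, dif_pos h]
  exact h.choose_spec

theorem XModule.isSelfAdjoint_chi (M : XModule X 𝓗) {S : Set X} (hS : MeasurableSet S) :
    IsSelfAdjoint (M.chi S) :=
  (M.acts_chi hS).adjoint.unique (M.acts_chi hS)

@[simp] theorem XModule.chi_empty (M : XModule X 𝓗) : M.chi ∅ = 0 :=
  (M.acts_chi MeasurableSet.empty).unique (by simpa using M.acts_zero)

theorem XModule.chi_compl (M : XModule X 𝓗) {S : Set X} (hS : MeasurableSet S) :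
    M.chi Sᶜ = 1 - M.chi S := by
  refine (M.acts_chi hS.compl).unique ?_
  have := M.acts_one.sub (M.acts_chi hS) (fun v => integrable_const _) (M.integrable_indicator hS)
  convert this using 2 with x
  by_cases hx : x ∈ S <;> simp [hx]

/-- If `f ↦ q f` is implemented by right multiplication of `Q` with continuous functions of compact
support, then also with indicator functions. -/
theorem XModule.Acts.mul_chi {M : XModule X 𝓗} {q : X → ℝ} (hq : Measurable q) {C : ℝ}
    (hC : ∀ x, |q x| ≤ C) {Q : 𝓗 →L[ℂ] 𝓗} (hQ1 : M.Acts q Q)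
    (hQ : ∀ f : C_c(X, ℝ), M.Acts (fun x => q x * f x) (Q * M.rep (ofCc f))) {S : Set X}
    (hS : MeasurableSet S) : M.Acts (fun x => q x * S.indicator 1 x) (Q * M.chi S) := by
  have hbd : ∀ {f : X → ℝ}, (∀ x, |f x| ≤ 1) → ∀ x, |q x * f x| ≤ C * 1 := fun {f} hf x => by
    rw [abs_mul]
    exact mul_le_mul (hC x) (hf x) (abs_nonneg _) ((abs_nonneg _).trans (hC x))
  have hinteg : ∀ {S : Set X} (_ : MeasurableSet S) (v : 𝓗),
      Integrable (fun x => q x * S.indicator 1 x) (M.specMeasure v) := fun hS v =>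
    integrable_bdd (hq.mul (indicator_measurable hS)) (hbd (abs_indicator_le_one _)) _
  -- passage to limits
  have hlim' : ∀ (f : ℕ → X → ℝ) (T : ℕ → 𝓗 →L[ℂ] 𝓗) (S : Set X), MeasurableSet S →
      (∀ n, M.Acts (f n) (T n)) → (∀ n, Measurable (f n)) → (∀ n x, |f n x| ≤ 1) →
      (∀ x, Tendsto (fun n => f n x) atTop (𝓝 (S.indicator 1 x))) →
      (∀ n, M.Acts (fun x => q x * f n x) (Q * T n)) →
      M.Acts (fun x => q x * S.indicator 1 x) (Q * M.chi S) := by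
    intro f T S hS hT hm hb hl hQT v
    -- Moving Q to the other side of the inner product makes weak convergence of the factors T n
    -- sufficient.
    have h1 := XModule.Acts.tendsto hT (M.acts_chi hS) hm hb hl (star Q v) v
    simp_rw [ContinuousLinearMap.star_eq_adjoint, ContinuousLinearMap.adjoint_inner_left] at h1
    refine tendsto_nhds_unique h1 ?_
    have h2 : ∀ n, inner ℂ v (Q (T n v)) = _ := fun n => hQT n v
    simp_rw [h2]
    exact (Complex.continuous_ofReal.tendsto _).comp (tendsto_integral_bdd
      (fun n => hq.mul (hm n)) (fun n => hbd (hb n)) (fun x => (hl x).const_mul _) _)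
  refine MeasurableSpace.induction_on_inter
    (C := fun S _ => M.Acts (fun x => q x * S.indicator 1 x) (Q * M.chi S))
    (BorelSpace.measurable_eq.trans borel_eq_generateFrom_isClosed) isPiSystem_isClosed
    ?_ ?_ ?_ ?_ S hS
  · simpa using M.acts_zero
  · intro F hF
    obtain ⟨f, h0, h1, hlim⟩ := exists_cc_approx_isClosed hF
    exact hlim' (fun n => f n) _ F (IsClosed.measurableSet hF) (fun n => M.acts_ofCc (f n))
      (fun n => (f n).continuous.measurable)
      (fun n x => by rw [abs_of_nonneg (h0 n x)]; exact h1 n x) hlim (fun n => hQ (f n))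
  · intro S hS hT
    rw [M.chi_compl hS, mul_sub, mul_one]
    have := hQ1.sub hT (fun v => integrable_bdd hq hC _) (hinteg hS)
    convert this using 2 with x
    by_cases hx : x ∈ S <;> simp [hx]
  · intro f hd hm hT
    refine hlim' (fun n => (⋃ i < n, f i).indicator 1) (fun n => ∑ i ∈ Finset.range n, M.chi (f i))
      _ (MeasurableSet.iUnion hm) (fun n => ?_)
      (fun n => indicator_measurable (measurableSet_partialUnion hm n))
      (fun n => abs_indicator_le_one _) (tendsto_indicator_partialUnion f) (fun n => ?_)
    · induction n with
      | zero => simpa using M.acts_zero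
      | succ n ih =>
        rw [Finset.sum_range_succ]
        have := ih.add (M.acts_chi (hm n)) (M.integrable_indicator (measurableSet_partialUnion hm n))
          (M.integrable_indicator (hm n))
        convert this using 2 with x
        exact indicator_partialUnion f hd n x
    · induction n with
      | zero => simpa using M.acts_zero
      | succ n ih =>
        rw [Finset.sum_range_succ, mul_add]
        have := ih.add (hT n) (hinteg (measurableSet_partialUnion hm n)) (hinteg (hm n))
        convert this using 2 with x
        rw [indicator_partialUnion f hd n x, mul_add]

/-- Multiplicativity is bootstrapped in two rounds of `Acts.mul_chi`: first for a continuous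
function times an indicator, then, after taking adjoints, with the first factor already an
indicator. -/
theorem XModule.chi_mul_chi (M : XModule X 𝓗) {S T : Set X} (hS : MeasurableSet S)
    (hT : MeasurableSet T) : M.chi S * M.chi T = M.chi (S ∩ T) := by
  have key : ∀ g : C_c(X, ℝ), M.Acts (fun x => S.indicator 1 x * g x)
      (M.chi S * M.rep (ofCc g)) := by
    intro g
    obtain ⟨C, hC⟩ : ∃ C, ∀ x, ‖g x‖ ≤ C := g.hasCompactSupport.exists_bound_of_continuous g.continuous
    have := XModule.Acts.mul_chi g.continuous.measurable hC (M.acts_ofCc g) (fun f => by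
      rw [← map_mul, ← ofCc_mul]; exact M.acts_ofCc (g * f)) hS
    have := this.adjoint
    rw [star_mul, (M.isSelfAdjoint_chi hS).star_eq, (M.isSelfAdjoint_rep_ofCc g).star_eq] at this
    convert this using 2 with x
    exact mul_comm _ _
  refine (XModule.Acts.mul_chi (indicator_measurable hS) (abs_indicator_le_one S) (M.acts_chi hS)
    key hT).unique ?_
  convert M.acts_chi (hS.inter hT) using 2 with x
  rw [Set.inter_indicator_one]
  rfl

theorem XModule.isStarProjection_chi (M : XModule X 𝓗) {S : Set X} (hS : MeasurableSet S) :
    IsStarProjection (M.chi S) :=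
  ⟨by rw [IsIdempotentElem, M.chi_mul_chi hS hS, Set.inter_self], M.isSelfAdjoint_chi hS⟩

end Spectral

/-! ### Adjoints and limits of compact operators -/

section CompactAdjoint

variable {𝓗 : Type*} [NormedAddCommGroup 𝓗] [InnerProductSpace ℂ 𝓗] [CompleteSpace 𝓗]

theorem FiniteRank.isCompactOperator {E : Type*} [NormedAddCommGroup E] [NormedSpace ℂ E]
    {F : E →L[ℂ] E} (hF : FiniteRank F) : IsCompactOperator F := by
  have : FiniteDimensional ℂ (LinearMap.range (F : E →ₗ[ℂ] E)) := hF
  have hpr : ProperSpace (LinearMap.range (F : E →ₗ[ℂ] E)) := FiniteDimensional.proper ℂ _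
  let F' : E →L[ℂ] LinearMap.range (F : E →ₗ[ℂ] E) :=
    F.codRestrict _ (fun x => LinearMap.mem_range_self _ x)
  have h1 : IsCompactOperator F' := isCompactOperator_of_locallyCompactSpace_dom F'
  exact h1.clm_comp (Submodule.subtypeL _)

theorem FiniteRank.star {F : 𝓗 →L[ℂ] 𝓗} (hF : FiniteRank F) : FiniteRank (star F) := by
  set U := LinearMap.range (F : 𝓗 →ₗ[ℂ] 𝓗)
  have : FiniteDimensional ℂ U := hF
  have h1 : U.starProjection * F = F := by
    ext x
    exact Submodule.starProjection_eq_self_iff.2 (LinearMap.mem_range_self (F : 𝓗 →ₗ[ℂ] 𝓗) x)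
  have h2 : Star.star F = Star.star F * U.starProjection := by
    conv_lhs => rw [← h1, star_mul, (isSelfAdjoint_starProjection U).star_eq]
  rw [h2]
  refine FiniteRank.mul_left ?_ _
  exact Submodule.finiteDimensional_of_le (S₂ := U) (by rintro _ ⟨x, rfl⟩; simp)

/-- Approximation by finite rank operators is preserved under adjoints, since the adjoint is
isometric and keeps finite rank. -/
theorem isCompactOperator_star {T : 𝓗 →L[ℂ] 𝓗} (hT : IsCompactOperator T) :
    IsCompactOperator (star T : 𝓗 →L[ℂ] 𝓗) := by
  have hcl := isClosed_setOfPred_isCompactOperator (𝕜₁ := ℂ) (𝕜₂ := ℂ) (σ₁₂ := RingHom.id ℂ)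
    (M₁ := 𝓗) (M₂ := 𝓗)
  have : star T ∈ closure {f : 𝓗 →L[ℂ] 𝓗 | IsCompactOperator f} := by
    rw [Metric.mem_closure_iff]
    intro ε hε
    obtain ⟨F, hF, hFT⟩ := exists_finiteRank_norm_sub_lt hT hε
    refine ⟨star F, hF.star.isCompactOperator, ?_⟩
    rwa [dist_eq_norm, ← star_sub, norm_star]
  exact hcl.closure_subset this

theorem isCompactOperator_of_mem_closure {s : Set (𝓗 →L[ℂ] 𝓗)} (hs : ∀ T ∈ s, IsCompactOperator T)
    {T : 𝓗 →L[ℂ] 𝓗} (hT : T ∈ closure s) : IsCompactOperator T :=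
  (isClosed_setOfPred_isCompactOperator (𝕜₁ := ℂ) (𝕜₂ := ℂ) (σ₁₂ := RingHom.id ℂ)
    (M₁ := 𝓗) (M₂ := 𝓗)).closure_subset (closure_mono hs hT)

theorem IsCompactOperator.mul_left' {T : 𝓗 →L[ℂ] 𝓗} (hT : IsCompactOperator T) (S : 𝓗 →L[ℂ] 𝓗) :
    IsCompactOperator (S * T) := hT.clm_comp S

theorem IsCompactOperator.mul_right' {T : 𝓗 →L[ℂ] 𝓗} (hT : IsCompactOperator T) (S : 𝓗 →L[ℂ] 𝓗) :
    IsCompactOperator (T * S) := hT.comp_clm S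

end CompactAdjoint

/-! ### Roe algebras -/

section Roe

open Bornology

variable {X : Type*} [MetricSpace X] [ProperSpace X] [MeasurableSpace X] [BorelSpace X]
  {𝓗 : Type*} [NormedAddCommGroup 𝓗] [InnerProductSpace ℂ 𝓗] [CompleteSpace 𝓗]

variable (M : XModule X 𝓗)

theorem lt_dist_of_notMem_cthickening {r : ℝ} {V : Set X} {x y : X} (hx : x ∈ V)
    (hy : y ∉ Metric.cthickening r V) : r < dist x y := by
  by_contra h
  exact hy (Metric.mem_cthickening_of_dist_le y x r V hx (by rw [dist_comm]; exact not_lt.1 h))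

theorem exists_dist_lt_of_mem_cthickening {r s : ℝ} (hr : 0 ≤ r) (hrs : r < s) {V : Set X} {x : X}
    (hx : x ∈ Metric.cthickening r V) : ∃ y ∈ V, dist x y < s :=
  Metric.mem_thickening_iff.1 (Metric.cthickening_subset_thickening' (hr.trans_lt hrs) hrs V hx)

/-- The algebra of locally compact operators of finite propagation. -/
def XModule.roeCore : NonUnitalStarSubalgebra ℂ (𝓗 →L[ℂ] 𝓗) where
  carrier := {T | M.LocallyCompact T ∧ M.FinitePropagation T}
  add_mem' := by
    rintro S T ⟨hS, r, hr, hSr⟩ ⟨hT, s, hs, hTs⟩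
    refine ⟨fun V hV hb => ⟨?_, ?_⟩, max r s, le_max_of_le_left hr, fun V W hV hW h => ?_⟩
    · rw [mul_add]; exact (hS V hV hb).1.add (hT V hV hb).1
    · rw [add_mul]; exact (hS V hV hb).2.add (hT V hV hb).2
    · rw [mul_add, add_mul, hSr V W hV hW fun x hx y hy => (le_max_left _ _).trans_lt (h x hx y hy),
        hTs V W hV hW fun x hx y hy => (le_max_right _ _).trans_lt (h x hx y hy), add_zero]
  zero_mem' := by
    refine ⟨fun V hV hb => ⟨?_, ?_⟩, 0, le_rfl, fun V W hV hW h => by simp⟩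
    · rw [mul_zero]; exact isCompactOperator_zero
    · rw [zero_mul]; exact isCompactOperator_zero
  mul_mem' := by
    rintro S T ⟨hS, r, hr, hSr⟩ ⟨hT, s, hs, hTs⟩
    refine ⟨fun V hV hb => ⟨?_, ?_⟩, r + s + 1, by positivity, fun V W hV hW h => ?_⟩
    · rw [← mul_assoc]; exact IsCompactOperator.mul_right' (hS V hV hb).1 T
    · rw [mul_assoc]; exact IsCompactOperator.mul_left' (hT V hV hb).2 S
    -- Insert χ_Z + χ_{Zᶜ} = 1 between S and T, with Z the closed r-thickening of V. A point of Z is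
    -- only known to be within distance less than r + 1 of V, which accounts for the summand 1 in
    -- the propagation bound.
    · set Z := Metric.cthickening r V
      have hZ : MeasurableSet Z := Metric.isClosed_cthickening.measurableSet
      have h1 : M.chi V * S * M.chi Zᶜ = 0 := hSr V Zᶜ hV hZ.compl fun x hx y hy =>
        lt_dist_of_notMem_cthickening hx hy
      have h2 : M.chi Z * T * M.chi W = 0 := hTs Z W hZ hW fun x hx y hy => by
        obtain ⟨v, hv, hxv⟩ := exists_dist_lt_of_mem_cthickening hr (lt_add_one r) hx
        have := h v hv y hy
        have := dist_triangle_left v y x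
        linarith
      have h3 : M.chi V * (S * T) * M.chi W = M.chi V * S * M.chi Zᶜ * (T * M.chi W) +
          M.chi V * S * (M.chi Z * T * M.chi W) := by
        rw [M.chi_compl hZ]; noncomm_ring
      rw [h3, h1, h2, zero_mul, mul_zero, add_zero]
  smul_mem' := by
    rintro c T ⟨hT, r, hr, hTr⟩
    refine ⟨fun V hV hb => ⟨?_, ?_⟩, r, hr, fun V W hV hW h => ?_⟩
    · rw [mul_smul_comm]; exact (hT V hV hb).1.smul c
    · rw [smul_mul_assoc]; exact (hT V hV hb).2.smul c
    · rw [mul_smul_comm, smul_mul_assoc, hTr V W hV hW h, smul_zero]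
  star_mem' := by
    rintro T ⟨hT, r, hr, hTr⟩
    refine ⟨fun V hV hb => ⟨?_, ?_⟩, r, hr, fun V W hV hW h => ?_⟩
    · have := isCompactOperator_star (hT V hV hb).2
      rwa [star_mul, (M.isSelfAdjoint_chi hV).star_eq] at this
    · have := isCompactOperator_star (hT V hV hb).1
      rwa [star_mul, (M.isSelfAdjoint_chi hV).star_eq] at this
    · have := congrArg star (hTr W V hW hV fun x hx y hy => by rw [dist_comm]; exact h y hy x hx)
      rwa [star_mul, star_mul, (M.isSelfAdjoint_chi hV).star_eq, (M.isSelfAdjoint_chi hW).star_eq,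
        star_zero, ← mul_assoc] at this

/-- The generating operators already form a *-algebra, so taking the closure is the only step left.
Statements about the Roe algebra then reduce to finite propagation operators by continuity. -/
theorem XModule.roe_eq : (M.roe : Set (𝓗 →L[ℂ] 𝓗)) = closure (M.roeCore : Set (𝓗 →L[ℂ] 𝓗)) := by
  have : NonUnitalStarAlgebra.adjoin ℂ {T | M.LocallyCompact T ∧ M.FinitePropagation T} =
      M.roeCore :=
    le_antisymm (NonUnitalStarAlgebra.adjoin_le fun T hT => hT) fun T hT =>
      NonUnitalStarAlgebra.subset_adjoin ℂ _ hT
  unfold XModule.roe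
  rw [this]
  rfl

theorem XModule.roeCore_le {T : 𝓗 →L[ℂ] 𝓗} (hT : T ∈ M.roeCore) : T ∈ M.roe := by
  rw [← SetLike.mem_coe, M.roe_eq]; exact subset_closure hT

theorem XModule.chi_mul_mem_roeCore {S : Set X} (hS : MeasurableSet S) {T : 𝓗 →L[ℂ] 𝓗}
    (hT : T ∈ M.roeCore) : M.chi S * T ∈ M.roeCore := by
  obtain ⟨hT, r, hr, hTr⟩ := hT
  refine ⟨fun V hV hb => ⟨?_, ?_⟩, r, hr, fun V W hV hW h => ?_⟩
  · rw [← mul_assoc, M.chi_mul_chi hV hS, Set.inter_comm, ← M.chi_mul_chi hS hV, mul_assoc]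
    exact IsCompactOperator.mul_left' (hT V hV hb).1 _
  · rw [mul_assoc]; exact IsCompactOperator.mul_left' (hT V hV hb).2 _
  · rw [← mul_assoc, M.chi_mul_chi hV hS, Set.inter_comm, ← M.chi_mul_chi hS hV, mul_assoc, mul_assoc,
      ← mul_assoc (M.chi V), hTr V W hV hW h, mul_zero]

/-- A closed set of operators whose preimage under a continuous map contains the core. -/
theorem XModule.roe_induction {p : (𝓗 →L[ℂ] 𝓗) → Prop} (hp : IsClosed {T | p T})
    (h : ∀ T ∈ M.roeCore, p T) {T : 𝓗 →L[ℂ] 𝓗} (hT : T ∈ M.roe) : p T := by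
  rw [← SetLike.mem_coe, M.roe_eq] at hT
  exact hp.closure_subset_iff.2 h hT

theorem XModule.chi_mul_mem_roe {S : Set X} (hS : MeasurableSet S) {T : 𝓗 →L[ℂ] 𝓗}
    (hT : T ∈ M.roe) : M.chi S * T ∈ M.roe :=
  M.roe_induction (p := fun T => M.chi S * T ∈ M.roe)
    (M.isClosed_roe.preimage (continuous_const_mul (M.chi S)))
    (fun _ h => M.roeCore_le (M.chi_mul_mem_roeCore hS h)) hT

theorem XModule.mul_chi_mem_roe {S : Set X} (hS : MeasurableSet S) {T : 𝓗 →L[ℂ] 𝓗}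
    (hT : T ∈ M.roe) : T * M.chi S ∈ M.roe := by
  have := star_mem (M.chi_mul_mem_roe hS (star_mem hT))
  rwa [star_mul, star_star, (M.isSelfAdjoint_chi hS).star_eq] at this

/-- Families of subsets that are closed under subsets, finite unions and thickenings. -/
structure IsBigFamily (𝒴 : Set (Set X)) : Prop where
  nonempty : 𝒴.Nonempty
  mono : ∀ {Z Z'}, Z ∈ 𝒴 → Z' ⊆ Z → Z' ∈ 𝒴
  union : ∀ {Z Z'}, Z ∈ 𝒴 → Z' ∈ 𝒴 → Z ∪ Z' ∈ 𝒴
  cthickening : ∀ {Z} (r : ℝ), 0 ≤ r → Z ∈ 𝒴 → Metric.cthickening r Z ∈ 𝒴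

theorem isBigFamily_bigFamily (Y : Set X) : IsBigFamily (bigFamily Y) where
  nonempty := ⟨∅, 1, one_pos, Set.empty_subset _⟩
  mono := fun ⟨r, hr, h⟩ h' => ⟨r, hr, h'.trans h⟩
  union := fun ⟨r, hr, h⟩ ⟨s, hs, h'⟩ => ⟨max r s, lt_max_of_lt_left hr, Set.union_subset
    (fun x hx => let ⟨y, hy, hd⟩ := h hx; ⟨y, hy, hd.trans (le_max_left _ _)⟩)
    (fun x hx => let ⟨y, hy, hd⟩ := h' hx; ⟨y, hy, hd.trans (le_max_right _ _)⟩)⟩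
  cthickening := fun {Z} s hs ⟨r, hr, h⟩ => ⟨r + s + 1, by positivity, fun x hx => by
    obtain ⟨z, hz, hxz⟩ := exists_dist_lt_of_mem_cthickening hs (lt_add_one s) hx
    obtain ⟨y, hy, hd⟩ := h hz
    exact ⟨y, hy, by linarith [dist_triangle x z y]⟩⟩

theorem IsBigFamily.inter {𝒴 𝒵 : Set (Set X)} (h𝒴 : IsBigFamily 𝒴) (h𝒵 : IsBigFamily 𝒵) :
    IsBigFamily (familyInter 𝒴 𝒵) := by
  have mono : ∀ {Z Z'}, Z ∈ familyInter 𝒴 𝒵 → Z' ⊆ Z → Z' ∈ familyInter 𝒴 𝒵 := by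
    rintro _ Z' ⟨A, hA, B, hB, rfl⟩ h
    exact ⟨Z', h𝒴.mono hA (h.trans Set.inter_subset_left), Z',
      h𝒵.mono hB (h.trans Set.inter_subset_right), Set.inter_self _⟩
  refine ⟨h𝒴.nonempty.image2 h𝒵.nonempty, mono, ?_, ?_⟩
  · rintro _ _ ⟨A, hA, B, hB, rfl⟩ ⟨A', hA', B', hB', rfl⟩
    refine mono ⟨A ∪ A', h𝒴.union hA hA', B ∪ B', h𝒵.union hB hB', rfl⟩ ?_
    rintro x (⟨h1, h2⟩ | ⟨h1, h2⟩)
    · exact ⟨Or.inl h1, Or.inl h2⟩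
    · exact ⟨Or.inr h1, Or.inr h2⟩
  · rintro _ r hr ⟨A, hA, B, hB, rfl⟩
    exact mono ⟨_, h𝒴.cthickening r hr hA, _, h𝒵.cthickening r hr hB, rfl⟩
      (Set.subset_inter (Metric.cthickening_subset_of_subset r Set.inter_subset_left)
        (Metric.cthickening_subset_of_subset r Set.inter_subset_right))

theorem isBigFamily_coarseBoundary (Y : Set X) : IsBigFamily (coarseBoundary Y) :=
  (isBigFamily_bigFamily Y).inter (isBigFamily_bigFamily Yᶜ)

/-- Members of a big family need not be Borel sets, but the closed 0-thickening is closed. -/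
theorem IsBigFamily.exists_measurable {𝒴 : Set (Set X)} (h𝒴 : IsBigFamily 𝒴) {Z : Set X}
    (hZ : Z ∈ 𝒴) : ∃ Z' ∈ 𝒴, MeasurableSet Z' ∧ Z ⊆ Z' :=
  ⟨_, h𝒴.cthickening 0 le_rfl hZ, Metric.isClosed_cthickening.measurableSet,
    Metric.self_subset_cthickening Z⟩

/-- The elements of the Roe algebra supported in a big family. -/
def XModule.localizedCore {𝒴 : Set (Set X)} (h𝒴 : IsBigFamily 𝒴) :
    NonUnitalStarSubalgebra ℂ (𝓗 →L[ℂ] 𝓗) where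
  carrier := {T | T ∈ M.roe ∧ M.SupportedIn 𝒴 T}
  add_mem' := by
    rintro S T ⟨hS, Z, hZ, hSZ⟩ ⟨hT, Z', hZ', hTZ⟩
    refine ⟨add_mem hS hT, Z ∪ Z', h𝒴.union hZ hZ', fun V hV h => ?_⟩
    have h1 := hSZ V hV (h.trans (Set.compl_subset_compl.2 Set.subset_union_left))
    have h2 := hTZ V hV (h.trans (Set.compl_subset_compl.2 Set.subset_union_right))
    rw [mul_add, add_mul, h1.1, h1.2, h2.1, h2.2, add_zero]
    exact ⟨rfl, rfl⟩
  zero_mem' := by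
    obtain ⟨Z, hZ⟩ := h𝒴.nonempty
    exact ⟨zero_mem _, Z, hZ, fun V hV h => by simp⟩
  mul_mem' := by
    rintro S T ⟨hS, Z, hZ, hSZ⟩ ⟨hT, Z', hZ', hTZ⟩
    refine ⟨mul_mem hS hT, Z ∪ Z', h𝒴.union hZ hZ', fun V hV h => ?_⟩
    have h1 := hSZ V hV (h.trans (Set.compl_subset_compl.2 Set.subset_union_left))
    have h2 := hTZ V hV (h.trans (Set.compl_subset_compl.2 Set.subset_union_right))
    rw [← mul_assoc, mul_assoc S, h1.1, h2.2, zero_mul, mul_zero]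
    exact ⟨rfl, rfl⟩
  smul_mem' := by
    rintro c T ⟨hT, Z, hZ, hTZ⟩
    refine ⟨SMulMemClass.smul_mem c hT, Z, hZ, fun V hV h => ?_⟩
    rw [mul_smul_comm, smul_mul_assoc, (hTZ V hV h).1, (hTZ V hV h).2, smul_zero]
    exact ⟨rfl, rfl⟩
  star_mem' := by
    rintro T ⟨hT, Z, hZ, hTZ⟩
    refine ⟨star_mem hT, Z, hZ, fun V hV h => ?_⟩
    have h1 := congrArg star (hTZ V hV h).1
    have h2 := congrArg star (hTZ V hV h).2
    rw [star_mul, (M.isSelfAdjoint_chi hV).star_eq, star_zero] at h1 h2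
    exact ⟨h2, h1⟩

variable {M} {𝒴 𝒵 : Set (Set X)}

theorem XModule.localizedRoe_eq (h𝒴 : IsBigFamily 𝒴) : (M.localizedRoe 𝒴 : Set (𝓗 →L[ℂ] 𝓗)) =
    closure {T | T ∈ M.roe ∧ M.SupportedIn 𝒴 T} := by
  have : NonUnitalStarAlgebra.adjoin ℂ {T | T ∈ M.roe ∧ M.SupportedIn 𝒴 T} =
      M.localizedCore h𝒴 :=
    le_antisymm (NonUnitalStarAlgebra.adjoin_le fun T hT => hT) fun T hT =>
      NonUnitalStarAlgebra.subset_adjoin ℂ _ hT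
  unfold XModule.localizedRoe
  rw [this]
  rfl

theorem XModule.isClosed_localizedRoe (M : XModule X 𝓗) (𝒴 : Set (Set X)) :
    IsClosed (M.localizedRoe 𝒴 : Set (𝓗 →L[ℂ] 𝓗)) :=
  NonUnitalStarSubalgebra.isClosed_topologicalClosure _

theorem XModule.localizedRoe_le (h𝒴 : IsBigFamily 𝒴) {T : 𝓗 →L[ℂ] 𝓗}
    (hT : T ∈ M.localizedRoe 𝒴) : T ∈ M.roe := by
  rw [← SetLike.mem_coe, XModule.localizedRoe_eq h𝒴] at hT
  exact closure_minimal (fun T hT => hT.1) M.isClosed_roe hT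

theorem XModule.mem_localizedRoe_of_supportedIn (h𝒴 : IsBigFamily 𝒴) {T : 𝓗 →L[ℂ] 𝓗}
    (hT : T ∈ M.roe) (h : M.SupportedIn 𝒴 T) : T ∈ M.localizedRoe 𝒴 := by
  rw [← SetLike.mem_coe, XModule.localizedRoe_eq h𝒴]
  exact subset_closure ⟨hT, h⟩

theorem XModule.chi_mul_eq_zero_of_subset {Z S : Set X} (hZ : MeasurableSet Z) (hS : MeasurableSet S)
    (h : S ⊆ Zᶜ) : M.chi S * M.chi Z = 0 := by
  rw [M.chi_mul_chi hS hZ, Set.disjoint_iff_inter_eq_empty.1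
    (Set.subset_compl_iff_disjoint_right.1 h), M.chi_empty]

theorem XModule.compress_mem_localizedRoe (h𝒴 : IsBigFamily 𝒴) {T : 𝓗 →L[ℂ] 𝓗}
    (hT : T ∈ M.roe) {Z : Set X} (hZ : Z ∈ 𝒴) (hZm : MeasurableSet Z) :
    M.chi Z * T * M.chi Z ∈ M.localizedRoe 𝒴 := by
  refine XModule.mem_localizedRoe_of_supportedIn h𝒴
    (M.mul_chi_mem_roe hZm (M.chi_mul_mem_roe hZm hT)) ⟨Z, hZ, fun S hS h => ⟨?_, ?_⟩⟩
  · rw [← mul_assoc, ← mul_assoc, XModule.chi_mul_eq_zero_of_subset hZm hS h, zero_mul, zero_mul]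
  · rw [mul_assoc, XModule.chi_mul_eq_zero_of_subset hS hZm (Set.subset_compl_comm.1 h), mul_zero]

theorem XModule.norm_chi_le (M : XModule X 𝓗) {S : Set X} (hS : MeasurableSet S) :
    ‖M.chi S‖ ≤ 1 :=
  (M.acts_chi hS).norm_le_one (indicator_measurable hS) (indicator_nonneg' S) (indicator_le_one' S)

theorem XModule.norm_compress_le (M : XModule X 𝓗) {S : Set X} (hS : MeasurableSet S)
    (T : 𝓗 →L[ℂ] 𝓗) : ‖M.chi S * T * M.chi S‖ ≤ ‖T‖ := by
  have h := M.norm_chi_le hS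
  calc _ ≤ ‖M.chi S‖ * ‖T‖ * ‖M.chi S‖ := (norm_mul_le _ _).trans (by gcongr; exact norm_mul_le _ _)
    _ ≤ 1 * ‖T‖ * 1 := by gcongr
    _ = ‖T‖ := by ring

/-- An operator supported in a Borel set Z equals its own compression by χ_Z, and compression is
contractive, so an ε/2-approximation by supported operators makes T ε-close to a compression of
itself. This intrinsic criterion is what makes intersections of localized algebras computable. -/
theorem XModule.mem_localizedRoe_iff (h𝒴 : IsBigFamily 𝒴) {T : 𝓗 →L[ℂ] 𝓗} :
    T ∈ M.localizedRoe 𝒴 ↔ T ∈ M.roe ∧ ∀ ε > 0, ∃ Z ∈ 𝒴, MeasurableSet Z ∧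
      ‖T - M.chi Z * T * M.chi Z‖ < ε := by
  constructor
  · intro hT
    refine ⟨XModule.localizedRoe_le h𝒴 hT, fun ε hε => ?_⟩
    rw [← SetLike.mem_coe, XModule.localizedRoe_eq h𝒴, Metric.mem_closure_iff] at hT
    obtain ⟨T₀, ⟨hT₀, Z, hZ, hTZ⟩, hd⟩ := hT (ε / 2) (by positivity)
    obtain ⟨Z', hZ', hm, hsub⟩ := h𝒴.exists_measurable hZ
    refine ⟨Z', hZ', hm, ?_⟩
    obtain ⟨h1, h2⟩ := hTZ Z'ᶜ hm.compl (Set.compl_subset_compl.2 hsub)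
    rw [M.chi_compl hm] at h1 h2
    have h3 : M.chi Z' * T₀ * M.chi Z' = T₀ := by
      have h1' : M.chi Z' * T₀ = T₀ := by
        rw [sub_mul, one_mul, sub_eq_zero] at h1; exact h1.symm
      have h2' : T₀ * M.chi Z' = T₀ := by
        rw [mul_sub, mul_one, sub_eq_zero] at h2; exact h2.symm
      rw [h1', h2']
    have h4 : T - M.chi Z' * T * M.chi Z' = (T - T₀) - M.chi Z' * (T - T₀) * M.chi Z' := by
      rw [mul_sub, sub_mul, h3]; abel
    rw [h4]
    rw [dist_eq_norm] at hd
    linarith [norm_sub_le (T - T₀) (M.chi Z' * (T - T₀) * M.chi Z'),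
      M.norm_compress_le hm (T - T₀)]
  · rintro ⟨hT, h⟩
    refine (M.isClosed_localizedRoe 𝒴).closure_subset (Metric.mem_closure_iff.2 fun ε hε => ?_)
    obtain ⟨Z, hZ, hm, hlt⟩ := h ε hε
    exact ⟨_, XModule.compress_mem_localizedRoe h𝒴 hT hZ hm, by rwa [dist_eq_norm]⟩

/-- If T is close to both χ_A T χ_A and χ_B T χ_B, compressing the second approximation by χ_A shows
that T is close to its compression by A ∩ B. -/
theorem XModule.mem_localizedRoe_inter (h𝒴 : IsBigFamily 𝒴) (h𝒵 : IsBigFamily 𝒵)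
    {T : 𝓗 →L[ℂ] 𝓗} : T ∈ M.localizedRoe (familyInter 𝒴 𝒵) ↔
      T ∈ M.localizedRoe 𝒴 ∧ T ∈ M.localizedRoe 𝒵 := by
  rw [XModule.mem_localizedRoe_iff (h𝒴.inter h𝒵), XModule.mem_localizedRoe_iff h𝒴,
    XModule.mem_localizedRoe_iff h𝒵]
  constructor
  · rintro ⟨hT, h⟩
    refine ⟨⟨hT, fun ε hε => ?_⟩, ⟨hT, fun ε hε => ?_⟩⟩
    · obtain ⟨_, ⟨A, hA, B, hB, rfl⟩, hm, h⟩ := h ε hε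
      exact ⟨_, h𝒴.mono hA Set.inter_subset_left, hm, h⟩
    · obtain ⟨_, ⟨A, hA, B, hB, rfl⟩, hm, h⟩ := h ε hε
      exact ⟨_, h𝒵.mono hB Set.inter_subset_right, hm, h⟩
  · rintro ⟨⟨hT, h1⟩, -, h2⟩
    refine ⟨hT, fun ε hε => ?_⟩
    obtain ⟨A, hA, hAm, h1⟩ := h1 (ε / 2) (by positivity)
    obtain ⟨B, hB, hBm, h2⟩ := h2 (ε / 2) (by positivity)
    refine ⟨A ∩ B, ⟨A, hA, B, hB, rfl⟩, hAm.inter hBm, ?_⟩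
    have h3 : T - M.chi (A ∩ B) * T * M.chi (A ∩ B) = (T - M.chi A * T * M.chi A) +
        M.chi A * (T - M.chi B * T * M.chi B) * M.chi A := by
      nth_rewrite 2 [Set.inter_comm]
      rw [← M.chi_mul_chi hAm hBm, ← M.chi_mul_chi hBm hAm]
      noncomm_ring
    rw [h3]
    linarith [norm_add_le (T - M.chi A * T * M.chi A)
      (M.chi A * (T - M.chi B * T * M.chi B) * M.chi A),
      M.norm_compress_le hAm (T - M.chi B * T * M.chi B)]

/-- An operator of propagation r enlarges supports at most by the r-thickening, under which big
families are stable; closedness does the rest. -/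
theorem XModule.mul_mem_localizedRoe (h𝒴 : IsBigFamily 𝒴) {S T : 𝓗 →L[ℂ] 𝓗} (hS : S ∈ M.roe)
    (hT : T ∈ M.localizedRoe 𝒴) : S * T ∈ M.localizedRoe 𝒴 := by
  have hTr := XModule.localizedRoe_le h𝒴 hT
  refine M.roe_induction (p := fun S => S * T ∈ M.localizedRoe 𝒴)
    ((M.isClosed_localizedRoe 𝒴).preimage (continuous_mul_const T)) (fun S hS => ?_) hS
  have hSr := M.roeCore_le hS
  obtain ⟨-, r, hr, hSr'⟩ := hS
  have hcl : IsClosed {T | S * T ∈ M.localizedRoe 𝒴} :=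
    (M.isClosed_localizedRoe 𝒴).preimage (continuous_const_mul S)
  rw [← SetLike.mem_coe, XModule.localizedRoe_eq h𝒴] at hT
  refine closure_minimal ?_ hcl hT
  rintro T ⟨hT, Z, hZ, hTZ⟩
  obtain ⟨Z', hZ', hm, hsub⟩ := h𝒴.exists_measurable hZ
  set Z'' := Metric.cthickening r Z' with hZ''
  refine XModule.mem_localizedRoe_of_supportedIn h𝒴 (mul_mem hSr hT)
    ⟨Z'', h𝒴.cthickening r hr hZ', fun V hV h => ⟨?_, ?_⟩⟩
  · have h1 := (hTZ Z'ᶜ hm.compl (Set.compl_subset_compl.2 hsub)).1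
    rw [M.chi_compl hm, sub_mul, one_mul, sub_eq_zero] at h1
    rw [h1, ← mul_assoc, ← mul_assoc, hSr' V Z' hV hm fun x hx y hy => by
      rw [dist_comm]; exact lt_dist_of_notMem_cthickening hy (h hx), zero_mul]
  · rw [mul_assoc, (hTZ V hV (h.trans (Set.compl_subset_compl.2
      (hsub.trans (Metric.self_subset_cthickening Z'))))).2, mul_zero]

theorem XModule.mul_mem_localizedRoe' (h𝒴 : IsBigFamily 𝒴) {S T : 𝓗 →L[ℂ] 𝓗} (hS : S ∈ M.roe)
    (hT : T ∈ M.localizedRoe 𝒴) : T * S ∈ M.localizedRoe 𝒴 := by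
  have := star_mem (XModule.mul_mem_localizedRoe h𝒴 (star_mem hS) (star_mem hT))
  rwa [star_mul, star_star, star_star] at this

/-- For T of propagation r the product is supported in the r-thickening of Y. It follows that the
algebra is the sum of the two ideals of Y and its complement. -/
theorem XModule.chi_mul_mem_localizedRoe {Y : Set X} (hY : MeasurableSet Y) {T : 𝓗 →L[ℂ] 𝓗}
    (hT : T ∈ M.roe) : M.chi Y * T ∈ M.localizedRoe (bigFamily Y) := by
  have hb := isBigFamily_bigFamily Y
  refine M.roe_induction (p := fun T => M.chi Y * T ∈ M.localizedRoe (bigFamily Y))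
    ((M.isClosed_localizedRoe _).preimage (continuous_const_mul _)) (fun T hT => ?_) hT
  have hTr := M.roeCore_le hT
  obtain ⟨-, r, hr, hTr'⟩ := hT
  have hYY : Y ∈ bigFamily Y := ⟨1, one_pos, fun x hx => ⟨x, hx, by simp⟩⟩
  refine XModule.mem_localizedRoe_of_supportedIn hb (M.chi_mul_mem_roe hY hTr)
    ⟨Metric.cthickening r Y, hb.cthickening r hr hYY, fun V hV h => ⟨?_, ?_⟩⟩
  · rw [← mul_assoc, XModule.chi_mul_eq_zero_of_subset hY hV (h.trans (Set.compl_subset_compl.2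
      (Metric.self_subset_cthickening Y))), zero_mul]
  · exact hTr' Y V hY hV fun x hx y hy => lt_dist_of_notMem_cthickening hx (h hy)

theorem XModule.mul_chi_mem_localizedRoe {Y : Set X} (hY : MeasurableSet Y) {T : 𝓗 →L[ℂ] 𝓗}
    (hT : T ∈ M.roe) : T * M.chi Y ∈ M.localizedRoe (bigFamily Y) := by
  have := star_mem (XModule.chi_mul_mem_localizedRoe hY (star_mem hT))
  rwa [star_mul, star_star, (M.isSelfAdjoint_chi hY).star_eq] at this

/-- Multiplication with `χ_S` preserves localized Roe algebras. -/
theorem XModule.chi_mul_mem_localizedRoe' (h𝒴 : IsBigFamily 𝒴) {S : Set X} (hS : MeasurableSet S)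
    {T : 𝓗 →L[ℂ] 𝓗} (hT : T ∈ M.localizedRoe 𝒴) : M.chi S * T ∈ M.localizedRoe 𝒴 := by
  have hcl : IsClosed {T | M.chi S * T ∈ M.localizedRoe 𝒴} :=
    (M.isClosed_localizedRoe 𝒴).preimage (continuous_const_mul _)
  rw [← SetLike.mem_coe, XModule.localizedRoe_eq h𝒴] at hT
  refine closure_minimal ?_ hcl hT
  rintro T ⟨hT, Z, hZ, hTZ⟩
  refine XModule.mem_localizedRoe_of_supportedIn h𝒴 (M.chi_mul_mem_roe hS hT)
    ⟨Z, hZ, fun V hV h => ⟨?_, ?_⟩⟩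
  · rw [← mul_assoc, M.chi_mul_chi hV hS, Set.inter_comm, ← M.chi_mul_chi hS hV, mul_assoc,
      (hTZ V hV h).1, mul_zero]
  · rw [mul_assoc, (hTZ V hV h).2, mul_zero]

theorem XModule.mul_chi_mem_localizedRoe' (h𝒴 : IsBigFamily 𝒴) {S : Set X} (hS : MeasurableSet S)
    {T : 𝓗 →L[ℂ] 𝓗} (hT : T ∈ M.localizedRoe 𝒴) : T * M.chi S ∈ M.localizedRoe 𝒴 := by
  have := star_mem (XModule.chi_mul_mem_localizedRoe' h𝒴 hS (star_mem hT))
  rwa [star_mul, star_star, (M.isSelfAdjoint_chi hS).star_eq] at this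

/-- The commutator is the difference of the off-diagonal corners χ_{Wᶜ} T χ_W and χ_W T χ_{Wᶜ}. Each
corner carries both a factor localized at W and one localized at Wᶜ, hence lies in both ideals. -/
theorem XModule.commutator_mem_localizedRoe {W : Set X} (hW : MeasurableSet W) {T : 𝓗 →L[ℂ] 𝓗}
    (hT : T ∈ M.roe) : T * M.chi W - M.chi W * T ∈ M.localizedRoe (coarseBoundary W) := by
  have hb := isBigFamily_bigFamily W
  have hb' := isBigFamily_bigFamily Wᶜ
  have e : T * M.chi W - M.chi W * T = M.chi Wᶜ * (T * M.chi W) - M.chi W * (T * M.chi Wᶜ) := by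
    rw [M.chi_compl hW]; noncomm_ring
  rw [e]
  refine sub_mem ((XModule.mem_localizedRoe_inter hb hb').2 ⟨?_, ?_⟩)
    ((XModule.mem_localizedRoe_inter hb hb').2 ⟨?_, ?_⟩)
  · exact XModule.chi_mul_mem_localizedRoe' hb hW.compl (XModule.mul_chi_mem_localizedRoe hW hT)
  · exact XModule.chi_mul_mem_localizedRoe hW.compl (M.mul_chi_mem_roe hW hT)
  · exact XModule.chi_mul_mem_localizedRoe hW (M.mul_chi_mem_roe hW.compl hT)
  · exact XModule.chi_mul_mem_localizedRoe' hb' hW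
      (XModule.mul_chi_mem_localizedRoe hW.compl hT)

theorem XModule.chi_mul_isCompactOperator {S : Set X} (hS : MeasurableSet S) (hb : IsBounded S)
    {T : 𝓗 →L[ℂ] 𝓗} (hT : T ∈ M.roe) : IsCompactOperator (M.chi S * T) := by
  have hcl := isClosed_setOfPred_isCompactOperator (𝕜₁ := ℂ) (𝕜₂ := ℂ) (σ₁₂ := RingHom.id ℂ)
    (M₁ := 𝓗) (M₂ := 𝓗)
  exact M.roe_induction (p := fun T => IsCompactOperator (M.chi S * T))
    (hcl.preimage (continuous_const_mul (M.chi S))) (fun T hT => (hT.1 S hS hb).1) hT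

/-- By transversality such an operator is a norm limit of its compressions to bounded sets, and
these are compact by local compactness. -/
theorem XModule.isCompactOperator_of_mem {Y W : Set X} (hYW : Transversal Y W) {T : 𝓗 →L[ℂ] 𝓗}
    (h1 : T ∈ M.localizedRoe (coarseBoundary Y)) (h2 : T ∈ M.localizedRoe (coarseBoundary W)) :
    IsCompactOperator T := by
  have hb := (isBigFamily_coarseBoundary Y).inter (isBigFamily_coarseBoundary W)
  have h := (XModule.mem_localizedRoe_inter (isBigFamily_coarseBoundary Y)
    (isBigFamily_coarseBoundary W)).2 ⟨h1, h2⟩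
  rw [XModule.mem_localizedRoe_iff hb] at h
  refine isCompactOperator_of_mem_closure (s := {T | IsCompactOperator T}) (fun _ h => h)
    (Metric.mem_closure_iff.2 fun ε hε => ?_)
  obtain ⟨Z, hZ, hm, hlt⟩ := h.2 ε hε
  exact ⟨_, IsCompactOperator.mul_right' (XModule.chi_mul_isCompactOperator hm (hYW Z hZ) h.1) _,
    by rwa [dist_eq_norm]⟩

/-- The commutator of an element of `C*(∂Y)` with `χ_W` is compact. -/
theorem XModule.isCompactOperator_commutator {Y W : Set X} (hYW : Transversal Y W)
    (hW : MeasurableSet W) {T : 𝓗 →L[ℂ] 𝓗} (hT : T ∈ M.localizedRoe (coarseBoundary Y)) :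
    IsCompactOperator (T * M.chi W - M.chi W * T) := by
  have hb := isBigFamily_coarseBoundary Y
  exact XModule.isCompactOperator_of_mem hYW
    (sub_mem (XModule.mul_chi_mem_localizedRoe' hb hW hT)
      (XModule.chi_mul_mem_localizedRoe' hb hW hT))
    (XModule.commutator_mem_localizedRoe hW (XModule.localizedRoe_le hb hT))

end Roe

/-! ### Exponentials of matrices -/

section MatrixExp

variable {B : Type*} [NormedRing B] [NormedAlgebra ℂ B] [CompleteSpace B] {n : ℕ}

/-- The matrix algebra carries only the entrywise topology; the ℓ^∞ operator norm, which induces it,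
is brought in locally to use the theory of Banach algebras. -/
theorem hasSum_exp_matrix (x : Matrix (Fin n) (Fin n) B) :
    HasSum (fun k : ℕ => ((k.factorial : ℂ)⁻¹) • x ^ k) (NormedSpace.exp x) := by
  have hc : CompleteSpace (Matrix (Fin n) (Fin n) B) := inferInstance
  exact @NormedSpace.exp_series_hasSum_exp' ℂ (Matrix (Fin n) (Fin n) B) _ _ _
    Matrix.linftyOpNormedRing Matrix.linftyOpNormedAlgebra hc x

theorem continuous_exp_matrix :
    Continuous (NormedSpace.exp : Matrix (Fin n) (Fin n) B → Matrix (Fin n) (Fin n) B) := by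
  have hc : CompleteSpace (Matrix (Fin n) (Fin n) B) := inferInstance
  let := Matrix.linftyOpNormedRing (n := Fin n) (α := B)
  let := Matrix.linftyOpNormedAlgebra (n := Fin n) (R := ℂ) (α := B)
  exact @NormedSpace.exp_continuous (Matrix (Fin n) (Fin n) B) _
    (NormedAlgebra.restrictScalars ℚ ℂ _) hc

theorem exp_mem_unitary_matrix [StarRing B] [ContinuousStar B] {x : Matrix (Fin n) (Fin n) B}
    (hx : star x = -x) : NormedSpace.exp x ∈ unitary (Matrix (Fin n) (Fin n) B) := by
  let : NormedAlgebra ℚ B := NormedAlgebra.restrictScalars ℚ ℂ _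
  have h1 : NormedSpace.exp (-x) * NormedSpace.exp x = 1 := by
    rw [← Matrix.exp_add_of_commute _ _ (Commute.refl x).neg_left, neg_add_cancel,
      NormedSpace.exp_zero]
  have h2 : NormedSpace.exp x * NormedSpace.exp (-x) = 1 := by
    rw [← Matrix.exp_add_of_commute _ _ (Commute.refl x).neg_right, add_neg_cancel,
      NormedSpace.exp_zero]
  rw [Unitary.mem_iff, NormedSpace.star_exp, hx]
  exact ⟨h1, h2⟩

/-- For an idempotent p the series collapses to exp(cp) = 1 + (e^c - 1)p. -/
theorem exp_smul_idempotent_matrix {p : Matrix (Fin n) (Fin n) B} (hp : IsIdempotentElem p)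
    {c : ℂ} (hc : Complex.exp c = 1) : NormedSpace.exp (c • p) = 1 := by
  have h1 := hasSum_exp_matrix (c • p)
  have h2 : HasSum (fun k : ℕ => ((k.factorial : ℂ)⁻¹ * c ^ k) • p) (Complex.exp c • p) := by
    have := NormedSpace.exp_series_hasSum_exp' (𝕂 := ℂ) c
    rw [← Complex.exp_eq_exp_ℂ] at this
    exact (by simpa [smul_eq_mul] using this : HasSum (fun k : ℕ => (k.factorial : ℂ)⁻¹ * c ^ k)
      (Complex.exp c)).smul_const p
  have h3 : HasSum (fun k : ℕ => if k = 0 then (1 - p) else 0) (1 - p) := hasSum_ite_eq 0 (1 - p)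
  have h4 := h2.add h3
  rw [hc, one_smul, add_sub_cancel] at h4
  refine h1.unique (h4.congr_fun ?_)
  intro k
  rcases Nat.eq_zero_or_pos k with rfl | hk
  · simp
  · simp [hk.ne', smul_pow, smul_smul, hp.pow_eq hk.ne']

theorem continuous_exp_smul_matrix {T : Type*} [TopologicalSpace T]
    {f : T → Matrix (Fin n) (Fin n) B} (hf : Continuous f) (c : ℂ) :
    Continuous fun t => NormedSpace.exp (c • f t) :=
  continuous_exp_matrix.comp (continuous_matrix fun i j => (hf.matrix_elem i j).const_smul c)

theorem continuous_lineMap_matrix (x y : Matrix (Fin n) (Fin n) B) :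
    Continuous fun t : unitInterval => x + ((t : ℝ) : ℂ) • (y - x) := by
  refine continuous_matrix fun i j => ?_
  have h : Continuous fun t : unitInterval => x i j + ((t : ℝ) : ℂ) • (y i j - x i j) := by
    fun_prop
  exact h

end MatrixExp

/-! ### Block sums of matrices -/

section Blocks

variable {B : Type*} {m n : ℕ}

theorem blockSum_zero [Zero B] : blockSum (0 : Matrix (Fin m) (Fin m) B)
    (0 : Matrix (Fin n) (Fin n) B) = 0 := by
  simp [blockSum]

theorem blockSum_one [Zero B] [One B] : blockSum (1 : Matrix (Fin m) (Fin m) B)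
    (1 : Matrix (Fin n) (Fin n) B) = 1 := by
  simp [blockSum]

theorem blockSum_mul [NonUnitalNonAssocSemiring B] (a a' : Matrix (Fin m) (Fin m) B)
    (b b' : Matrix (Fin n) (Fin n) B) :
    blockSum a b * blockSum a' b' = blockSum (a * a') (b * b') := by
  simp [blockSum, Matrix.fromBlocks_multiply, Matrix.submatrix_mul_equiv]

theorem blockSum_add [AddZeroClass B] (a a' : Matrix (Fin m) (Fin m) B)
    (b b' : Matrix (Fin n) (Fin n) B) :
    blockSum a b + blockSum a' b' = blockSum (a + a') (b + b') := by
  simp only [blockSum, Matrix.reindex_apply]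
  rw [← add_zero (0 : Matrix (Fin m) (Fin n) B), ← add_zero (0 : Matrix (Fin n) (Fin m) B),
    ← Matrix.fromBlocks_add, add_zero, add_zero]
  rfl

theorem blockSum_pow [Semiring B] (a : Matrix (Fin m) (Fin m) B)
    (b : Matrix (Fin n) (Fin n) B) (k : ℕ) :
    blockSum a b ^ k = blockSum (a ^ k) (b ^ k) := by
  induction k with
  | zero => simp [blockSum_one]
  | succ k ih => rw [pow_succ, ih, blockSum_mul, pow_succ, pow_succ]

theorem blockSum_smul {R : Type*} [AddCommMonoid B] [Monoid R] [DistribMulAction R B] (r : R)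
    (a : Matrix (Fin m) (Fin m) B) (b : Matrix (Fin n) (Fin n) B) :
    r • blockSum a b = blockSum (r • a) (r • b) := by
  simp only [blockSum, Matrix.reindex_apply]
  rw [← smul_zero (A := Matrix (Fin m) (Fin n) B) r,
    ← smul_zero (A := Matrix (Fin n) (Fin m) B) r, ← Matrix.fromBlocks_smul, smul_zero, smul_zero]
  rfl

theorem blockSum_map {C : Type*} [Zero B] [Zero C] (f : B → C) (hf : f 0 = 0)
    (a : Matrix (Fin m) (Fin m) B) (b : Matrix (Fin n) (Fin n) B) :
    (blockSum a b).map f = blockSum (a.map f) (b.map f) := by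
  simp only [blockSum, Matrix.reindex_apply]
  rw [← Matrix.submatrix_map, Matrix.fromBlocks_map, Matrix.map_zero _ hf, Matrix.map_zero _ hf]

theorem continuous_blockSum [Zero B] [TopologicalSpace B] :
    Continuous fun x : Matrix (Fin m) (Fin m) B × Matrix (Fin n) (Fin n) B =>
      blockSum x.1 x.2 :=
  (continuous_fst.matrix_fromBlocks continuous_const continuous_const
    continuous_snd).matrix_reindex _ _

theorem exp_blockSum [NormedRing B] [NormedAlgebra ℂ B] [CompleteSpace B]
    (a : Matrix (Fin m) (Fin m) B) (b : Matrix (Fin n) (Fin n) B) :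
    NormedSpace.exp (blockSum a b) = blockSum (NormedSpace.exp a) (NormedSpace.exp b) := by
  let Φ : (Matrix (Fin m) (Fin m) B × Matrix (Fin n) (Fin n) B) →+
      Matrix (Fin (m + n)) (Fin (m + n)) B :=
    { toFun := fun x => blockSum x.1 x.2
      map_zero' := blockSum_zero
      map_add' := fun x y => (blockSum_add _ _ _ _).symm }
  have h := ((hasSum_exp_matrix a).prodMk (hasSum_exp_matrix b)).map Φ continuous_blockSum
  refine (hasSum_exp_matrix _).unique (h.congr_fun ?_)
  intro k
  simp [Φ, blockSum_pow, blockSum_smul]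

end Blocks

/-! ### Homomorphisms out of `K_0` and `K_1` -/

section KTheory

variable {B : Type*} [Ring B] [StarRing B] [TopologicalSpace B]

theorem k1Class_eq_of_joined {n : ℕ} {u v : UnitaryMat B n} (huv : Joined u v) :
    k1Class u = k1Class v := by
  rw [← sub_eq_zero]
  refine (QuotientAddGroup.eq_zero_iff _).2 (AddSubgroup.subset_closure ?_)
  exact Or.inr ⟨n, u, v, huv, rfl⟩

theorem k1Class_one {n : ℕ} : k1Class (1 : UnitaryMat B n) = 0 := by
  refine (QuotientAddGroup.eq_zero_iff _).2 (AddSubgroup.subset_closure ?_)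
  exact Or.inl (Or.inl ⟨n, 1, rfl, rfl⟩)

theorem k1Class_blockSum {m n : ℕ} {u : UnitaryMat B m} {v : UnitaryMat B n}
    {w : UnitaryMat B (m + n)} (hw : w.1 = blockSum u.1 v.1) :
    k1Class w = k1Class u + k1Class v := by
  rw [← sub_eq_zero, ← sub_sub]
  refine (QuotientAddGroup.eq_zero_iff _).2 (AddSubgroup.subset_closure ?_)
  exact Or.inl (Or.inr ⟨m, n, u, v, w, hw, rfl⟩)

theorem exists_k0Hom {G : Type*} [AddCommGroup G] (f : ∀ n, ProjMat B n → G)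
    (h0 : ∀ n (p : ProjMat B n), p.1 = 0 → f n p = 0)
    (hadd : ∀ m n (p : ProjMat B m) (q : ProjMat B n) (r : ProjMat B (m + n)),
      r.1 = blockSum p.1 q.1 → f (m + n) r = f m p + f n q)
    (hj : ∀ n (p q : ProjMat B n), Joined p q → f n p = f n q) :
    ∃ d : K0Unital B →+ G, ∀ (n : ℕ) (p : ProjMat B n), d (k0Class p) = f n p := by
  let Φ : FreeAbelianGroup (Σ n, ProjMat B n) →+ G := FreeAbelianGroup.lift fun x => f x.1 x.2
  have hΦ : ∀ (n : ℕ) (p : ProjMat B n), Φ (.of ⟨n, p⟩) = f n p :=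
    fun n p => FreeAbelianGroup.lift_apply_of _ _
  have hker : AddSubgroup.closure (k0Relators B) ≤ Φ.ker := by
    rw [AddSubgroup.closure_le]
    rintro x ((⟨n, p, hp, rfl⟩ | ⟨m, n, p, q, r, hr, rfl⟩) | ⟨n, p, q, hpq, rfl⟩)
    · exact (hΦ n p).trans (h0 n p hp)
    · change Φ _ = 0
      rw [map_sub, map_sub, hΦ, hΦ, hΦ, hadd m n p q r hr, add_sub_cancel_left, sub_self]
    · change Φ _ = 0
      rw [map_sub, hΦ, hΦ, hj n p q hpq, sub_self]
  exact ⟨QuotientAddGroup.lift _ Φ hker, fun n p => hΦ n p⟩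

theorem exists_k1Hom {G : Type*} [AddCommGroup G] (f : ∀ n, UnitaryMat B n → G)
    (h0 : ∀ n, f n 1 = 0)
    (hadd : ∀ m n (p : UnitaryMat B m) (q : UnitaryMat B n) (r : UnitaryMat B (m + n)),
      r.1 = blockSum p.1 q.1 → f (m + n) r = f m p + f n q)
    (hj : ∀ n (p q : UnitaryMat B n), Joined p q → f n p = f n q) :
    ∃ d : K1Unital B →+ G, ∀ (n : ℕ) (p : UnitaryMat B n), d (k1Class p) = f n p := by
  let Φ : FreeAbelianGroup (Σ n, UnitaryMat B n) →+ G := FreeAbelianGroup.lift fun x => f x.1 x.2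
  have hΦ : ∀ (n : ℕ) (p : UnitaryMat B n), Φ (.of ⟨n, p⟩) = f n p :=
    fun n p => FreeAbelianGroup.lift_apply_of _ _
  have hker : AddSubgroup.closure (k1Relators B) ≤ Φ.ker := by
    rw [AddSubgroup.closure_le]
    rintro x ((⟨n, p, rfl, rfl⟩ | ⟨m, n, p, q, r, hr, rfl⟩) | ⟨n, p, q, hpq, rfl⟩)
    · exact (hΦ n 1).trans (h0 n)
    · change Φ _ = 0
      rw [map_sub, map_sub, hΦ, hΦ, hΦ, hadd m n p q r hr, add_sub_cancel_left, sub_self]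
    · change Φ _ = 0
      rw [map_sub, hΦ, hΦ, hj n p q hpq, sub_self]
  exact ⟨QuotientAddGroup.lift _ Φ hker, fun n p => hΦ n p⟩

end KTheory

/-! ### Matrices over unitalizations -/

section MatIdeal

variable {𝓗 : Type*} [NormedAddCommGroup 𝓗] [InnerProductSpace ℂ 𝓗] [CompleteSpace 𝓗] {n m : ℕ}

/-! Shortcut instances that keep the instance search for unitalizations short. -/

section Shortcuts

variable (S : NonUnitalStarSubalgebra ℂ (𝓗 →L[ℂ] 𝓗))

instance : Ring (Unitization ℂ S) := inferInstance
instance : Ring (Unitization ℂ (𝓗 →L[ℂ] 𝓗)) := inferInstance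
instance : Semiring (Unitization ℂ S) := inferInstance
instance : Semiring (Unitization ℂ (𝓗 →L[ℂ] 𝓗)) := inferInstance
instance : NonUnitalNonAssocSemiring (Unitization ℂ S) := inferInstance
instance : NonUnitalNonAssocSemiring (Unitization ℂ (𝓗 →L[ℂ] 𝓗)) := inferInstance
instance : AddCommMonoid (Unitization ℂ S) := inferInstance
instance : AddCommMonoid (Unitization ℂ (𝓗 →L[ℂ] 𝓗)) := inferInstance
instance : AddMonoid (Unitization ℂ S) := inferInstance
instance : AddMonoid (Unitization ℂ (𝓗 →L[ℂ] 𝓗)) := inferInstance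
instance : AddZeroClass (Unitization ℂ S) := inferInstance
instance : AddZeroClass (Unitization ℂ (𝓗 →L[ℂ] 𝓗)) := inferInstance
instance : AddGroup (Unitization ℂ S) := inferInstance
instance : AddGroup (Unitization ℂ (𝓗 →L[ℂ] 𝓗)) := inferInstance
instance : Mul (Unitization ℂ S) := inferInstance
instance : Mul (Unitization ℂ (𝓗 →L[ℂ] 𝓗)) := inferInstance
instance : Add (Unitization ℂ S) := inferInstance
instance : Add (Unitization ℂ (𝓗 →L[ℂ] 𝓗)) := inferInstance
instance : Zero (Unitization ℂ S) := inferInstance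
instance : Zero (Unitization ℂ (𝓗 →L[ℂ] 𝓗)) := inferInstance
instance : StarRing (Unitization ℂ S) := inferInstance
instance : StarRing (Unitization ℂ (𝓗 →L[ℂ] 𝓗)) := inferInstance
instance : TopologicalSpace (Unitization ℂ S) := inferInstance
instance : TopologicalSpace (Unitization ℂ (𝓗 →L[ℂ] 𝓗)) := inferInstance

end Shortcuts

/-- Matrices over `B(𝓗)⁺` all of whose entries lie in `A⁺`. -/
def matUnitalization (A : NonUnitalStarSubalgebra ℂ (𝓗 →L[ℂ] 𝓗)) (n : ℕ) :
    Subalgebra ℂ (Matrix (Fin n) (Fin n) (Unitization ℂ (𝓗 →L[ℂ] 𝓗))) where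
  carrier := {x | ∀ i j, (x i j).snd ∈ A}
  mul_mem' := by
    intro x y hx hy i j
    rw [Matrix.mul_apply]
    have : (∑ k, x i k * y k j).snd = ∑ k, (x i k * y k j).snd :=
      map_sum (Unitization.sndHom ℂ ℂ (𝓗 →L[ℂ] 𝓗)) _ _
    rw [this]
    refine sum_mem fun k _ => ?_
    rw [Unitization.snd_mul]
    exact add_mem (add_mem (SMulMemClass.smul_mem _ (hy k j)) (SMulMemClass.smul_mem _ (hx i k)))
      (mul_mem (hx i k) (hy k j))
  add_mem' := by
    intro x y hx hy i j
    exact add_mem (hx i j) (hy i j)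
  algebraMap_mem' := by
    intro r i j
    rw [Matrix.algebraMap_matrix_apply]
    split_ifs
    · rw [Unitization.algebraMap_eq_inl, Unitization.snd_inl]
      exact zero_mem A
    · exact zero_mem A

/-- Matrices over `B(𝓗)⁺` all of whose entries lie in `I`. -/
def matIdeal (I : NonUnitalStarSubalgebra ℂ (𝓗 →L[ℂ] 𝓗)) (n : ℕ) :
    Submodule ℂ (Matrix (Fin n) (Fin n) (Unitization ℂ (𝓗 →L[ℂ] 𝓗))) where
  carrier := {x | ∀ i j, (x i j).fst = 0 ∧ (x i j).snd ∈ I}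
  zero_mem' := fun i j => ⟨rfl, zero_mem I⟩
  add_mem' := by
    intro x y hx hy i j
    refine ⟨?_, add_mem (hx i j).2 (hy i j).2⟩
    rw [Matrix.add_apply, Unitization.fst_add, (hx i j).1, (hy i j).1, add_zero]
  smul_mem' := by
    intro c x hx i j
    refine ⟨?_, SMulMemClass.smul_mem c (hx i j).2⟩
    rw [Matrix.smul_apply, Unitization.fst_smul, (hx i j).1, smul_zero]

variable {A I : NonUnitalStarSubalgebra ℂ (𝓗 →L[ℂ] 𝓗)}

theorem isClosed_matIdeal (hI : IsClosed (I : Set (𝓗 →L[ℂ] 𝓗))) :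
    IsClosed (matIdeal I n : Set (Matrix (Fin n) (Fin n) (Unitization ℂ (𝓗 →L[ℂ] 𝓗)))) := by
  have : (matIdeal I n : Set (Matrix (Fin n) (Fin n) (Unitization ℂ (𝓗 →L[ℂ] 𝓗)))) =
      ⋂ i, ⋂ j, {x | (x i j).fst = 0} ∩ {x | (x i j).snd ∈ (I : Set (𝓗 →L[ℂ] 𝓗))} := by
    ext x
    simp [matIdeal]
  rw [this]
  refine isClosed_iInter fun i => isClosed_iInter fun j => IsClosed.inter ?_ ?_
  · exact isClosed_singleton.preimage
      (Unitization.continuous_fst.comp (continuous_id.matrix_elem i j))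
  · exact hI.preimage (Unitization.continuous_snd.comp (continuous_id.matrix_elem i j))

theorem mul_mem_matIdeal (hI : ∀ S ∈ A, ∀ T ∈ I, S * T ∈ I)
    {x y : Matrix (Fin n) (Fin n) (Unitization ℂ (𝓗 →L[ℂ] 𝓗))} (hx : x ∈ matUnitalization A n)
    (hy : y ∈ matIdeal I n) : x * y ∈ matIdeal I n := by
  intro i j
  rw [Matrix.mul_apply]
  have h1 : (∑ k, x i k * y k j).snd = ∑ k, (x i k * y k j).snd :=
    map_sum (Unitization.sndHom ℂ ℂ (𝓗 →L[ℂ] 𝓗)) _ _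
  have h2 : (∑ k, x i k * y k j).fst = ∑ k, (x i k * y k j).fst :=
    map_sum (Unitization.fstHom ℂ (𝓗 →L[ℂ] 𝓗)) _ _
  rw [h1, h2]
  refine ⟨Finset.sum_eq_zero fun k _ => ?_, sum_mem fun k _ => ?_⟩
  · rw [Unitization.fst_mul, (hy k j).1, mul_zero]
  · rw [Unitization.snd_mul, (hy k j).1, zero_smul, add_zero]
    exact add_mem (SMulMemClass.smul_mem _ (hy k j).2) (hI _ (hx i k) _ (hy k j).2)

theorem mul_mem_matIdeal' (hI : ∀ S ∈ A, ∀ T ∈ I, T * S ∈ I)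
    {x y : Matrix (Fin n) (Fin n) (Unitization ℂ (𝓗 →L[ℂ] 𝓗))} (hx : x ∈ matUnitalization A n)
    (hy : y ∈ matIdeal I n) : y * x ∈ matIdeal I n := by
  intro i j
  rw [Matrix.mul_apply]
  have h1 : (∑ k, y i k * x k j).snd = ∑ k, (y i k * x k j).snd :=
    map_sum (Unitization.sndHom ℂ ℂ (𝓗 →L[ℂ] 𝓗)) _ _
  have h2 : (∑ k, y i k * x k j).fst = ∑ k, (y i k * x k j).fst :=
    map_sum (Unitization.fstHom ℂ (𝓗 →L[ℂ] 𝓗)) _ _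
  rw [h1, h2]
  refine ⟨Finset.sum_eq_zero fun k _ => ?_, sum_mem fun k _ => ?_⟩
  · rw [Unitization.fst_mul, (hy i k).1, zero_mul]
  · rw [Unitization.snd_mul, (hy i k).1, zero_smul, zero_add]
    exact add_mem (SMulMemClass.smul_mem _ (hy i k).2) (hI _ (hx k j) _ (hy i k).2)

/-- Modulo a closed ideal the exponential depends only on the class of its argument: powers differ
by elements of the ideal by telescoping, and the series converges. -/
theorem exp_sub_exp_mem_matIdeal (hIc : IsClosed (I : Set (𝓗 →L[ℂ] 𝓗)))
    (hI : ∀ S ∈ A, ∀ T ∈ I, S * T ∈ I ∧ T * S ∈ I)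
    {x y : Matrix (Fin n) (Fin n) (Unitization ℂ (𝓗 →L[ℂ] 𝓗))} (hx : x ∈ matUnitalization A n)
    (hy : y ∈ matUnitalization A n) (hxy : x - y ∈ matIdeal I n) :
    NormedSpace.exp x - NormedSpace.exp y ∈ matIdeal I n := by
  have hpow : ∀ k : ℕ, x ^ k - y ^ k ∈ matIdeal I n := by
    intro k
    induction k with
    | zero => simp
    | succ k ih =>
      have : x ^ (k + 1) - y ^ (k + 1) = x ^ k * (x - y) + (x ^ k - y ^ k) * y := by
        rw [pow_succ, pow_succ]; noncomm_ring
      rw [this]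
      exact add_mem (mul_mem_matIdeal (fun S hS T hT => (hI S hS T hT).1) (pow_mem hx k) hxy)
        (mul_mem_matIdeal' (fun S hS T hT => (hI S hS T hT).2) hy ih)
  have h := (hasSum_exp_matrix x).sub (hasSum_exp_matrix y)
  refine (isClosed_matIdeal hIc).mem_of_tendsto h (Filter.Eventually.of_forall fun s => ?_)
  refine sum_mem fun k _ => ?_
  rw [← smul_sub]
  exact Submodule.smul_mem _ _ (hpow k)

theorem matIncl_apply (S : NonUnitalStarSubalgebra ℂ (𝓗 →L[ℂ] 𝓗))
    (a : Matrix (Fin n) (Fin n) (Unitization ℂ S)) (i j : Fin n) :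
    (matIncl S a i j).fst = (a i j).fst ∧ (matIncl S a i j).snd = ((a i j).snd : 𝓗 →L[ℂ] 𝓗) := by
  simp [matIncl, Unitization.starMap, Unitization.starLift, Unitization.algebraMap_eq_inl]

theorem matIncl_injective (S : NonUnitalStarSubalgebra ℂ (𝓗 →L[ℂ] 𝓗)) :
    Function.Injective (matIncl S : Matrix (Fin n) (Fin n) (Unitization ℂ S) → _) := by
  intro a b hab
  ext i j
  · rw [← (matIncl_apply S a i j).1, hab, (matIncl_apply S b i j).1]
  · rw [← (matIncl_apply S a i j).2, hab, (matIncl_apply S b i j).2]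

theorem matIncl_mul (S : NonUnitalStarSubalgebra ℂ (𝓗 →L[ℂ] 𝓗))
    (a b : Matrix (Fin n) (Fin n) (Unitization ℂ S)) :
    matIncl S (a * b) = matIncl S a * matIncl S b :=
  Matrix.map_mul

theorem matIncl_add (S : NonUnitalStarSubalgebra ℂ (𝓗 →L[ℂ] 𝓗))
    (a b : Matrix (Fin n) (Fin n) (Unitization ℂ S)) :
    matIncl S (a + b) = matIncl S a + matIncl S b :=
  Matrix.ext fun i j => Unitization.ext
    (by rw [(matIncl_apply S _ i j).1, Matrix.add_apply, Matrix.add_apply, Unitization.fst_add,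
      Unitization.fst_add, (matIncl_apply S _ i j).1, (matIncl_apply S _ i j).1])
    (by rw [(matIncl_apply S _ i j).2, Matrix.add_apply, Matrix.add_apply, Unitization.snd_add,
      Unitization.snd_add, (matIncl_apply S _ i j).2, (matIncl_apply S _ i j).2]; rfl)

theorem matIncl_smul (S : NonUnitalStarSubalgebra ℂ (𝓗 →L[ℂ] 𝓗)) (c : ℂ)
    (a : Matrix (Fin n) (Fin n) (Unitization ℂ S)) :
    matIncl S (c • a) = c • matIncl S a :=
  Matrix.ext fun i j => Unitization.ext
    (by rw [(matIncl_apply S _ i j).1, Matrix.smul_apply, Matrix.smul_apply, Unitization.fst_smul,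
      Unitization.fst_smul, (matIncl_apply S _ i j).1])
    (by rw [(matIncl_apply S _ i j).2, Matrix.smul_apply, Matrix.smul_apply, Unitization.snd_smul,
      Unitization.snd_smul, (matIncl_apply S _ i j).2]; rfl)

theorem matIncl_sub (S : NonUnitalStarSubalgebra ℂ (𝓗 →L[ℂ] 𝓗))
    (a b : Matrix (Fin n) (Fin n) (Unitization ℂ S)) :
    matIncl S (a - b) = matIncl S a - matIncl S b := by
  rw [eq_sub_iff_add_eq, ← matIncl_add, sub_add_cancel]

theorem matIncl_one (S : NonUnitalStarSubalgebra ℂ (𝓗 →L[ℂ] 𝓗)) :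
    matIncl S (1 : Matrix (Fin n) (Fin n) (Unitization ℂ S)) = 1 :=
  Matrix.map_one _ (map_zero _) (map_one _)

theorem matIncl_star (S : NonUnitalStarSubalgebra ℂ (𝓗 →L[ℂ] 𝓗))
    (a : Matrix (Fin n) (Fin n) (Unitization ℂ S)) :
    matIncl S (star a) = star (matIncl S a) := by
  ext1 i j
  simp only [matIncl, Matrix.star_apply, Matrix.map_apply]
  exact map_star _ _

theorem matIncl_blockSum (S : NonUnitalStarSubalgebra ℂ (𝓗 →L[ℂ] 𝓗))
    (a : Matrix (Fin m) (Fin m) (Unitization ℂ S)) (b : Matrix (Fin n) (Fin n) (Unitization ℂ S)) :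
    matIncl S (blockSum a b) = blockSum (matIncl S a) (matIncl S b) :=
  blockSum_map _ (map_zero _) _ _

/-- The inclusion into matrices over B(𝓗)⁺ is a topological embedding, because unitalizations carry
the product topology. Paths in the small algebra can therefore be built in the large one, where all
exponentials are formed. -/
theorem continuous_of_matIncl {T : Type*} [TopologicalSpace T]
    {S : NonUnitalStarSubalgebra ℂ (𝓗 →L[ℂ] 𝓗)}
    {f : T → Matrix (Fin n) (Fin n) (Unitization ℂ S)}
    (hf : Continuous fun t => matIncl S (f t)) : Continuous f := by
  refine continuous_matrix fun i j => ?_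
  refine (Unitization.uniformEquivProd (𝕜 := ℂ)
    (A := S)).toHomeomorph.isInducing.continuous_iff.mpr ?_
  have h := hf.matrix_elem i j
  refine Continuous.prodMk (g := fun t => (f t i j).snd) (f := fun t => (f t i j).fst) ?_ ?_
  · exact (Unitization.continuous_fst.comp h).congr fun t => (matIncl_apply S (f t) i j).1
  · refine Continuous.subtype_mk (f := fun t => ((f t i j).snd : 𝓗 →L[ℂ] 𝓗)) ?_ _
    exact (Unitization.continuous_snd.comp h).congr fun t => (matIncl_apply S (f t) i j).2

theorem continuous_matIncl {S : NonUnitalStarSubalgebra ℂ (𝓗 →L[ℂ] 𝓗)} :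
    Continuous (matIncl S : Matrix (Fin n) (Fin n) (Unitization ℂ S) → _) := by
  refine continuous_matrix fun i j => ?_
  refine (Unitization.uniformEquivProd (𝕜 := ℂ)
    (A := 𝓗 →L[ℂ] 𝓗)).toHomeomorph.isInducing.continuous_iff.mpr ?_
  have h := (continuous_id (X := Matrix (Fin n) (Fin n) (Unitization ℂ S))).matrix_elem i j
  refine Continuous.prodMk (g := fun a => (matIncl S a i j).snd)
    (f := fun a => (matIncl S a i j).fst) ?_ ?_
  · exact (Unitization.continuous_fst.comp h).congr fun t => (matIncl_apply S t i j).1.symm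
  · exact (continuous_subtype_val.comp (Unitization.continuous_snd.comp h)).congr
      fun t => (matIncl_apply S t i j).2.symm

theorem exists_unitaryMat {J : NonUnitalStarSubalgebra ℂ (𝓗 →L[ℂ] 𝓗)}
    {U : Matrix (Fin n) (Fin n) (Unitization ℂ (𝓗 →L[ℂ] 𝓗))}
    (hU : U ∈ unitary (Matrix (Fin n) (Fin n) (Unitization ℂ (𝓗 →L[ℂ] 𝓗))))
    (hJ : U - 1 ∈ matIdeal J n) :
    ∃ u : UnitaryMat (Unitization ℂ J) n, matIncl J u.1 = U := by
  have hsnd : ∀ i j, (U i j).snd ∈ J := by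
    intro i j
    have := (hJ i j).2
    rw [Matrix.sub_apply, show (U i j - (1 : Matrix (Fin n) (Fin n) _) i j).snd = (U i j).snd -
      ((1 : Matrix (Fin n) (Fin n) (Unitization ℂ (𝓗 →L[ℂ] 𝓗))) i j).snd from
      map_sub (Unitization.sndHom ℂ ℂ (𝓗 →L[ℂ] 𝓗)) _ _, Matrix.one_apply] at this
    split_ifs at this <;> simpa using this
  let u : Matrix (Fin n) (Fin n) (Unitization ℂ J) := fun i j =>
    Unitization.inl (U i j).fst + Unitization.inr ⟨(U i j).snd, hsnd i j⟩
  have hu : matIncl J u = U := by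
    ext1 i j
    refine Unitization.ext ?_ ?_
    · rw [(matIncl_apply J u i j).1]; simp [u]
    · rw [(matIncl_apply J u i j).2]; simp [u]
  refine ⟨⟨u, ?_⟩, hu⟩
  rw [Unitary.mem_iff] at hU ⊢
  constructor <;> apply matIncl_injective J
  · rw [matIncl_mul, matIncl_star, hu, hU.1, matIncl_one]
  · rw [matIncl_mul, matIncl_star, hu, hU.2, matIncl_one]

theorem joined_of_matIncl_path {J : NonUnitalStarSubalgebra ℂ (𝓗 →L[ℂ] 𝓗)}
    {U : unitInterval → Matrix (Fin n) (Fin n) (Unitization ℂ (𝓗 →L[ℂ] 𝓗))} (hU : Continuous U)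
    (h : ∀ t, ∃ u : UnitaryMat (Unitization ℂ J) n, matIncl J u.1 = U t)
    {u v : UnitaryMat (Unitization ℂ J) n} (hu : matIncl J u.1 = U 0) (hv : matIncl J v.1 = U 1) :
    Joined u v := by
  choose w hw using h
  refine ⟨⟨⟨w, ?_⟩, ?_, ?_⟩⟩
  · refine continuous_induced_rng.mpr (continuous_of_matIncl ?_)
    exact hU.congr fun t => (hw t).symm
  · exact Subtype.ext (matIncl_injective J ((hw 0).trans hu.symm))
  · exact Subtype.ext (matIncl_injective J ((hw 1).trans hv.symm))

end MatIdeal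

/-! ### The boundary map -/

section Boundary

variable {𝓗 : Type*} [NormedAddCommGroup 𝓗] [InnerProductSpace ℂ 𝓗] [CompleteSpace 𝓗] {n m : ℕ}
variable {A I₁ I₂ J : NonUnitalStarSubalgebra ℂ (𝓗 →L[ℂ] 𝓗)}

/-- The hypotheses under which the Mayer–Vietoris boundary map exists: `I₁` and `I₂` are closed
ideals of `A`, `J` is their intersection, and compression by `P` is a splitting of
`A = I₁ + I₂`. -/
structure IsMayerVietorisTriple (A I₁ I₂ J : NonUnitalStarSubalgebra ℂ (𝓗 →L[ℂ] 𝓗))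
    (P : 𝓗 →L[ℂ] 𝓗) : Prop where
  le₁ : I₁ ≤ A
  closed₁ : IsClosed (I₁ : Set (𝓗 →L[ℂ] 𝓗))
  closed₂ : IsClosed (I₂ : Set (𝓗 →L[ℂ] 𝓗))
  ideal₁ : ∀ S ∈ A, ∀ T ∈ I₁, S * T ∈ I₁ ∧ T * S ∈ I₁
  ideal₂ : ∀ S ∈ A, ∀ T ∈ I₂, S * T ∈ I₂ ∧ T * S ∈ I₂
  mem_iff : ∀ T, T ∈ J ↔ T ∈ I₁ ∧ T ∈ I₂
  selfAdjoint : IsSelfAdjoint P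
  cut_mem : ∀ T ∈ A, P * T * P ∈ I₁
  sub_cut_mem : ∀ T ∈ A, T - P * T * P ∈ I₂

theorem star_smul_matIncl {S : NonUnitalStarSubalgebra ℂ (𝓗 →L[ℂ] 𝓗)}
    {a : Matrix (Fin n) (Fin n) (Unitization ℂ S)} (ha : IsSelfAdjoint a) :
    star ((2 * Real.pi * Complex.I : ℂ) • matIncl S a) =
      -((2 * Real.pi * Complex.I : ℂ) • matIncl S a) := by
  rw [star_smul, ← matIncl_star, ha.star_eq, ← neg_smul]
  simp

theorem exp_two_pi_I : Complex.exp (2 * Real.pi * Complex.I : ℂ) = 1 :=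
  Complex.exp_two_pi_mul_I

namespace IsMayerVietorisTriple

variable {P : 𝓗 →L[ℂ] 𝓗} (h : IsMayerVietorisTriple A I₁ I₂ J P)

/-- Modulo I₂ the lift a agrees with the idempotent p, and modulo I₁ with its scalar part `s`, which
is idempotent because p is. In both cases exp(2πi ·) becomes 1, so exp(2πi a) - 1 lies in both
ideals and hence in J. -/
theorem exists_unitaryMat_of_isLift (h : IsMayerVietorisTriple A I₁ I₂ J P)
    {p : Matrix (Fin n) (Fin n) (Unitization ℂ A)}
    (hp : IsStarProjection p) {a : Matrix (Fin n) (Fin n) (Unitization ℂ I₁)}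
    (ha : IsLift I₂ p a) : ∃ u : UnitaryMat (Unitization ℂ J) n,
      matIncl J u.1 = NormedSpace.exp ((2 * Real.pi * Complex.I : ℂ) • matIncl I₁ a) := by
  set c : ℂ := 2 * Real.pi * Complex.I with hc
  have hexp : Complex.exp c = 1 := exp_two_pi_I
  refine exists_unitaryMat (exp_mem_unitary_matrix (star_smul_matIncl ha.1)) ?_
  have hmemA : c • matIncl I₁ a ∈ matUnitalization A n := by
    refine Subalgebra.smul_mem _ (fun i j => ?_) c
    rw [(matIncl_apply I₁ a i j).2]
    exact h.le₁ (a i j).snd.2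
  have h2 : NormedSpace.exp (c • matIncl I₁ a) - 1 ∈ matIdeal I₂ n := by
    have hidem : IsIdempotentElem (matIncl A p) := by
      rw [IsIdempotentElem, ← matIncl_mul, hp.isIdempotentElem.eq]
    have key := exp_sub_exp_mem_matIdeal (x := c • matIncl I₁ a) (y := c • matIncl A p)
      h.closed₂ h.ideal₂ hmemA ?_ ?_
    · rwa [exp_smul_idempotent_matrix hidem hexp] at key
    · refine Subalgebra.smul_mem _ (fun i j => ?_) c
      rw [(matIncl_apply A p i j).2]
      exact (p i j).snd.2
    · rw [← smul_sub]
      refine Submodule.smul_mem _ _ fun i j => ?_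
      rw [Matrix.sub_apply]
      refine ⟨?_, ?_⟩
      · refine (map_sub (Unitization.fstHom ℂ (𝓗 →L[ℂ] 𝓗)) _ _).trans ?_
        change (matIncl I₁ a i j).fst - (matIncl A p i j).fst = 0
        rw [(matIncl_apply A p i j).1, (matIncl_apply I₁ a i j).1, (ha.2 i j).1, sub_self]
      · have : (matIncl I₁ a i j - matIncl A p i j).snd =
            -(((p i j).snd : 𝓗 →L[ℂ] 𝓗) - ((a i j).snd : 𝓗 →L[ℂ] 𝓗)) := by
          refine (map_sub (Unitization.sndHom ℂ ℂ (𝓗 →L[ℂ] 𝓗)) _ _).trans ?_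
          change (matIncl I₁ a i j).snd - (matIncl A p i j).snd = _
          rw [(matIncl_apply A p i j).2, (matIncl_apply I₁ a i j).2, neg_sub]
        rw [this]
        exact neg_mem (ha.2 i j).2
  have h1 : NormedSpace.exp (c • matIncl I₁ a) - 1 ∈ matIdeal I₁ n := by
    let s : Matrix (Fin n) (Fin n) (Unitization ℂ (𝓗 →L[ℂ] 𝓗)) :=
      p.map fun z => algebraMap ℂ _ z.fst
    have hidem : IsIdempotentElem s := by
      have h0 : s = p.map ((Algebra.ofId ℂ (Unitization ℂ (𝓗 →L[ℂ] 𝓗))).comp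
        (Unitization.fstHom ℂ A)) := rfl
      rw [IsIdempotentElem, h0, ← Matrix.map_mul, hp.isIdempotentElem.eq]
    have key := exp_sub_exp_mem_matIdeal (x := c • matIncl I₁ a) (y := c • s)
      h.closed₁ h.ideal₁ hmemA ?_ ?_
    · rwa [exp_smul_idempotent_matrix hidem hexp] at key
    · refine Subalgebra.smul_mem _ (fun i j => ?_) c
      simp only [s, Matrix.map_apply, Unitization.algebraMap_eq_inl, Unitization.snd_inl]
      exact zero_mem A
    · rw [← smul_sub]
      refine Submodule.smul_mem _ _ fun i j => ?_
      rw [Matrix.sub_apply]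
      refine ⟨?_, ?_⟩
      · refine (map_sub (Unitization.fstHom ℂ (𝓗 →L[ℂ] 𝓗)) _ _).trans ?_
        change (matIncl I₁ a i j).fst - (s i j).fst = 0
        rw [(matIncl_apply I₁ a i j).1, (ha.2 i j).1]
        simp [s, Unitization.algebraMap_eq_inl]
      · have : (matIncl I₁ a i j - s i j).snd = ((a i j).snd : 𝓗 →L[ℂ] 𝓗) := by
          refine (map_sub (Unitization.sndHom ℂ ℂ (𝓗 →L[ℂ] 𝓗)) _ _).trans ?_
          change (matIncl I₁ a i j).snd - (s i j).snd = _
          rw [(matIncl_apply I₁ a i j).2]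
          simp [s, Unitization.algebraMap_eq_inl]
        rw [this]
        exact (a i j).snd.2
  exact fun i j => ⟨(h1 i j).1, (h.mem_iff _).2 ⟨(h1 i j).2, (h2 i j).2⟩⟩

/-- The lift of a matrix `p` obtained by compressing its entries. -/
def cutLift (h : IsMayerVietorisTriple A I₁ I₂ J P) (p : Matrix (Fin n) (Fin n) (Unitization ℂ A)) :
    Matrix (Fin n) (Fin n) (Unitization ℂ I₁) :=
  p.map fun z => Unitization.inl z.fst +
    Unitization.inr ⟨P * (z.snd : 𝓗 →L[ℂ] 𝓗) * P, h.cut_mem _ z.snd.2⟩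

theorem cutLift_apply (p : Matrix (Fin n) (Fin n) (Unitization ℂ A)) (i j : Fin n) :
    (h.cutLift p i j).fst = (p i j).fst ∧
      ((h.cutLift p i j).snd : 𝓗 →L[ℂ] 𝓗) = P * ((p i j).snd : 𝓗 →L[ℂ] 𝓗) * P := by
  simp [cutLift]

theorem isLift_cutLift {p : Matrix (Fin n) (Fin n) (Unitization ℂ A)} (hp : IsSelfAdjoint p) :
    IsLift I₂ p (h.cutLift p) := by
  refine ⟨?_, fun i j => ⟨(h.cutLift_apply p i j).1, ?_⟩⟩
  · ext i j
    · rw [Matrix.star_apply, Unitization.fst_star, (h.cutLift_apply p i j).1,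
        (h.cutLift_apply p j i).1, ← Unitization.fst_star, ← Matrix.star_apply, hp.star_eq]
    · rw [Matrix.star_apply, Unitization.snd_star, StarMemClass.coe_star,
        (h.cutLift_apply p i j).2, (h.cutLift_apply p j i).2, star_mul, star_mul,
        h.selfAdjoint.star_eq, ← mul_assoc, ← StarMemClass.coe_star,
        ← Unitization.snd_star, ← Matrix.star_apply, hp.star_eq]
  · rw [(h.cutLift_apply p i j).2]
    exact h.sub_cut_mem _ (p i j).snd.2

theorem continuous_cutLift :
    Continuous (h.cutLift : Matrix (Fin n) (Fin n) (Unitization ℂ A) → _) := by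
  refine continuous_of_matIncl (continuous_matrix fun i j => ?_)
  refine (Unitization.uniformEquivProd (𝕜 := ℂ)
    (A := 𝓗 →L[ℂ] 𝓗)).toHomeomorph.isInducing.continuous_iff.mpr ?_
  have hc := (continuous_id (X := Matrix (Fin n) (Fin n) (Unitization ℂ A))).matrix_elem i j
  refine Continuous.prodMk (g := fun a => (matIncl I₁ (h.cutLift a) i j).snd)
    (f := fun a => (matIncl I₁ (h.cutLift a) i j).fst) ?_ ?_
  · refine (Unitization.continuous_fst.comp hc).congr fun t => ?_
    rw [(matIncl_apply I₁ _ i j).1, (h.cutLift_apply t i j).1]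
    rfl
  · refine ((continuous_const (y := P)).mul (continuous_subtype_val.comp
      (Unitization.continuous_snd.comp hc)) |>.mul (continuous_const (y := P))).congr fun t => ?_
    rw [(matIncl_apply I₁ _ i j).2, (h.cutLift_apply t i j).2]
    rfl

theorem cutLift_zero : h.cutLift (0 : Matrix (Fin n) (Fin n) (Unitization ℂ A)) = 0 := by
  refine Matrix.ext fun i j => Unitization.ext (h.cutLift_apply _ i j).1 (Subtype.ext ?_)
  rw [(h.cutLift_apply _ i j).2]
  change P * 0 * P = 0
  simp

theorem cutLift_blockSum (p : Matrix (Fin m) (Fin m) (Unitization ℂ A))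
    (q : Matrix (Fin n) (Fin n) (Unitization ℂ A)) :
    h.cutLift (blockSum p q) = blockSum (h.cutLift p) (h.cutLift q) := by
  refine blockSum_map _ ?_ _ _
  ext
  · simp
  · simp

/-- The unitary `exp(2πi a)` in `M_n(J⁺)`, for the compressed lift `a` of `p`. -/
def expUnitary (h : IsMayerVietorisTriple A I₁ I₂ J P) (p : ProjMat (Unitization ℂ A) n) :
    UnitaryMat (Unitization ℂ J) n :=
  (h.exists_unitaryMat_of_isLift p.2 (h.isLift_cutLift p.2.isSelfAdjoint)).choose

theorem matIncl_expUnitary (p : ProjMat (Unitization ℂ A) n) :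
    matIncl J (h.expUnitary p).1 =
      NormedSpace.exp ((2 * Real.pi * Complex.I : ℂ) • matIncl I₁ (h.cutLift p.1)) :=
  (h.exists_unitaryMat_of_isLift p.2 (h.isLift_cutLift p.2.isSelfAdjoint)).choose_spec

theorem k1Class_expUnitary_zero {p : ProjMat (Unitization ℂ A) n} (hp : p.1 = 0) :
    k1Class (h.expUnitary p) = 0 := by
  have h1 : h.expUnitary p = 1 := by
    refine Subtype.ext (matIncl_injective J ?_)
    have h0 : matIncl I₁ (0 : Matrix (Fin n) (Fin n) (Unitization ℂ I₁)) = 0 :=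
      Matrix.map_zero _ (map_zero _)
    rw [h.matIncl_expUnitary, hp, h.cutLift_zero, h0, smul_zero, NormedSpace.exp_zero]
    exact (matIncl_one J).symm
  rw [h1]
  exact k1Class_one

theorem k1Class_expUnitary_blockSum {p : ProjMat (Unitization ℂ A) m}
    {q : ProjMat (Unitization ℂ A) n} {r : ProjMat (Unitization ℂ A) (m + n)}
    (hr : r.1 = blockSum p.1 q.1) :
    k1Class (h.expUnitary r) = k1Class (h.expUnitary p) + k1Class (h.expUnitary q) := by
  refine k1Class_blockSum (matIncl_injective J ?_)
  rw [matIncl_blockSum, h.matIncl_expUnitary, h.matIncl_expUnitary, h.matIncl_expUnitary, hr,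
    h.cutLift_blockSum, matIncl_blockSum, blockSum_smul, exp_blockSum]

set_option maxHeartbeats 1000000 in
theorem k1Class_expUnitary_of_joined {p q : ProjMat (Unitization ℂ A) n} (hpq : Joined p q) :
    k1Class (h.expUnitary p) = k1Class (h.expUnitary q) := by
  obtain ⟨γ⟩ := hpq
  have h1 : Continuous fun t => (γ t).1 := continuous_subtype_val.comp γ.continuous
  have h2 : Continuous fun t => matIncl I₁ (h.cutLift (γ t).1) :=
    continuous_matIncl.comp (h.continuous_cutLift.comp h1)
  refine k1Class_eq_of_joined (joined_of_matIncl_path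
    (continuous_exp_smul_matrix h2 (2 * Real.pi * Complex.I)) ?_ ?_ ?_)
  · exact fun t => ⟨_, h.matIncl_expUnitary (γ t)⟩
  · rw [h.matIncl_expUnitary, γ.source]
  · rw [h.matIncl_expUnitary, γ.target]

/-- The boundary map, on `K_0` of the unitalization. -/
theorem exists_unitalHom : ∃ d : K0Unital (Unitization ℂ A) →+ K1 J,
    ∀ (n : ℕ) (p : ProjMat (Unitization ℂ A) n), d (k0Class p) = k1Class (h.expUnitary p) :=
  exists_k0Hom (fun _ p => k1Class (h.expUnitary p))
    (fun _ _ hp => h.k1Class_expUnitary_zero hp)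
    (fun _ _ _ _ _ hr => h.k1Class_expUnitary_blockSum hr)
    (fun _ _ _ hpq => h.k1Class_expUnitary_of_joined hpq)

/-- Lifts form a convex set; this is why the boundary class does not depend on the choice of lift.
-/
theorem isLift_lineMap {p : Matrix (Fin n) (Fin n) (Unitization ℂ A)}
    {a b : Matrix (Fin n) (Fin n) (Unitization ℂ I₁)} (ha : IsLift I₂ p a) (hb : IsLift I₂ p b)
    (t : ℝ) : IsLift I₂ p (a + (t : ℂ) • (b - a)) := by
  refine ⟨?_, fun i j => ⟨?_, ?_⟩⟩
  · rw [isSelfAdjoint_iff, star_add, star_smul, star_sub, ha.1.star_eq, hb.1.star_eq]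
    simp
  · have : ((a + (t : ℂ) • (b - a)) i j).fst =
        (a i j).fst + (t : ℂ) * ((b i j).fst - (a i j).fst) := rfl
    rw [this, (ha.2 i j).1, (hb.2 i j).1]
    ring
  · have h1 : (((a + (t : ℂ) • (b - a)) i j).snd : 𝓗 →L[ℂ] 𝓗) =
        (a i j).snd + (t : ℂ) • (((b i j).snd : 𝓗 →L[ℂ] 𝓗) - (a i j).snd) := rfl
    have h2 : ((p i j).snd : 𝓗 →L[ℂ] 𝓗) - ((a + (t : ℂ) • (b - a)) i j).snd =
        (((p i j).snd : 𝓗 →L[ℂ] 𝓗) - (a i j).snd) + (t : ℂ) • ((((p i j).snd : 𝓗 →L[ℂ] 𝓗) -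
          (b i j).snd) - (((p i j).snd : 𝓗 →L[ℂ] 𝓗) - (a i j).snd)) := by
      rw [h1]
      module
    rw [h2]
    exact add_mem (ha.2 i j).2 (SMulMemClass.smul_mem _ (sub_mem (hb.2 i j).2 (ha.2 i j).2))

theorem k1Class_eq_of_isLift (h : IsMayerVietorisTriple A I₁ I₂ J P)
    {p : Matrix (Fin n) (Fin n) (Unitization ℂ A)}
    (hp : IsStarProjection p) {a b : Matrix (Fin n) (Fin n) (Unitization ℂ I₁)}
    (ha : IsLift I₂ p a) (hb : IsLift I₂ p b) {u v : UnitaryMat (Unitization ℂ J) n}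
    (hu : matIncl J u.1 = NormedSpace.exp ((2 * Real.pi * Complex.I : ℂ) • matIncl I₁ a))
    (hv : matIncl J v.1 = NormedSpace.exp ((2 * Real.pi * Complex.I : ℂ) • matIncl I₁ b)) :
    k1Class u = k1Class v := by
  apply k1Class_eq_of_joined
  refine joined_of_matIncl_path (U := fun t => NormedSpace.exp
    ((2 * Real.pi * Complex.I : ℂ) • matIncl I₁ (a + ((t : ℝ) : ℂ) • (b - a)))) ?_ ?_ ?_ ?_
  · refine continuous_exp_smul_matrix ((continuous_lineMap_matrix (matIncl I₁ a)
      (matIncl I₁ b)).congr fun t => ?_) _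
    rw [matIncl_add, matIncl_smul, matIncl_sub]
  · exact fun t => h.exists_unitaryMat_of_isLift hp (isLift_lineMap ha hb t)
  · rw [hu]; simp
  · rw [hv]; simp

/-- The canonical lift by compression depends continuously and additively on p, so it defines a
homomorphism on K₀ of the unitalization. Any other lift is joined to it by a segment of lifts and
gives the same class. -/
theorem exists_boundary (h : IsMayerVietorisTriple A I₁ I₂ J P) :
    ∃ d, IsMayerVietorisBoundary A I₁ I₂ J d := by
  refine h.exists_unitalHom.elim fun D hD => ⟨D.comp (K0 A).subtype,
    fun n p => ⟨_, h.isLift_cutLift p.2.isSelfAdjoint⟩, fun n p q hpq a b ha hb => ?_⟩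
  refine (h.exists_unitaryMat_of_isLift p.2 ha).elim fun u hu =>
    (h.exists_unitaryMat_of_isLift q.2 hb).elim fun v hv => ⟨u, v, hu, hv, ?_⟩
  have hu' := h.k1Class_eq_of_isLift p.2 (h.isLift_cutLift p.2.isSelfAdjoint) ha
    (h.matIncl_expUnitary p) hu
  have hv' := h.k1Class_eq_of_isLift q.2 (h.isLift_cutLift q.2.isSelfAdjoint) hb
    (h.matIncl_expUnitary q) hv
  exact (D.map_sub _ _).trans (congrArg₂ (· - ·) ((hD n p).trans hu') ((hD n q).trans hv'))

end IsMayerVietorisTriple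

end Boundary

/-! ### The boundary map of Roe algebras -/

section RoeBoundary

variable {X : Type*} [MetricSpace X] [ProperSpace X] [MeasurableSpace X] [BorelSpace X]
  {𝓗 : Type*} [NormedAddCommGroup 𝓗] [InnerProductSpace ℂ 𝓗] [CompleteSpace 𝓗]

theorem XModule.isMayerVietorisTriple (M : XModule X 𝓗) {Y : Set X} (hY : MeasurableSet Y) :
    IsMayerVietorisTriple M.roe (M.localizedRoe (bigFamily Y)) (M.localizedRoe (bigFamily Yᶜ))
      (M.localizedRoe (coarseBoundary Y)) (M.chi Y) where
  le₁ := fun _ => M.localizedRoe_le (isBigFamily_bigFamily Y)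
  closed₁ := M.isClosed_localizedRoe _
  closed₂ := M.isClosed_localizedRoe _
  ideal₁ := fun S hS T hT => ⟨M.mul_mem_localizedRoe (isBigFamily_bigFamily Y) hS hT,
    M.mul_mem_localizedRoe' (isBigFamily_bigFamily Y) hS hT⟩
  ideal₂ := fun S hS T hT => ⟨M.mul_mem_localizedRoe (isBigFamily_bigFamily _) hS hT,
    M.mul_mem_localizedRoe' (isBigFamily_bigFamily _) hS hT⟩
  mem_iff := fun T => M.mem_localizedRoe_inter (isBigFamily_bigFamily Y) (isBigFamily_bigFamily Yᶜ)
  selfAdjoint := (M.isStarProjection_chi hY).isSelfAdjoint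
  cut_mem := fun T hT =>
    M.mul_chi_mem_localizedRoe' (isBigFamily_bigFamily Y) hY (M.chi_mul_mem_localizedRoe hY hT)
  sub_cut_mem := fun T hT => by
    -- Each of the two summands has a factor χ_{Yᶜ} next to T.
    have h1 : T - M.chi Y * T * M.chi Y = M.chi Yᶜ * T + M.chi Y * (T * M.chi Yᶜ) := by
      rw [M.chi_compl hY]; noncomm_ring
    rw [h1]
    exact add_mem (M.chi_mul_mem_localizedRoe hY.compl hT)
      (M.chi_mul_mem_localizedRoe' (isBigFamily_bigFamily _) hY
        (M.mul_chi_mem_localizedRoe hY.compl hT))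

theorem XModule.isMayerVietorisBoundary (M : XModule X 𝓗) {Y : Set X} (hY : MeasurableSet Y) :
    IsMayerVietorisBoundary M.roe (M.localizedRoe (bigFamily Y)) (M.localizedRoe (bigFamily Yᶜ))
      (M.localizedRoe (coarseBoundary Y)) (M.mvBoundary Y) := by
  have h := (M.isMayerVietorisTriple hY).exists_boundary
  rw [XModule.mvBoundary, dif_pos h]
  exact h.choose_spec

end RoeBoundary

/-! ### Compressions of unitary matrices -/

section MatrixOp

variable {𝓗 : Type*} [NormedAddCommGroup 𝓗] [InnerProductSpace ℂ 𝓗] [CompleteSpace 𝓗] {n m : ℕ}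

theorem matrixOp_apply (T : Matrix (Fin n) (Fin n) (𝓗 →L[ℂ] 𝓗)) (x : Fin n → 𝓗) (i : Fin n) :
    matrixOp T x i = ∑ j, T i j (x j) := by
  simp [matrixOp]

theorem matrixOp_mul (S T : Matrix (Fin n) (Fin n) (𝓗 →L[ℂ] 𝓗)) :
    matrixOp (S * T) = matrixOp S * matrixOp T := by
  ext x i
  rw [matrixOp_apply]
  change _ = matrixOp S (matrixOp T x) i
  rw [matrixOp_apply]
  simp only [matrixOp_apply, Matrix.mul_apply, map_sum, sum_apply, mul_apply_eq_comp]
  rw [Finset.sum_comm]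

theorem matrixOp_one : matrixOp (1 : Matrix (Fin n) (Fin n) (𝓗 →L[ℂ] 𝓗)) = 1 := by
  ext x i
  rw [matrixOp_apply, Finset.sum_eq_single i]
  · simp
  · intro j _ hj
    simp [Matrix.one_apply_ne hj.symm]
  · simp

theorem matrixOp_sub (S T : Matrix (Fin n) (Fin n) (𝓗 →L[ℂ] 𝓗)) :
    matrixOp (S - T) = matrixOp S - matrixOp T := by
  ext x i
  rw [sub_apply, Pi.sub_apply]
  simp [matrixOp_apply, Finset.sum_sub_distrib]

theorem matrixOp_eq_sum (T : Matrix (Fin n) (Fin n) (𝓗 →L[ℂ] 𝓗)) :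
    matrixOp T = ∑ i, ∑ j, (ContinuousLinearMap.single ℂ (fun _ : Fin n => 𝓗) i).comp
      ((T i j).comp (ContinuousLinearMap.proj j)) := by
  ext x k
  rw [matrixOp_apply]
  simp only [sum_apply, Finset.sum_apply, ContinuousLinearMap.comp_apply]
  symm
  rw [Finset.sum_eq_single k]
  · simp
  · intro i _ hi
    refine Finset.sum_eq_zero fun j _ => ?_
    simp [Pi.single_eq_of_ne hi.symm]
  · simp

theorem finiteRank_matrixOp {T : Matrix (Fin n) (Fin n) (𝓗 →L[ℂ] 𝓗)}
    (hT : ∀ i j, FiniteRank (T i j)) : FiniteRank (matrixOp T) := by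
  rw [matrixOp_eq_sum]
  refine FiniteRank.sum _ _ fun i _ => FiniteRank.sum _ _ fun j _ => ?_
  have := hT i j
  unfold FiniteRank at *
  refine Submodule.finiteDimensional_of_le (S₂ := (LinearMap.range (T i j : 𝓗 →ₗ[ℂ] 𝓗)).map
    (ContinuousLinearMap.single ℂ (fun _ : Fin n => 𝓗) i : 𝓗 →ₗ[ℂ] (Fin n → 𝓗))) ?_
  rintro _ ⟨x, rfl⟩
  exact ⟨T i j (x j), ⟨x j, rfl⟩, rfl⟩

theorem norm_matrixOp_le (T : Matrix (Fin n) (Fin n) (𝓗 →L[ℂ] 𝓗)) :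
    ‖matrixOp T‖ ≤ ∑ i, ∑ j, ‖T i j‖ := by
  refine ContinuousLinearMap.opNorm_le_bound _ (by positivity) fun x => ?_
  refine (pi_norm_le_iff_of_nonneg (by positivity)).2 fun i => ?_
  rw [matrixOp_apply]
  calc ‖∑ j, T i j (x j)‖ ≤ ∑ j, ‖T i j‖ * ‖x‖ := by
        refine (norm_sum_le _ _).trans (Finset.sum_le_sum fun j _ => ?_)
        exact (T i j).le_opNorm_of_le (norm_le_pi_norm x j)
    _ = (∑ j, ‖T i j‖) * ‖x‖ := by rw [Finset.sum_mul]
    _ ≤ _ := by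
        refine mul_le_mul_of_nonneg_right ?_ (norm_nonneg x)
        exact Finset.single_le_sum (f := fun i => ∑ j, ‖T i j‖) (fun _ _ => by positivity)
          (Finset.mem_univ i)

theorem exists_finiteRank_matrixOp {T : Matrix (Fin n) (Fin n) (𝓗 →L[ℂ] 𝓗)}
    (hT : ∀ i j, IsCompactOperator (T i j)) :
    ∃ F : (Fin n → 𝓗) →L[ℂ] (Fin n → 𝓗), FiniteRank F ∧ ‖matrixOp T - F‖ < 1 := by
  -- The n² entries are approximated so closely that the sum of their errors stays below 1.
  have hε : (0 : ℝ) < 1 / (n * n + 1) := by positivity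
  choose F hF hFT using fun i j => exists_finiteRank_norm_sub_lt (hT i j) hε
  refine ⟨matrixOp (Matrix.of F), finiteRank_matrixOp hF, ?_⟩
  rw [← matrixOp_sub]
  refine (norm_matrixOp_le _).trans_lt ?_
  calc ∑ i, ∑ j, ‖(T - Matrix.of F) i j‖ ≤ ∑ _i : Fin n, ∑ _j : Fin n, (1 / (n * n + 1) : ℝ) :=
        Finset.sum_le_sum fun i _ => Finset.sum_le_sum fun j _ => (hFT i j).le
    _ = (n * n) / (n * n + 1) := by simp; ring
    _ < 1 := by rw [div_lt_one (by positivity)]; linarith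

/-- `p U p + (1 - p)`, where `p` is the diagonal matrix with entries `P`. -/
def compressionMat (P : 𝓗 →L[ℂ] 𝓗) (U : Matrix (Fin n) (Fin n) (𝓗 →L[ℂ] 𝓗)) :
    Matrix (Fin n) (Fin n) (𝓗 →L[ℂ] 𝓗) :=
  Matrix.diagonal (fun _ => P) * U * Matrix.diagonal (fun _ => P) + (1 - Matrix.diagonal fun _ => P)

theorem compressionMat_apply (P : 𝓗 →L[ℂ] 𝓗) (U : Matrix (Fin n) (Fin n) (𝓗 →L[ℂ] 𝓗))
    (i j : Fin n) : compressionMat P U i j = P * U i j * P + if i = j then 1 - P else 0 := by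
  rw [compressionMat, Matrix.add_apply, Matrix.mul_diagonal, Matrix.diagonal_mul, Matrix.sub_apply,
    Matrix.one_apply, Matrix.diagonal_apply]
  split_ifs <;> simp

/-- The compression of a left inverse of u inverts the compression of u up to a multiple of the
commutator of u and p. Fredholmness follows if this commutator is compact, a trace formula if it is
nuclear. An abstract ring covers both operators and matrices of operators. -/
theorem one_sub_compression_mul {R : Type*} [Ring R] {p u v : R} (hp : IsIdempotentElem p)
    (huv : v * u = 1) :
    1 - (p * v * p + (1 - p)) * (p * u * p + (1 - p)) = p * v * (u * p - p * u) * p := by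
  have h := hp.eq
  have e : (p * v * p + (1 - p)) * (p * u * p + (1 - p)) =
      p * v * (p * p) * u * p + (p * v * p - p * v * (p * p)) + (p * u * p - (p * p) * u * p)
        + (1 - p - p + p * p) := by noncomm_ring
  have e2 : p * v * (u * p - p * u) * p = p * (v * u) * (p * p) - p * v * p * u * p := by
    noncomm_ring
  rw [e, e2, h, huv, mul_one, h]
  noncomm_ring

theorem commutator_diagonal_apply (P : 𝓗 →L[ℂ] 𝓗) (U : Matrix (Fin n) (Fin n) (𝓗 →L[ℂ] 𝓗))
    (i j : Fin n) : (U * Matrix.diagonal (fun _ => P) - Matrix.diagonal (fun _ => P) * U :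
      Matrix (Fin n) (Fin n) (𝓗 →L[ℂ] 𝓗)) i j =
      U i j * P - P * U i j := by
  rw [Matrix.sub_apply, Matrix.mul_diagonal, Matrix.diagonal_mul]

theorem exists_finiteRank_one_sub {P : 𝓗 →L[ℂ] 𝓗} (hP : IsIdempotentElem P)
    {U V : Matrix (Fin n) (Fin n) (𝓗 →L[ℂ] 𝓗)} (hVU : V * U = 1)
    (hU : ∀ i j, IsCompactOperator (U i j * P - P * U i j)) :
    ∃ F, FiniteRank F ∧
      ‖1 - matrixOp (compressionMat P V) * matrixOp (compressionMat P U) - F‖ < 1 := by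
  set p : Matrix (Fin n) (Fin n) (𝓗 →L[ℂ] 𝓗) := Matrix.diagonal fun _ => P with hp
  have hpi : IsIdempotentElem p := by
    rw [IsIdempotentElem, hp, Matrix.diagonal_mul_diagonal]
    simp only [hP.eq]
  have h1 : 1 - matrixOp (compressionMat P V) * matrixOp (compressionMat P U) =
      matrixOp (p * V * (U * p - p * U) * p) := by
    rw [← one_sub_compression_mul hpi hVU, matrixOp_sub, matrixOp_one, matrixOp_mul]
    rfl
  rw [h1]
  refine exists_finiteRank_matrixOp fun i j => ?_
  rw [hp, Matrix.mul_diagonal, Matrix.mul_apply]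
  refine IsCompactOperator.mul_right' ?_ _
  refine Finset.sum_induction _ (fun T : 𝓗 →L[ℂ] 𝓗 => IsCompactOperator T)
    (fun _ _ h h' => h.add h') isCompactOperator_zero fun k _ => ?_
  rw [commutator_diagonal_apply]
  exact IsCompactOperator.mul_left' (hU k j) _

theorem isCompactOperator_star_commutator {P T : 𝓗 →L[ℂ] 𝓗} (hP : IsSelfAdjoint P)
    (hT : IsCompactOperator (T * P - P * T)) : IsCompactOperator (star T * P - P * star T) := by
  have h := (isCompactOperator_star hT).neg
  rwa [← FunLike.coe_neg, star_sub, star_mul, star_mul, hP.star_eq, neg_sub] at h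

theorem isFredholm_compressionMat {P : 𝓗 →L[ℂ] 𝓗} (hP : IsStarProjection P)
    {U : Matrix (Fin n) (Fin n) (𝓗 →L[ℂ] 𝓗)}
    (hU : U ∈ unitary (Matrix (Fin n) (Fin n) (𝓗 →L[ℂ] 𝓗)))
    (hc : ∀ i j, IsCompactOperator (U i j * P - P * U i j)) :
    (matrixOp (compressionMat P U)).IsFredholm :=
  isFredholm_of_approx (S := matrixOp (compressionMat P (star U)))
    (exists_finiteRank_one_sub hP.isIdempotentElem (Unitary.mem_iff.1 hU).1 hc)
    (exists_finiteRank_one_sub hP.isIdempotentElem (Unitary.mem_iff.1 hU).2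
      fun i j => isCompactOperator_star_commutator hP.isSelfAdjoint (hc j i))

theorem continuous_matrixOp : Continuous
    (matrixOp : Matrix (Fin n) (Fin n) (𝓗 →L[ℂ] 𝓗) → ((Fin n → 𝓗) →L[ℂ] (Fin n → 𝓗))) := by
  rw [show (matrixOp : Matrix (Fin n) (Fin n) (𝓗 →L[ℂ] 𝓗) → _) = _ from funext matrixOp_eq_sum]
  refine continuous_finsetSum _ fun i _ => continuous_finsetSum _ fun j _ => ?_
  refine continuous_const.clm_comp (Continuous.clm_comp ?_ continuous_const)
  exact continuous_id.matrix_elem i j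

theorem continuous_compressionMat (P : 𝓗 →L[ℂ] 𝓗) :
    Continuous (compressionMat P : Matrix (Fin n) (Fin n) (𝓗 →L[ℂ] 𝓗) → _) := by
  refine continuous_matrix fun i j => ?_
  simp only [compressionMat_apply]
  exact ((continuous_const.mul (continuous_id.matrix_elem i j)).mul continuous_const).add
    continuous_const

theorem compressionMat_blockSum (P : 𝓗 →L[ℂ] 𝓗) (U : Matrix (Fin m) (Fin m) (𝓗 →L[ℂ] 𝓗))
    (V : Matrix (Fin n) (Fin n) (𝓗 →L[ℂ] 𝓗)) :
    compressionMat P (blockSum U V) = blockSum (compressionMat P U) (compressionMat P V) := by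
  have hd : Matrix.diagonal (fun _ : Fin (m + n) => P) =
      blockSum (Matrix.diagonal fun _ => P) (Matrix.diagonal fun _ => P) := by
    ext1 i j
    refine Fin.addCases (fun i => ?_) (fun i => ?_) i <;>
    refine Fin.addCases (fun j => ?_) (fun j => ?_) j <;>
    simp [blockSum, Matrix.diagonal_apply, Fin.ext_iff] <;> intro h <;> omega
  have hs : ∀ (a : Matrix (Fin m) (Fin m) (𝓗 →L[ℂ] 𝓗)) (b : Matrix (Fin n) (Fin n) (𝓗 →L[ℂ] 𝓗))
      (a' : Matrix (Fin m) (Fin m) (𝓗 →L[ℂ] 𝓗)) (b' : Matrix (Fin n) (Fin n) (𝓗 →L[ℂ] 𝓗)),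
      blockSum a b - blockSum a' b' = blockSum (a - a') (b - b') := by
    intro a b a' b'
    rw [sub_eq_iff_eq_add, blockSum_add, sub_add_cancel, sub_add_cancel]
  rw [compressionMat, hd, blockSum_mul, blockSum_mul, ← blockSum_one, hs, blockSum_add]
  rfl

theorem fredholmIndex_matrixOp_blockSum {U : Matrix (Fin m) (Fin m) (𝓗 →L[ℂ] 𝓗)}
    {V : Matrix (Fin n) (Fin n) (𝓗 →L[ℂ] 𝓗)} (hU : (matrixOp U).IsFredholm)
    (hV : (matrixOp V).IsFredholm) :
    fredholmIndex (matrixOp (blockSum U V)) =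
      fredholmIndex (matrixOp U) + fredholmIndex (matrixOp V) := by
  have := hU.finite_ker
  have := hV.finite_ker
  have : Module.Finite ℂ ((Fin m → 𝓗) ⧸
      LinearMap.range (matrixOp U : (Fin m → 𝓗) →ₗ[ℂ] (Fin m → 𝓗))) :=
    hU.finite_coker
  have : Module.Finite ℂ ((Fin n → 𝓗) ⧸
      LinearMap.range (matrixOp V : (Fin n → 𝓗) →ₗ[ℂ] (Fin n → 𝓗))) :=
    hV.finite_coker
  let e : (Fin (m + n) → 𝓗) ≃ₗ[ℂ] (Fin m → 𝓗) × (Fin n → 𝓗) :=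
    (LinearEquiv.funCongrLeft ℂ 𝓗 finSumFinEquiv).trans (LinearEquiv.sumArrowLequivProdArrow _ _ ℂ 𝓗)
  have h := linIndex_conj (matrixOp (blockSum U V) : (Fin (m + n) → 𝓗) →ₗ[ℂ] (Fin (m + n) → 𝓗))
    ((matrixOp U : (Fin m → 𝓗) →ₗ[ℂ] (Fin m → 𝓗)).prodMap
      (matrixOp V : (Fin n → 𝓗) →ₗ[ℂ] (Fin n → 𝓗))) e e ?_
  · exact h.trans (linIndex_prodMap _ _)
  · intro x
    refine Prod.ext ?_ ?_
    · funext i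
      change matrixOp (blockSum U V) x (finSumFinEquiv (Sum.inl i)) =
        matrixOp U (fun j => x (finSumFinEquiv (Sum.inl j))) i
      rw [matrixOp_apply, matrixOp_apply, ← finSumFinEquiv.sum_comp, Fintype.sum_sum_type]
      simp [blockSum]
    · funext i
      change matrixOp (blockSum U V) x (finSumFinEquiv (Sum.inr i)) =
        matrixOp V (fun j => x (finSumFinEquiv (Sum.inr j))) i
      rw [matrixOp_apply, matrixOp_apply, ← finSumFinEquiv.sum_comp, Fintype.sum_sum_type]
      simp [blockSum]

end MatrixOp

/-! ### The index functional -/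

section IndexMap

variable {X : Type*} [MetricSpace X] [ProperSpace X] [MeasurableSpace X] [BorelSpace X]
  {𝓗 : Type*} [NormedAddCommGroup 𝓗] [InnerProductSpace ℂ 𝓗] [CompleteSpace 𝓗]
  {J : NonUnitalStarSubalgebra ℂ (𝓗 →L[ℂ] 𝓗)} {n m : ℕ}

/-- The matrix of operators on `𝓗` given by a matrix over the unitalization of `J ⊆ B(𝓗)`. -/
def matLift (u : Matrix (Fin n) (Fin n) (Unitization ℂ J)) : Matrix (Fin n) (Fin n) (𝓗 →L[ℂ] 𝓗) :=
  u.map (Unitization.starLift (NonUnitalStarSubalgebraClass.subtype J))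

theorem matLift_apply (u : Matrix (Fin n) (Fin n) (Unitization ℂ J)) (i j : Fin n) :
    matLift u i j = (u i j).fst • (1 : 𝓗 →L[ℂ] 𝓗) + ((u i j).snd : 𝓗 →L[ℂ] 𝓗) := by
  rw [matLift, Matrix.map_apply, ← Algebra.algebraMap_eq_smul_one]
  rfl

theorem matLift_mem_unitary (u : UnitaryMat (Unitization ℂ J) n) :
    matLift u.1 ∈ unitary (Matrix (Fin n) (Fin n) (𝓗 →L[ℂ] 𝓗)) := by
  have hs : star (matLift u.1) = matLift (star u.1) := by
    refine Matrix.ext fun i j => ?_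
    rw [Matrix.star_apply, matLift, matLift, Matrix.map_apply, Matrix.map_apply, Matrix.star_apply,
      map_star]
  have hm : ∀ a b : Matrix (Fin n) (Fin n) (Unitization ℂ J),
      matLift a * matLift b = matLift (a * b) := fun a b => Matrix.map_mul.symm
  have h1 : matLift (1 : Matrix (Fin n) (Fin n) (Unitization ℂ J)) = 1 :=
    Matrix.map_one _ (map_zero _) (map_one _)
  have hu := Unitary.mem_iff.1 u.2
  rw [Unitary.mem_iff, hs, hm, hm, hu.1, hu.2, h1]
  exact ⟨rfl, rfl⟩

theorem continuous_matLift :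
    Continuous (matLift : Matrix (Fin n) (Fin n) (Unitization ℂ J) → _) := by
  refine continuous_matrix fun i j => ?_
  simp only [matLift_apply]
  have h := (continuous_id (X := Matrix (Fin n) (Fin n) (Unitization ℂ J))).matrix_elem i j
  exact ((Unitization.continuous_fst.comp h).smul continuous_const).add
    (continuous_subtype_val.comp (Unitization.continuous_snd.comp h))

variable (M : XModule X 𝓗)

theorem XModule.compression_eq {W : Set X} (hW : MeasurableSet W)
    (u : Matrix (Fin n) (Fin n) (Unitization ℂ J)) :
    M.compression W u = matrixOp (compressionMat (M.chi W) (matLift u)) := by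
  unfold XModule.compression
  congr 1
  ext1 i j
  rw [compressionMat_apply, M.chi_compl hW]
  rfl

/-- The scalar part of an entry commutes with P, so only the part in J contributes to the
commutators. -/
theorem isFredholm_compressionMat_matLift {P : 𝓗 →L[ℂ] 𝓗} (hP : IsStarProjection P)
    (hJ : ∀ T ∈ J, IsCompactOperator (T * P - P * T)) (u : UnitaryMat (Unitization ℂ J) n) :
    (matrixOp (compressionMat P (matLift u.1))).IsFredholm := by
  refine isFredholm_compressionMat hP (matLift_mem_unitary u) fun i j => ?_
  rw [matLift_apply]
  have := hJ _ (u.1 i j).snd.2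
  convert this using 1
  simp only [add_mul, mul_add, smul_mul_assoc, mul_smul_comm, one_mul, mul_one]
  rw [add_sub_add_left_eq_sub]

/-- Compression takes identities, block sums and paths of unitaries to identities, direct sums and
norm continuous paths of Fredholm operators, so the index respects the relations of K₁. -/
theorem XModule.exists_isIndexMap {W : Set X} (hW : MeasurableSet W)
    (hJ : ∀ T ∈ J, IsCompactOperator (T * M.chi W - M.chi W * T)) : ∃ θ, M.IsIndexMap W J θ := by
  have hP := M.isStarProjection_chi hW
  have hF : ∀ {n : ℕ} (u : UnitaryMat (Unitization ℂ J) n),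
      (matrixOp (compressionMat (M.chi W) (matLift u.1))).IsFredholm :=
    fun u => isFredholm_compressionMat_matLift hP hJ u
  refine (exists_k1Hom (B := Unitization ℂ J)
    (fun n u => fredholmIndex (matrixOp (compressionMat (M.chi W) (matLift u.1)))) ?_ ?_ ?_).imp
    fun θ hθ n u => by
      rw [M.compression_eq hW]
      exact ⟨hF u, hθ n u⟩
  · intro n
    have h1 : matLift (1 : Matrix (Fin n) (Fin n) (Unitization ℂ J)) = 1 :=
      Matrix.map_one _ (map_zero _) (map_one _)
    have h2 : compressionMat (M.chi W) (1 : Matrix (Fin n) (Fin n) (𝓗 →L[ℂ] 𝓗)) = 1 := by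
      rw [compressionMat, mul_one, Matrix.diagonal_mul_diagonal]
      simp only [hP.isIdempotentElem.eq]
      exact add_sub_cancel _ _
    change fredholmIndex (matrixOp (compressionMat (M.chi W) (matLift 1))) = 0
    rw [h1, h2, matrixOp_one]
    exact (fredholmIndex_of_isUnit isUnit_one).2
  · intro m n u v w hw
    have h1 : matLift w.1 = blockSum (matLift u.1) (matLift v.1) := by
      rw [hw]
      exact blockSum_map _ (map_zero _) _ _
    rw [h1, compressionMat_blockSum]
    exact fredholmIndex_matrixOp_blockSum (hF u) (hF v)
  · rintro n u v ⟨γ⟩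
    have h1 : Continuous fun t => (γ t).1 := continuous_subtype_val.comp γ.continuous
    have h := fredholmIndex_path _ (continuous_matrixOp.comp
      ((continuous_compressionMat (M.chi W)).comp (continuous_matLift.comp h1)))
      (fun t => hF (γ t))
    simpa using h

theorem XModule.isIndexMap_theta {Y W : Set X} (hYW : Transversal Y W) (hW : MeasurableSet W) :
    M.IsIndexMap W (M.localizedRoe (coarseBoundary Y)) (M.theta Y W) := by
  have h : ∃ θ, M.IsIndexMap W (M.localizedRoe (coarseBoundary Y)) θ :=
    M.exists_isIndexMap hW fun T hT => XModule.isCompactOperator_commutator hYW hW hT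
  rw [XModule.theta, dif_pos h]
  exact h.choose_spec

end IndexMap

/-! ### Nuclear operators and their traces -/

section Nuclear

open InnerProductSpace

variable {𝓗 : Type*} [NormedAddCommGroup 𝓗] [InnerProductSpace ℂ 𝓗] [CompleteSpace 𝓗]

/-- `T = ∑ ⟨x_i, ·⟩ y_i` with `∑ ‖x_i‖ ‖y_i‖ < ∞`. -/
structure NuclearRep {ι : Type*} (x y : ι → 𝓗) (T : 𝓗 →L[ℂ] 𝓗) : Prop where
  summable : Summable fun i => ‖x i‖ * ‖y i‖
  hasSum : HasSum (fun i => rankOne ℂ (y i) (x i)) T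

/-- `T` is nuclear of nuclear norm at most `c`. -/
def NuclearLE (T : 𝓗 →L[ℂ] 𝓗) (c : ℝ) : Prop :=
  ∃ x y : ℕ → 𝓗, NuclearRep x y T ∧ ∑' i, ‖x i‖ * ‖y i‖ ≤ c

/-- Nuclear operators. -/
def IsNuclear (T : 𝓗 →L[ℂ] 𝓗) : Prop := ∃ c, NuclearLE T c

theorem NuclearLE.isNuclear {T : 𝓗 →L[ℂ] 𝓗} {c : ℝ} (h : NuclearLE T c) : IsNuclear T := ⟨c, h⟩

theorem NuclearLE.nonneg {T : 𝓗 →L[ℂ] 𝓗} {c : ℝ} (h : NuclearLE T c) : 0 ≤ c := by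
  obtain ⟨x, y, _, hc⟩ := h
  exact (tsum_nonneg fun i => by positivity).trans hc

theorem NuclearLE.mono {T : 𝓗 →L[ℂ] 𝓗} {c d : ℝ} (h : NuclearLE T c) (hcd : c ≤ d) :
    NuclearLE T d := by
  obtain ⟨x, y, hT, hc⟩ := h
  exact ⟨x, y, hT, hc.trans hcd⟩

/-- A summable family has countable support, so the nonzero terms can be reindexed by ℕ. This allows
representations indexed by orthonormal bases of nonseparable spaces. -/
theorem NuclearRep.nuclearLE {ι : Type*} {x y : ι → 𝓗} {T : 𝓗 →L[ℂ] 𝓗} (h : NuclearRep x y T) :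
    NuclearLE T (∑' i, ‖x i‖ * ‖y i‖) := by
  set s : Set ι := Function.support fun i => ‖x i‖ * ‖y i‖ with hs
  have hcount : s.Countable := h.summable.countable_support
  have : Countable s := hcount
  obtain ⟨e, he⟩ := exists_injective_nat s
  let x' : ℕ → 𝓗 := Function.extend e (fun i => x i) 0
  let y' : ℕ → 𝓗 := Function.extend e (fun i => y i) 0
  have hx' : ∀ i, x' (e i) = x i := fun i => he.extend_apply _ _ _
  have hy' : ∀ i, y' (e i) = y i := fun i => he.extend_apply _ _ _
  have hx0 : ∀ k ∉ Set.range e, x' k = 0 := fun k hk =>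
    Function.extend_apply' _ _ _ (by simpa using hk)
  have h1 : HasSum (fun k => ‖x' k‖ * ‖y' k‖) (∑' i, ‖x i‖ * ‖y i‖) := by
    refine (he.hasSum_iff fun k hk => by simp [hx0 k hk]).1 ?_
    have := (hasSum_subtype_iff_of_support_subset (f := fun i => ‖x i‖ * ‖y i‖)
      (s := s) subset_rfl).2 h.summable.hasSum
    convert this using 1
    funext i
    simp [hx', hy']
  refine ⟨x', y', ⟨h1.summable, ?_⟩, h1.tsum_eq.le⟩
  refine (he.hasSum_iff fun k hk => by simp [hx0 k hk]).1 ?_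
  have := (hasSum_subtype_iff_of_support_subset (f := fun i => rankOne ℂ (y i) (x i))
    (s := s) ?_).2 h.hasSum
  · convert this using 1
    funext i
    simp [hx', hy']
  · intro i hi
    simp only [Function.mem_support, ne_eq, hs] at hi ⊢
    intro h0
    apply hi
    rcases mul_eq_zero.1 h0 with h0 | h0 <;> simp [norm_eq_zero.1 h0]

/-- Cauchy–Schwarz combined with Bessel's inequality for both vectors; the domination needed to
interchange sums in the trace. -/
theorem summable_norm_inner_mul_inner {κ : Type*} {b : κ → 𝓗} (hb : Orthonormal ℂ b) (x y : 𝓗) :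
    (Summable fun i => ‖inner ℂ x (b i) * inner ℂ (b i) y‖) ∧
      ∑' i, ‖inner ℂ x (b i) * inner ℂ (b i) y‖ ≤ ‖x‖ * ‖y‖ := by
  have key : ∀ s : Finset κ, ∑ i ∈ s, ‖inner ℂ x (b i) * inner ℂ (b i) y‖ ≤ ‖x‖ * ‖y‖ := by
    intro s
    have h1 := Finset.sum_mul_sq_le_sq_mul_sq s (fun i => ‖inner ℂ (b i) x‖)
      (fun i => ‖inner ℂ (b i) y‖)
    have h2 := hb.sum_inner_products_le x (s := s)
    have h3 := hb.sum_inner_products_le y (s := s)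
    have h4 : ∑ i ∈ s, ‖inner ℂ x (b i) * inner ℂ (b i) y‖ =
        ∑ i ∈ s, ‖inner ℂ (b i) x‖ * ‖inner ℂ (b i) y‖ :=
      Finset.sum_congr rfl fun i _ => by rw [norm_mul, norm_inner_symm]
    rw [h4]
    refine abs_le_of_sq_le_sq' ?_ (by positivity) |>.2
    rw [mul_pow]
    exact h1.trans (mul_le_mul h2 h3 (by positivity) (by positivity))
  exact ⟨summable_of_sum_le (fun i => norm_nonneg _) key,
    Real.tsum_le_of_sum_le (fun i => norm_nonneg _) key⟩

/-- Fubini and Parseval. The value does not involve the basis, so the basis chosen in `opTrace` is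
immaterial. -/
theorem NuclearRep.hasSum_inner {ι κ : Type*} {x y : ι → 𝓗} {T : 𝓗 →L[ℂ] 𝓗}
    (h : NuclearRep x y T) (b : HilbertBasis κ ℂ 𝓗) :
    HasSum (fun j => inner ℂ (b j) (T (b j))) (∑' i, inner ℂ (x i) (y i)) := by
  have hs : Summable fun p : ι × κ => inner ℂ (x p.1) (b p.2) * inner ℂ (b p.2) (y p.1) := by
    refine Summable.of_norm ((summable_prod_of_nonneg fun p => norm_nonneg _).2 ⟨fun i =>
      (summable_norm_inner_mul_inner b.orthonormal (x i) (y i)).1, ?_⟩)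
    exact h.summable.of_nonneg_of_le (fun i => tsum_nonneg fun j => norm_nonneg _)
      fun i => (summable_norm_inner_mul_inner b.orthonormal (x i) (y i)).2
  have h1 : HasSum (fun i => inner ℂ (x i) (y i))
      (∑' p : ι × κ, inner ℂ (x p.1) (b p.2) * inner ℂ (b p.2) (y p.1)) :=
    hs.hasSum.prod_fiberwise fun i => b.hasSum_inner_mul_inner (x i) (y i)
  rw [h1.tsum_eq]
  have hs' : HasSum (fun p : κ × ι => inner ℂ (x p.2) (b p.1) * inner ℂ (b p.1) (y p.2))
      (∑' p : ι × κ, inner ℂ (x p.1) (b p.2) * inner ℂ (b p.2) (y p.1)) :=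
    (Equiv.prodComm κ ι).hasSum_iff.2 hs.hasSum
  refine hs'.prod_fiberwise fun j => ?_
  have h2 := (h.hasSum.mapL (ContinuousLinearMap.apply ℂ 𝓗 (b j))).mapL (innerSL ℂ (b j))
  simpa [inner_smul_right] using h2

theorem NuclearRep.opTrace_eq {ι : Type*} {x y : ι → 𝓗} {T : 𝓗 →L[ℂ] 𝓗} (h : NuclearRep x y T) :
    opTrace T = ∑' i, inner ℂ (x i) (y i) :=
  (h.hasSum_inner _).tsum_eq

theorem NuclearRep.hasSum_opTrace {ι : Type*} {x y : ι → 𝓗} {T : 𝓗 →L[ℂ] 𝓗}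
    (h : NuclearRep x y T) : HasSum (fun i => inner ℂ (x i) (y i)) (opTrace T) := by
  rw [h.opTrace_eq]
  exact (Summable.of_norm_bounded h.summable fun i => norm_inner_le_norm _ _).hasSum

theorem NuclearRep.mul_left {ι : Type*} {x y : ι → 𝓗} {T : 𝓗 →L[ℂ] 𝓗} (h : NuclearRep x y T)
    (S : 𝓗 →L[ℂ] 𝓗) : NuclearRep x (fun i => S (y i)) (S * T) where
  summable := (h.summable.mul_left ‖S‖).of_nonneg_of_le (fun i => by positivity) fun i => by
    calc ‖x i‖ * ‖S (y i)‖ ≤ ‖x i‖ * (‖S‖ * ‖y i‖) := by gcongr; exact S.le_opNorm _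
      _ = ‖S‖ * (‖x i‖ * ‖y i‖) := by ring
  hasSum := by
    have := h.hasSum.mul_left S
    have e : (fun i => S * rankOne ℂ (y i) (x i)) = fun i => rankOne ℂ (S (y i)) (x i) :=
      funext fun i => comp_rankOne (y i) (x i) S
    rw [e] at this
    exact this

theorem NuclearRep.mul_right {ι : Type*} {x y : ι → 𝓗} {T : 𝓗 →L[ℂ] 𝓗} (h : NuclearRep x y T)
    (S : 𝓗 →L[ℂ] 𝓗) : NuclearRep (fun i => star S (x i)) y (T * S) where
  summable := (h.summable.mul_left ‖S‖).of_nonneg_of_le (fun i => by positivity) fun i => by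
    calc ‖star S (x i)‖ * ‖y i‖ ≤ (‖S‖ * ‖x i‖) * ‖y i‖ := by
          gcongr
          rw [← norm_star S]
          exact (star S).le_opNorm _
      _ = ‖S‖ * (‖x i‖ * ‖y i‖) := by ring
  hasSum := by
    have := h.hasSum.mul_right S
    have e : (fun i => rankOne ℂ (y i) (x i) * S) = fun i => rankOne ℂ (y i) (star S (x i)) :=
      funext fun i => rankOne_comp (y i) (x i) S
    rw [e] at this
    exact this

theorem NuclearLE.mul_left {T : 𝓗 →L[ℂ] 𝓗} {c : ℝ} (h : NuclearLE T c) (S : 𝓗 →L[ℂ] 𝓗) :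
    NuclearLE (S * T) (‖S‖ * c) := by
  obtain ⟨x, y, hT, hc⟩ := h
  refine ⟨_, _, hT.mul_left S, ?_⟩
  calc ∑' i, ‖x i‖ * ‖S (y i)‖ ≤ ∑' i, ‖S‖ * (‖x i‖ * ‖y i‖) := by
        refine (hT.mul_left S).summable.tsum_le_tsum (fun i => ?_) (hT.summable.mul_left _)
        calc ‖x i‖ * ‖S (y i)‖ ≤ ‖x i‖ * (‖S‖ * ‖y i‖) := by gcongr; exact S.le_opNorm _
          _ = ‖S‖ * (‖x i‖ * ‖y i‖) := by ring
    _ = ‖S‖ * ∑' i, ‖x i‖ * ‖y i‖ := tsum_mul_left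
    _ ≤ _ := by gcongr

theorem NuclearLE.mul_right {T : 𝓗 →L[ℂ] 𝓗} {c : ℝ} (h : NuclearLE T c) (S : 𝓗 →L[ℂ] 𝓗) :
    NuclearLE (T * S) (c * ‖S‖) := by
  obtain ⟨x, y, hT, hc⟩ := h
  refine ⟨_, _, hT.mul_right S, ?_⟩
  calc ∑' i, ‖star S (x i)‖ * ‖y i‖ ≤ ∑' i, (‖x i‖ * ‖y i‖) * ‖S‖ := by
        refine (hT.mul_right S).summable.tsum_le_tsum (fun i => ?_) (hT.summable.mul_right _)
        calc ‖star S (x i)‖ * ‖y i‖ ≤ (‖S‖ * ‖x i‖) * ‖y i‖ := by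
              gcongr
              rw [← norm_star S]
              exact (star S).le_opNorm _
          _ = (‖x i‖ * ‖y i‖) * ‖S‖ := by ring
    _ = (∑' i, ‖x i‖ * ‖y i‖) * ‖S‖ := tsum_mul_right
    _ ≤ _ := by gcongr

theorem NuclearLE.star {T : 𝓗 →L[ℂ] 𝓗} {c : ℝ} (h : NuclearLE T c) : NuclearLE (star T) c := by
  obtain ⟨x, y, hT, hc⟩ := h
  refine ⟨y, x, ⟨by simpa only [mul_comm] using hT.summable, ?_⟩, by simpa only [mul_comm] using hc⟩
  have := hT.hasSum.star
  convert this using 1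
  funext i
  rw [ContinuousLinearMap.star_eq_adjoint, adjoint_rankOne]

theorem IsNuclear.mul_left {T : 𝓗 →L[ℂ] 𝓗} (h : IsNuclear T) (S : 𝓗 →L[ℂ] 𝓗) :
    IsNuclear (S * T) := (h.choose_spec.mul_left S).isNuclear

theorem IsNuclear.mul_right {T : 𝓗 →L[ℂ] 𝓗} (h : IsNuclear T) (S : 𝓗 →L[ℂ] 𝓗) :
    IsNuclear (T * S) := (h.choose_spec.mul_right S).isNuclear

theorem IsNuclear.star {T : 𝓗 →L[ℂ] 𝓗} (h : IsNuclear T) : IsNuclear (star T) :=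
  h.choose_spec.star.isNuclear

/-- In a representation by vectors x_i, y_i both sides are the sum of ⟨S*x_i, y_i⟩ = ⟨x_i, S y_i⟩.
-/
theorem opTrace_mul_comm {T : 𝓗 →L[ℂ] 𝓗} (h : IsNuclear T) (S : 𝓗 →L[ℂ] 𝓗) :
    opTrace (T * S) = opTrace (S * T) := by
  obtain ⟨c, x, y, hT, hc⟩ := h
  rw [(hT.mul_left S).opTrace_eq, (hT.mul_right S).opTrace_eq]
  refine tsum_congr fun i => ?_
  rw [ContinuousLinearMap.star_eq_adjoint, ContinuousLinearMap.adjoint_inner_left]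

/-- Concatenating the representations of the terms gives an absolutely convergent double series;
summing it in two ways shows that the trace is countably additive under summable nuclear bounds. -/
theorem nuclearLE_of_hasSum {κ : Type*} {T : κ → 𝓗 →L[ℂ] 𝓗} {c : κ → ℝ} {S : 𝓗 →L[ℂ] 𝓗}
    (hT : ∀ k, NuclearLE (T k) (c k)) (hc : Summable c) (hS : HasSum T S) :
    NuclearLE S (∑' k, c k) ∧ HasSum (fun k => opTrace (T k)) (opTrace S) := by
  choose x y hrep hle using hT
  have hs0 : Summable fun k => ∑' i, ‖x k i‖ * ‖y k i‖ :=
    hc.of_nonneg_of_le (fun k => tsum_nonneg fun i => by positivity) hle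
  have hs : Summable fun p : κ × ℕ => ‖x p.1 p.2‖ * ‖y p.1 p.2‖ :=
    (summable_prod_of_nonneg fun p => by positivity).2 ⟨fun k => (hrep k).summable, hs0⟩
  have hs' : Summable fun p : κ × ℕ => rankOne ℂ (y p.1 p.2) (x p.1 p.2) :=
    Summable.of_norm (by simpa [mul_comm] using hs)
  have h1 := hs'.hasSum.prod_fiberwise fun k => (hrep k).hasSum
  have hR : NuclearRep (fun p : κ × ℕ => x p.1 p.2) (fun p : κ × ℕ => y p.1 p.2) S :=
    ⟨hs, by rw [hS.unique h1]; exact hs'.hasSum⟩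
  refine ⟨hR.nuclearLE.mono ?_, hR.hasSum_opTrace.prod_fiberwise fun k => (hrep k).hasSum_opTrace⟩
  have h2 := hs.hasSum.prod_fiberwise fun k => (hrep k).summable.hasSum
  rw [← h2.tsum_eq]
  exact hs0.tsum_le_tsum hle hc

theorem NuclearLE.sum {κ : Type*} [Fintype κ] {T : κ → 𝓗 →L[ℂ] 𝓗} {c : κ → ℝ}
    (hT : ∀ k, NuclearLE (T k) (c k)) :
    NuclearLE (∑ k, T k) (∑ k, c k) ∧ opTrace (∑ k, T k) = ∑ k, opTrace (T k) := by
  have := nuclearLE_of_hasSum hT (hasSum_fintype c).summable (hasSum_fintype T)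
  rw [tsum_fintype] at this
  exact ⟨this.1, this.2.unique (hasSum_fintype _)⟩

theorem NuclearLE.add {S T : 𝓗 →L[ℂ] 𝓗} {c d : ℝ} (hS : NuclearLE S c) (hT : NuclearLE T d) :
    NuclearLE (S + T) (c + d) := by
  have := (NuclearLE.sum (κ := Fin 2) (T := ![S, T]) (c := ![c, d])
    (fun k => by fin_cases k <;> assumption)).1
  simpa using this

theorem IsNuclear.add {S T : 𝓗 →L[ℂ] 𝓗} (hS : IsNuclear S) (hT : IsNuclear T) :
    IsNuclear (S + T) := (hS.choose_spec.add hT.choose_spec).isNuclear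

theorem opTrace_add {S T : 𝓗 →L[ℂ] 𝓗} (hS : IsNuclear S) (hT : IsNuclear T) :
    opTrace (S + T) = opTrace S + opTrace T := by
  have h1 := hS.choose_spec
  have h2 := hT.choose_spec
  have := (NuclearLE.sum (κ := Fin 2) (T := ![S, T]) (c := ![hS.choose, hT.choose])
    (fun k => by fin_cases k <;> assumption)).2
  simpa using this

theorem IsNuclear.smul {T : 𝓗 →L[ℂ] 𝓗} (hT : IsNuclear T) (z : ℂ) : IsNuclear (z • T) := by
  have := hT.mul_left (z • (1 : 𝓗 →L[ℂ] 𝓗))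
  rwa [smul_mul_assoc, one_mul] at this

theorem opTrace_smul (T : 𝓗 →L[ℂ] 𝓗) (z : ℂ) :
    opTrace (z • T) = z * opTrace T := by
  unfold opTrace
  rw [← tsum_mul_left]
  exact tsum_congr fun i => by rw [smul_apply, inner_smul_right]

theorem IsNuclear.neg {T : 𝓗 →L[ℂ] 𝓗} (hT : IsNuclear T) : IsNuclear (-T) := by
  simpa using hT.smul (-1)

theorem opTrace_neg (T : 𝓗 →L[ℂ] 𝓗) : opTrace (-T) = -opTrace T := by
  simpa using opTrace_smul T (-1)

theorem IsNuclear.sub {S T : 𝓗 →L[ℂ] 𝓗} (hS : IsNuclear S) (hT : IsNuclear T) :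
    IsNuclear (S - T) := by
  rw [sub_eq_add_neg]
  exact hS.add hT.neg

theorem opTrace_sub {S T : 𝓗 →L[ℂ] 𝓗} (hS : IsNuclear S) (hT : IsNuclear T) :
    opTrace (S - T) = opTrace S - opTrace T := by
  rw [sub_eq_add_neg, opTrace_add hS hT.neg, opTrace_neg, ← sub_eq_add_neg]

theorem NuclearLE.norm_opTrace_le {T : 𝓗 →L[ℂ] 𝓗} {c : ℝ} (h : NuclearLE T c) :
    ‖opTrace T‖ ≤ c := by
  obtain ⟨x, y, hT, hc⟩ := h
  rw [hT.opTrace_eq]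
  refine (tsum_of_norm_bounded hT.summable.hasSum fun i => norm_inner_le_norm _ _).trans hc

/-- Bounded strong convergence of the left factor suffices, by dominated convergence in the series
of ⟨x_i, S y_i⟩. -/
theorem tendsto_opTrace_mul {α : Type*} {l : Filter α} {S : α → 𝓗 →L[ℂ] 𝓗} {S₀ T : 𝓗 →L[ℂ] 𝓗}
    (hT : IsNuclear T) {C : ℝ} (hC : ∀ a, ‖S a‖ ≤ C)
    (hS : ∀ v, Filter.Tendsto (fun a => S a v) l (nhds (S₀ v))) :
    Filter.Tendsto (fun a => opTrace (S a * T)) l (nhds (opTrace (S₀ * T))) := by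
  obtain ⟨c, x, y, hT, hc⟩ := hT
  simp only [(hT.mul_left _).opTrace_eq]
  refine tendsto_tsum_of_dominated_convergence (hT.summable.mul_left C)
    (fun i => tendsto_const_nhds.inner (hS (y i))) (Filter.Eventually.of_forall fun a i => ?_)
  calc ‖inner ℂ (x i) (S a (y i))‖ ≤ ‖x i‖ * ‖S a (y i)‖ := norm_inner_le_norm _ _
    _ ≤ ‖x i‖ * (C * ‖y i‖) := by
        gcongr
        exact (S a).le_of_opNorm_le (hC a) _
    _ = C * (‖x i‖ * ‖y i‖) := by ring

theorem nuclearRep_of_pointwise {ι : Type*} {x y : ι → 𝓗} {T : 𝓗 →L[ℂ] 𝓗}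
    (hs : Summable fun i => ‖x i‖ * ‖y i‖)
    (h : ∀ v, HasSum (fun i => inner ℂ (x i) v • y i) (T v)) : NuclearRep x y T := by
  refine ⟨hs, ?_⟩
  have hs' : Summable fun i => rankOne ℂ (y i) (x i) :=
    Summable.of_norm (by simpa [mul_comm] using hs)
  convert hs'.hasSum using 1
  ext v
  refine (h v).unique ?_
  simpa using hs'.hasSum.mapL (ContinuousLinearMap.apply ℂ 𝓗 v)

/-- Douglas' factorization lemma. -/
theorem exists_eq_mul_of_norm_le {S T : 𝓗 →L[ℂ] 𝓗} (h : ∀ v, ‖T v‖ ≤ ‖S v‖) :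
    ∃ C : 𝓗 →L[ℂ] 𝓗, T = C * S := by
  set R : Submodule ℂ 𝓗 := LinearMap.range (S : 𝓗 →ₗ[ℂ] 𝓗) with hR
  have hker : LinearMap.ker (S : 𝓗 →ₗ[ℂ] 𝓗) ≤ LinearMap.ker (T : 𝓗 →ₗ[ℂ] 𝓗) := by
    intro v hv
    have := h v
    rw [show S v = 0 from hv, norm_zero] at this
    exact norm_le_zero_iff.1 this
  let f₀ : R →ₗ[ℂ] 𝓗 := ((LinearMap.ker (S : 𝓗 →ₗ[ℂ] 𝓗)).liftQ (T : 𝓗 →ₗ[ℂ] 𝓗) hker) ∘ₗ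
    (S : 𝓗 →ₗ[ℂ] 𝓗).quotKerEquivRange.symm.toLinearMap
  have hf₀ : ∀ v, f₀ ⟨S v, LinearMap.mem_range_self (S : 𝓗 →ₗ[ℂ] 𝓗) v⟩ = T v := by
    intro v
    have : (S : 𝓗 →ₗ[ℂ] 𝓗).quotKerEquivRange.symm
        ⟨S v, LinearMap.mem_range_self (S : 𝓗 →ₗ[ℂ] 𝓗) v⟩ =
        Submodule.Quotient.mk v := by
      rw [LinearEquiv.symm_apply_eq]
      rfl
    change ((LinearMap.ker (S : 𝓗 →ₗ[ℂ] 𝓗)).liftQ (T : 𝓗 →ₗ[ℂ] 𝓗) hker)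
      ((S : 𝓗 →ₗ[ℂ] 𝓗).quotKerEquivRange.symm _) = T v
    rw [this]
    rfl
  let f : R →L[ℂ] 𝓗 := f₀.mkContinuous 1 (by
    rintro ⟨_, v, rfl⟩
    rw [one_mul]
    exact (congrArg norm (hf₀ v)).trans_le (h v))
  let e : R →L[ℂ] R.topologicalClosure :=
    (Submodule.inclusion R.le_topologicalClosure).mkContinuous 1 (fun v => by rw [one_mul]; rfl)
  have he : IsUniformInducing e := by
    refine Isometry.isUniformInducing (AddMonoidHomClass.isometry_of_norm e fun v => rfl)
  have hd : DenseRange e := by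
    intro z
    rw [Metric.mem_closure_iff]
    intro ε hε
    obtain ⟨w, hw, hwz⟩ := Metric.mem_closure_iff.1 z.2 ε hε
    exact ⟨e ⟨w, hw⟩, ⟨⟨w, hw⟩, rfl⟩, hwz⟩
  have : CompleteSpace R.topologicalClosure :=
    R.isClosed_topologicalClosure.completeSpace_coe
  -- The map S v ↦ T v is extended by continuity to the closure of the range of S and by zero to its
  -- orthogonal complement.
  refine ⟨(f.extend e).comp R.topologicalClosure.orthogonalProjectionOnto, ?_⟩
  ext v
  have h1 : R.topologicalClosure.orthogonalProjectionOnto (S v) =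
      e ⟨S v, LinearMap.mem_range_self (S : 𝓗 →ₗ[ℂ] 𝓗) v⟩ :=
    Submodule.orthogonalProjectionOnto_mem_subspace_eq_self
      (e ⟨S v, LinearMap.mem_range_self (S : 𝓗 →ₗ[ℂ] 𝓗) v⟩)
  change T v = f.extend e (R.topologicalClosure.orthogonalProjectionOnto (S v))
  rw [h1, ContinuousLinearMap.extend_eq f hd he]
  exact (hf₀ v).symm

/-- Douglas' lemma gives T = C|T| with bounded C, in place of a polar decomposition. With R =
|T|^{1/2}, expanding R v in the basis yields T v = ∑ ⟨R b_i, v⟩ C R b_i, and ‖R b_i‖² = ⟨b_i, |T|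
b_i⟩ is summable. -/
theorem IsTraceClass.isNuclear {T : 𝓗 →L[ℂ] 𝓗} (hT : IsTraceClass T) : IsNuclear T := by
  obtain ⟨w, b, hs⟩ := hT
  have habs : 0 ≤ CFC.abs T := CFC.abs_nonneg T
  set R := CFC.sqrt (CFC.abs T) with hRdef
  have hRR : R * R = CFC.abs T := CFC.sqrt_mul_sqrt_self _ habs
  have hRsa : IsSelfAdjoint R := (CFC.sqrt_nonneg _).isSelfAdjoint
  have hnorm : ∀ v, ‖T v‖ ≤ ‖CFC.abs T v‖ := by
    intro v
    have h1 : ∀ S : 𝓗 →L[ℂ] 𝓗, inner ℂ v ((star S * S) v) = (‖S v‖ : ℂ) ^ 2 := by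
      intro S
      rw [mul_apply_eq_comp, ContinuousLinearMap.star_eq_adjoint]
      rw [ContinuousLinearMap.adjoint_inner_right, inner_self_eq_norm_sq_to_K]
      rfl
    have h2 : (‖T v‖ : ℂ) ^ 2 = (‖CFC.abs T v‖ : ℂ) ^ 2 := by
      rw [← h1, ← h1, habs.isSelfAdjoint.star_eq, CFC.abs_mul_abs]
    have h3 : ‖T v‖ ^ 2 = ‖CFC.abs T v‖ ^ 2 := by exact_mod_cast h2
    exact ((pow_left_inj₀ (norm_nonneg _) (norm_nonneg _) two_ne_zero).1 h3).le
  obtain ⟨C, hC⟩ := exists_eq_mul_of_norm_le hnorm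
  have hRb : ∀ i, (inner ℂ (b i) (CFC.abs T (b i))).re = ‖R (b i)‖ * ‖R (b i)‖ := by
    intro i
    rw [← hRR, mul_apply_eq_comp, ← ContinuousLinearMap.adjoint_inner_left,
      ← ContinuousLinearMap.star_eq_adjoint, hRsa.star_eq, ← inner_self_eq_norm_mul_norm (𝕜 := ℂ)]
    rfl
  simp only [hRb] at hs
  refine (nuclearRep_of_pointwise (x := fun i => R (b i)) (y := fun i => C (R (b i))) ?_
    fun v => ?_).nuclearLE.isNuclear
  · refine (hs.mul_left ‖C‖).of_nonneg_of_le (fun i => by positivity) fun i => ?_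
    calc ‖R (b i)‖ * ‖C (R (b i))‖ ≤ ‖R (b i)‖ * (‖C‖ * ‖R (b i)‖) := by
          gcongr; exact C.le_opNorm _
      _ = ‖C‖ * (‖R (b i)‖ * ‖R (b i)‖) := by ring
  · have h1 := (b.hasSum_repr (R v)).mapL (C * R)
    have h2 : (C * R) (R v) = T v := by
      have h3 := congrArg (fun S : 𝓗 →L[ℂ] 𝓗 => S v) hC
      rw [← hRR] at h3
      exact h3.symm
    rw [h2] at h1
    convert h1 using 1
    funext i
    rw [map_smul, b.repr_apply_apply, ← ContinuousLinearMap.adjoint_inner_left,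
      ← ContinuousLinearMap.star_eq_adjoint, hRsa.star_eq]
    rfl

/-- A finite rank idempotent is nuclear and its trace is its rank. -/
theorem nuclear_of_idempotent {Q : 𝓗 →L[ℂ] 𝓗} {V : Submodule ℂ 𝓗} [FiniteDimensional ℂ V]
    (h1 : ∀ v, Q v ∈ V) (h2 : ∀ v ∈ V, Q v = v) :
    IsNuclear Q ∧ opTrace Q = Module.finrank ℂ V := by
  let b := stdOrthonormalBasis ℂ V
  have hr : NuclearRep (fun i => star Q (b i : 𝓗)) (fun i => (b i : 𝓗)) Q := by
    refine nuclearRep_of_pointwise (hasSum_fintype _).summable fun v => ?_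
    have h3 := congrArg (Submodule.subtype V) (b.sum_repr ⟨Q v, h1 v⟩)
    rw [map_sum] at h3
    convert hasSum_fintype (fun i => inner ℂ (star Q (b i : 𝓗)) v • (b i : 𝓗)) using 1
    refine h3.symm.trans (Finset.sum_congr rfl fun i _ => ?_)
    rw [map_smul, b.repr_apply_apply, ContinuousLinearMap.star_eq_adjoint,
      ContinuousLinearMap.adjoint_inner_left]
    rfl
  refine ⟨hr.nuclearLE.isNuclear, ?_⟩
  rw [hr.opTrace_eq, tsum_fintype]
  have : ∀ i, inner ℂ (star Q (b i : 𝓗)) (b i : 𝓗) = 1 := by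
    intro i
    rw [ContinuousLinearMap.star_eq_adjoint, ContinuousLinearMap.adjoint_inner_left,
      h2 _ (b i).2, inner_self_eq_norm_sq_to_K]
    have : ‖(b i : 𝓗)‖ = 1 := b.orthonormal.1 i
    simp [this]
  simp [this]

/-- Fedosov's formula. -/
theorem fredholmIndex_eq_opTrace {T R : 𝓗 →L[ℂ] 𝓗} (hT : T.IsFredholm)
    (h1 : IsNuclear (1 - R * T)) (h2 : IsNuclear (1 - T * R)) :
    (fredholmIndex T : ℂ) = opTrace (1 - R * T) - opTrace (1 - T * R) := by
  obtain ⟨pkg⟩ := hT.nonempty_fredholmPackage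
  have := pkg.decDom.finite_X₀
  have := pkg.decCodom.finite_X₀
  set R₀ : 𝓗 →L[ℂ] 𝓗 := pkg.quasiInverse with hR₀
  have hTapp : ∀ v, T v = pkg.equiv (pkg.decDom.proj v) := fun v => by
    conv_lhs => rw [pkg.eq_equiv]
    rfl
  have hRapp : ∀ v, R₀ v = pkg.equiv.symm (pkg.decCodom.proj v) := fun v => rfl
  have hpd : ∀ z : pkg.decDom.X₁, pkg.decDom.proj z = z := fun z =>
    Submodule.projectionOntoL_apply_left _ z
  have hpc : ∀ z : pkg.decCodom.X₁, pkg.decCodom.proj z = z := fun z =>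
    Submodule.projectionOntoL_apply_left _ z
  have hRT : ∀ v, (1 - R₀ * T) v = v - pkg.decDom.proj v := by
    intro v
    rw [sub_apply, mul_apply_eq_comp, hRapp, hTapp, hpc]
    simp
  have hTR : ∀ v, (1 - T * R₀) v = v - pkg.decCodom.proj v := by
    intro v
    rw [sub_apply, mul_apply_eq_comp, hRapp, hTapp, hpd]
    simp
  -- For the parametrix R₀ of the Fredholm decomposition, the defects are idempotents onto the
  -- kernel of T and onto a complement of its range, so their traces are the two dimensions in the
  -- index.
  obtain ⟨n1, t1⟩ := nuclear_of_idempotent (Q := 1 - R₀ * T) (V := pkg.decDom.X₀)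
    (fun v => by
      rw [hRT, ← Submodule.projectionOntoL_apply_eq_zero_iff pkg.decDom.isTopCompl]
      rw [map_sub, hpd, sub_self])
    (fun v hv => by
      rw [hRT, (Submodule.projectionOntoL_apply_eq_zero_iff pkg.decDom.isTopCompl).2 hv]
      simp)
  obtain ⟨n2, t2⟩ := nuclear_of_idempotent (Q := 1 - T * R₀) (V := pkg.decCodom.X₀)
    (fun v => by
      rw [hTR, ← Submodule.projectionOntoL_apply_eq_zero_iff pkg.decCodom.isTopCompl]
      rw [map_sub, hpc, sub_self])
    (fun v hv => by
      rw [hTR, (Submodule.projectionOntoL_apply_eq_zero_iff pkg.decCodom.isTopCompl).2 hv]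
      simp)
  have hind : (fredholmIndex T : ℂ) = opTrace (1 - R₀ * T) - opTrace (1 - T * R₀) := by
    rw [t1, t2, fredholmIndex, pkg.ker_eq, pkg.range_eq,
      (Submodule.quotientEquivOfIsCompl _ _ pkg.decCodom.isTopCompl.isCompl).finrank_eq]
    push_cast
    rfl
  -- Two parametrices with nuclear defects differ by a nuclear operator D, and exchanging them
  -- changes the formula by Tr(DT) - Tr(TD) = 0.
  set D := R₀ - R with hD
  have hDn : IsNuclear D := by
    have : D = R₀ * (1 - T * R) - (1 - R₀ * T) * R := by rw [hD]; noncomm_ring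
    rw [this]
    exact (h2.mul_left _).sub (n1.mul_right _)
  have e1 : 1 - R₀ * T = (1 - R * T) - D * T := by rw [hD]; noncomm_ring
  have e2 : 1 - T * R₀ = (1 - T * R) - T * D := by rw [hD]; noncomm_ring
  rw [hind, e1, e2, opTrace_sub h1 (hDn.mul_right T), opTrace_sub h2 (hDn.mul_left T),
    opTrace_mul_comm hDn T]
  ring

end Nuclear

/-! ### Functional calculus of self-adjoint operators -/

section FuncCalc

variable {𝓗 : Type*} [NormedAddCommGroup 𝓗] [InnerProductSpace ℂ 𝓗] [CompleteSpace 𝓗]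
  {T : 𝓗 →L[ℂ] 𝓗} {f g : ℝ → ℂ}

theorem mem_spectrum_real_of_complex (hT : IsSelfAdjoint T) {z : ℂ} (hz : z ∈ spectrum ℂ T) :
    z.re ∈ spectrum ℝ T ∧ (z.re : ℂ) = z := by
  have h := (hT.mem_spectrum_eq_re hz).symm
  refine ⟨?_, h⟩
  rw [← spectrum.algebraMap_mem_iff ℂ (r := z.re)]
  exact (congrArg (· ∈ spectrum ℂ T) h).mpr hz

theorem funcCalc_congr (hT : IsSelfAdjoint T) (h : ∀ x ∈ spectrum ℝ T, f x = g x) :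
    funcCalc f T = funcCalc g T :=
  cfc_congr fun _ hz => h _ (mem_spectrum_real_of_complex hT hz).1

theorem continuousOn_re (hf : Continuous f) (s : Set ℂ) : ContinuousOn (fun z : ℂ => f z.re) s :=
  (hf.comp Complex.continuous_re).continuousOn

theorem funcCalc_mul (hf : Continuous f) (hg : Continuous g) :
    funcCalc (fun x => f x * g x) T = funcCalc f T * funcCalc g T :=
  cfc_mul _ _ T (continuousOn_re hf _) (continuousOn_re hg _)

theorem funcCalc_add (hf : Continuous f) (hg : Continuous g) :
    funcCalc (fun x => f x + g x) T = funcCalc f T + funcCalc g T :=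
  cfc_add T _ _ (continuousOn_re hf _) (continuousOn_re hg _)

theorem funcCalc_sub (hf : Continuous f) (hg : Continuous g) :
    funcCalc (fun x => f x - g x) T = funcCalc f T - funcCalc g T :=
  cfc_sub _ _ T (continuousOn_re hf _) (continuousOn_re hg _)

theorem funcCalc_const_mul (hf : Continuous f) (c : ℂ) :
    funcCalc (fun x => c * f x) T = c • funcCalc f T :=
  cfc_const_mul c _ T (continuousOn_re hf _)

theorem funcCalc_star : funcCalc (fun x => star (f x)) T = star (funcCalc f T) :=
  cfc_star _ _

theorem funcCalc_const (hT : IsSelfAdjoint T) (c : ℂ) :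
    funcCalc (fun _ => c) T = c • (1 : 𝓗 →L[ℂ] 𝓗) := by
  have := hT.isStarNormal
  rw [funcCalc, cfc_const c T, Algebra.algebraMap_eq_smul_one]

theorem funcCalc_id (hT : IsSelfAdjoint T) : funcCalc (fun x => (x : ℂ)) T = T := by
  have := hT.isStarNormal
  refine Eq.trans (cfc_congr fun z hz => ?_) (cfc_id ℂ T)
  exact (mem_spectrum_real_of_complex hT hz).2

theorem norm_funcCalc_le (hT : IsSelfAdjoint T) {c : ℝ} (hc : 0 ≤ c)
    (h : ∀ x ∈ spectrum ℝ T, ‖f x‖ ≤ c) : ‖funcCalc f T‖ ≤ c :=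
  norm_cfc_le hc fun _ hz => h _ (mem_spectrum_real_of_complex hT hz).1

theorem commute_funcCalc (hT : IsSelfAdjoint T) {G : 𝓗 →L[ℂ] 𝓗} (hG : Commute G T) (f : ℝ → ℂ) :
    Commute G (funcCalc f T) :=
  (hT.commute_cfc hG.symm _).symm

theorem commute_funcCalc_self (hT : IsSelfAdjoint T) (f : ℝ → ℂ) : Commute (funcCalc f T) T :=
  hT.commute_cfc (Commute.refl T) _

theorem funcCalc_exp (hT : IsSelfAdjoint T) (hf : Continuous f) :
    funcCalc (fun x => Complex.exp (f x)) T = NormedSpace.exp (funcCalc f T) := by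
  have := hT.isStarNormal
  have hn : IsStarNormal (funcCalc f T) := by
    unfold funcCalc
    infer_instance
  rw [← CFC.complex_exp_eq_normedSpace_exp (a := funcCalc f T) hn]
  exact cfc_comp' Complex.exp (fun z : ℂ => f z.re) T Complex.continuous_exp.continuousOn
    (continuousOn_re hf _)

/-- The Weierstrass test gives norm convergence in the continuous functions on the spectrum, which
the continuous functional calculus carries over to operators. -/
theorem hasSum_funcCalc (hT : IsSelfAdjoint T) {κ : Type*} {F : κ → ℝ → ℂ}
    (hF : ∀ k, Continuous (F k)) (hf : Continuous f) {c : κ → ℝ} (hc : Summable c)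
    (hFc : ∀ k, ∀ x ∈ spectrum ℝ T, ‖F k x‖ ≤ c k)
    (h : ∀ x ∈ spectrum ℝ T, HasSum (fun k => F k x) (f x)) :
    HasSum (fun k => funcCalc (F k) T) (funcCalc f T) := by
  have hn := hT.isStarNormal
  let F' : κ → C(spectrum ℂ T, ℂ) := fun k => ⟨fun z => F k z.1.re, by fun_prop⟩
  let f' : C(spectrum ℂ T, ℂ) := ⟨fun z => f z.1.re, by fun_prop⟩
  have hs : Summable F' := by
    refine Summable.of_norm_bounded (g := fun k => |c k|) hc.abs fun k => ?_
    refine (ContinuousMap.norm_le _ (abs_nonneg _)).2 fun z => ?_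
    exact (hFc k _ (mem_spectrum_real_of_complex hT z.2).1).trans (le_abs_self _)
  have hsum : HasSum F' f' := by
    have h1 := hs.hasSum
    convert h1 using 1
    ext z
    exact (h _ (mem_spectrum_real_of_complex hT z.2).1).unique (ContinuousMap.hasSum_apply h1 z)
  have := hsum.map (cfcHom (R := ℂ) hn) (cfcHom_continuous hn)
  have e1 : ∀ k, funcCalc (F k) T = cfcHom (R := ℂ) hn (F' k) := fun k =>
    cfc_apply _ T hn (continuousOn_re (hF k) _)
  have e2 : funcCalc f T = cfcHom (R := ℂ) hn f' := cfc_apply _ T hn (continuousOn_re hf _)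
  rw [e2, funext e1]
  exact this

end FuncCalc

/-! ### Commutators with functions of an operator -/

section CommDeriv

variable {𝓗 : Type*} [NormedAddCommGroup 𝓗] [InnerProductSpace ℂ 𝓗] [CompleteSpace 𝓗]

/-- `w` and `w'` lie in the bicommutant of `h`, the operator `η [w, P]` is nuclear, and the trace
does not distinguish it from `w' η [h, P]`. -/
structure HasCommDeriv (h η P : 𝓗 →L[ℂ] 𝓗) (w w' : 𝓗 →L[ℂ] 𝓗) (c : ℝ) : Prop where
  comm : ∀ G, Commute G h → Commute G w
  comm' : ∀ G, Commute G h → Commute G w'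
  nuclear : NuclearLE (η * (w * P - P * w)) c
  trace : ∀ G, Commute G h →
    opTrace (G * (η * (w * P - P * w))) = opTrace (G * w' * (η * (h * P - P * h)))

variable {h η P : 𝓗 →L[ℂ] 𝓗}

theorem HasCommDeriv.self {c : ℝ} (hc : NuclearLE (η * (h * P - P * h)) c) :
    HasCommDeriv h η P h 1 c where
  comm := fun _ hG => hG
  comm' := fun G _ => Commute.one_right G
  nuclear := hc
  trace := fun G _ => by rw [mul_one]

theorem HasCommDeriv.one : HasCommDeriv h η P 1 0 0 where
  comm := fun G _ => Commute.one_right G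
  comm' := fun G _ => Commute.zero_right G
  nuclear := by
    simp only [one_mul, mul_one, sub_self, mul_zero]
    exact ⟨0, 0, ⟨by simp, by simp⟩, by simp⟩
  trace := fun G _ => by simp

theorem HasCommDeriv.mono {w w' : 𝓗 →L[ℂ] 𝓗} {c d : ℝ} (hw : HasCommDeriv h η P w w' c)
    (hcd : c ≤ d) : HasCommDeriv h η P w w' d :=
  ⟨hw.comm, hw.comm', hw.nuclear.mono hcd, hw.trace⟩

/-- The functional `A ↦ Tr(A N)` for a nuclear operator `N`. -/
def traceMul (N : 𝓗 →L[ℂ] 𝓗) (hN : IsNuclear N) : (𝓗 →L[ℂ] 𝓗) →L[ℂ] ℂ :=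
  LinearMap.mkContinuous
    { toFun := fun A => opTrace (A * N)
      map_add' := fun A B => by rw [add_mul, opTrace_add (hN.mul_left A) (hN.mul_left B)]
      map_smul' := fun z A => by rw [smul_mul_assoc, opTrace_smul]; rfl }
    hN.choose fun A => by
      rw [mul_comm]
      exact (hN.choose_spec.mul_left A).norm_opTrace_le

/-- Leibniz rule: [wz, P] = w[z, P] + [w, P]z. In the first term η passes w; in the second,
cyclicity of the trace brings z to the front, where it commutes with everything that is a function
of h. The free factor G in the definition is what makes the rule iterate. -/
theorem HasCommDeriv.mul (hη : Commute η h) (hK : IsNuclear (η * (h * P - P * h)))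
    {w w' z z' : 𝓗 →L[ℂ] 𝓗} {c d : ℝ}
    (hw : HasCommDeriv h η P w w' c) (hz : HasCommDeriv h η P z z' d) :
    HasCommDeriv h η P (w * z) (w' * z + w * z') (‖w‖ * d + c * ‖z‖) := by
  have hwh : Commute w h := (hw.comm h (Commute.refl h)).symm
  have hzh : Commute z h := (hz.comm h (Commute.refl h)).symm
  have hdec : η * (w * z * P - P * (w * z)) =
      w * (η * (z * P - P * z)) + η * (w * P - P * w) * z := by
    rw [← mul_assoc w η, ← (hw.comm η hη).eq]
    noncomm_ring
  refine ⟨fun G hG => (hw.comm G hG).mul_right (hz.comm G hG), fun G hG =>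
    ((hw.comm' G hG).mul_right (hz.comm G hG)).add_right
      ((hw.comm G hG).mul_right (hz.comm' G hG)), ?_, fun G hG => ?_⟩
  · rw [hdec]
    exact (hz.nuclear.mul_left w).add (hw.nuclear.mul_right z)
  · have n1 : IsNuclear (G * w * (η * (z * P - P * z))) := hz.nuclear.isNuclear.mul_left _
    have n2 : IsNuclear (G * (η * (w * P - P * w))) := hw.nuclear.isNuclear.mul_left _
    have n3 : IsNuclear (G * (η * (w * P - P * w)) * z) := n2.mul_right z
    have e1 : G * (w * (η * (z * P - P * z)) + η * (w * P - P * w) * z) =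
        G * w * (η * (z * P - P * z)) + G * (η * (w * P - P * w)) * z := by noncomm_ring
    have e2 : G * (w' * z + w * z') = z * G * w' + G * w * z' := by
      rw [← (hz.comm G hG).eq, mul_assoc G z, (hw.comm' z hzh).eq]
      noncomm_ring
    rw [hdec, e1, opTrace_add n1 n3, opTrace_mul_comm n2 z, ← mul_assoc z,
      hw.trace _ (hzh.mul_left hG), hz.trace _ (hG.mul_left hwh), e2, add_mul,
      opTrace_add (hK.mul_left _) (hK.mul_left _), add_comm]

/-- The nuclear bound grows like n‖w‖^{n-1}. For unitary w it is linear in n, which is what Fourier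
series require. -/
theorem HasCommDeriv.pow (hη : Commute η h) (hK : IsNuclear (η * (h * P - P * h)))
    {w w' : 𝓗 →L[ℂ] 𝓗} {c : ℝ} (hw : HasCommDeriv h η P w w' c) (n : ℕ) :
    HasCommDeriv h η P (w ^ (n + 1)) (((n : ℂ) + 1) • (w ^ n * w')) ((n + 1) * ‖w‖ ^ n * c) := by
  have hc := hw.nuclear.nonneg
  have hwh : Commute w h := (hw.comm h (Commute.refl h)).symm
  induction n with
  | zero => simpa using hw
  | succ n ih =>
    have h1 := ih.mul hη hK hw
    rw [← pow_succ] at h1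
    have e : ((n : ℂ) + 1) • (w ^ n * w') * w + w ^ (n + 1) * w' =
        (((n + 1 : ℕ) : ℂ) + 1) • (w ^ (n + 1) * w') := by
      rw [smul_mul_assoc, mul_assoc, ← (hw.comm' w hwh).eq, ← mul_assoc, ← pow_succ]
      push_cast
      module
    rw [e] at h1
    refine h1.mono ?_
    have h2 : ‖w ^ (n + 1)‖ ≤ ‖w‖ ^ (n + 1) := norm_pow_le' w (Nat.succ_pos n)
    calc ‖w ^ (n + 1)‖ * c + (n + 1) * ‖w‖ ^ n * c * ‖w‖
        ≤ ‖w‖ ^ (n + 1) * c + (n + 1) * ‖w‖ ^ n * c * ‖w‖ := by gcongr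
      _ = (((n + 1 : ℕ) : ℝ) + 1) * ‖w‖ ^ (n + 1) * c := by push_cast; ring

theorem HasCommDeriv.smul {w w' : 𝓗 →L[ℂ] 𝓗} {c : ℝ} (hw : HasCommDeriv h η P w w' c) (z : ℂ) :
    HasCommDeriv h η P (z • w) (z • w') (‖z‖ * c) := by
  have e : η * (z • w * P - P * (z • w)) = z • (η * (w * P - P * w)) := by
    rw [smul_mul_assoc, mul_smul_comm, ← smul_sub, mul_smul_comm]
  refine ⟨fun G hG => (hw.comm G hG).smul_right z, fun G hG => (hw.comm' G hG).smul_right z, ?_,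
    fun G hG => ?_⟩
  · have h1 := hw.nuclear.mul_left (z • (1 : 𝓗 →L[ℂ] 𝓗))
    rw [smul_mul_assoc, one_mul] at h1
    rw [e]
    refine h1.mono ?_
    have := hw.nuclear.nonneg
    gcongr
    refine (norm_smul_le _ _).trans ?_
    calc ‖z‖ * ‖(1 : 𝓗 →L[ℂ] 𝓗)‖ ≤ ‖z‖ * 1 := by
          gcongr; exact ContinuousLinearMap.norm_id_le
      _ = ‖z‖ := mul_one _
  · rw [e, mul_smul_comm, opTrace_smul, hw.trace G hG, mul_smul_comm, smul_mul_assoc, opTrace_smul]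

/-- One side passes to the limit by countable additivity of the trace, the other by norm continuity
of A ↦ Tr(A N) for nuclear N. -/
theorem HasCommDeriv.hasSum {κ : Type*} {w w' : κ → 𝓗 →L[ℂ] 𝓗} {c : κ → ℝ}
    (hK : IsNuclear (η * (h * P - P * h)))
    (hw : ∀ k, HasCommDeriv h η P (w k) (w' k) (c k)) (hc : Summable c) {W W' : 𝓗 →L[ℂ] 𝓗}
    (hW : HasSum w W) (hW' : HasSum w' W') : HasCommDeriv h η P W W' (∑' k, c k) := by
  have hcomm : ∀ (G : 𝓗 →L[ℂ] 𝓗) (w : κ → 𝓗 →L[ℂ] 𝓗) (W : 𝓗 →L[ℂ] 𝓗), HasSum w W →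
      (∀ k, Commute G (w k)) → Commute G W := by
    intro G w W hW hG
    refine (hW.mul_left G).unique ?_
    rw [show (fun i => G * w i) = fun i => w i * G from funext fun k => (hG k).eq]
    exact hW.mul_right G
  have hS : HasSum (fun k => η * (w k * P - P * w k)) (η * (W * P - P * W)) :=
    ((hW.mul_right P).sub (hW.mul_left P)).mul_left η
  refine ⟨fun G hG => hcomm G w W hW fun k => (hw k).comm G hG,
    fun G hG => hcomm G w' W' hW' fun k => (hw k).comm' G hG,
    (nuclearLE_of_hasSum (fun k => (hw k).nuclear) hc hS).1, fun G hG => ?_⟩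
  have h1 := (nuclearLE_of_hasSum (fun k => (hw k).nuclear.mul_left G) (hc.mul_left ‖G‖)
    (hS.mul_left G)).2
  refine h1.unique ?_
  rw [show (fun k => opTrace (G * (η * (w k * P - P * w k)))) =
    fun k => traceMul _ hK (G * w' k) from funext fun k => (hw k).trace G hG]
  exact (hW'.mul_left G).mapL (traceMul _ hK)

theorem HasCommDeriv.exp_smul (hη : Commute η h) (hK : IsNuclear (η * (h * P - P * h))) (z : ℂ) :
    ∃ c, HasCommDeriv h η P (NormedSpace.exp (z • h)) (z • NormedSpace.exp (z • h)) c := by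
  obtain ⟨c, hc⟩ := hK
  let w : ℕ → 𝓗 →L[ℂ] 𝓗 := fun k => (k.factorial : ℂ)⁻¹ • (z • h) ^ k
  -- The derivative of a term of the exponential series is z times the preceding term, whence the
  -- shift by one and the value 0 at k = 0.
  let w' : ℕ → 𝓗 →L[ℂ] 𝓗 := fun k => match k with
    | 0 => 0
    | k + 1 => z • ((k.factorial : ℂ)⁻¹ • (z • h) ^ k)
  let d : ℕ → ℝ := fun k => match k with
    | 0 => 0
    | k + 1 => ‖z‖ * c * ((‖z • h‖) ^ k / k.factorial)
  have hW : HasSum w (NormedSpace.exp (z • h)) := NormedSpace.exp_series_hasSum_exp' (𝕂 := ℂ) _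
  have hW' : HasSum w' (z • NormedSpace.exp (z • h)) := by
    rw [← hasSum_nat_add_iff' 1]
    simpa [w'] using hW.const_smul z
  have hd : Summable d := by
    rw [← summable_nat_add_iff 1]
    exact (Real.summable_pow_div_factorial _).mul_left _
  refine ⟨_, HasCommDeriv.hasSum ⟨c, hc⟩ (c := d) (fun k => ?_) hd hW hW'⟩
  match k with
  | 0 => simpa [w, w', d] using HasCommDeriv.one
  | k + 1 =>
    have h1 := (((HasCommDeriv.self hc).smul z).pow hη ⟨c, hc⟩ k).smul
      (((k + 1).factorial : ℂ)⁻¹)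
    have hk : ((k : ℂ) + 1) ≠ 0 := by exact_mod_cast k.succ_ne_zero
    have hk' : ((k : ℝ) + 1) ≠ 0 := by exact_mod_cast k.succ_ne_zero
    have e1 : ((k + 1).factorial : ℂ)⁻¹ • ((k : ℂ) + 1) • ((z • h) ^ k * z • (1 : 𝓗 →L[ℂ] 𝓗)) =
        w' (k + 1) := by
      simp only [w', mul_smul_comm, mul_one, smul_smul, Nat.factorial_succ]
      congr 1
      push_cast
      field_simp
    have e2 : ‖((k + 1).factorial : ℂ)⁻¹‖ * (((k : ℝ) + 1) * ‖z • h‖ ^ k * (‖z‖ * c)) =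
        d (k + 1) := by
      simp only [d, norm_inv, Nat.factorial_succ]
      rw [Complex.norm_natCast]
      push_cast
      field_simp
    rw [e1, e2] at h1
    exact h1

/-- Commutators with functions that are given by absolutely convergent Fourier series together with
their derivatives. -/
theorem HasCommDeriv.funcCalc (hh : IsSelfAdjoint h) (hη : Commute η h)
    (hK : IsNuclear (η * (h * P - P * h))) {ω : ℝ} {a : ℤ → ℂ}
    (ha : Summable fun n => ‖a n‖) (ha' : Summable fun n : ℤ => |(n : ℝ)| * ‖a n‖)
    {f f' : ℝ → ℂ} (hf : Continuous f) (hf' : Continuous f')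
    (hfs : ∀ x ∈ spectrum ℝ h,
      HasSum (fun n : ℤ => a n * Complex.exp (Complex.I * ω * n * x)) (f x))
    (hfs' : ∀ x ∈ spectrum ℝ h, HasSum (fun n : ℤ => a n * (Complex.I * ω * n) *
      Complex.exp (Complex.I * ω * n * x)) (f' x)) :
    ∃ c, HasCommDeriv h η P (funcCalc f h) (funcCalc f' h) c := by
  let e : ℤ → ℝ → ℂ := fun n x => Complex.exp (Complex.I * ω * n * x)
  have hec : ∀ n, Continuous (e n) := fun n => by fun_prop
  have hen : ∀ n x, ‖e n x‖ = 1 := by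
    intro n x
    change ‖Complex.exp (Complex.I * ω * n * x)‖ = 1
    rw [show Complex.I * ω * n * x = ((ω * n * x : ℝ) : ℂ) * Complex.I by push_cast; ring]
    exact Complex.norm_exp_ofReal_mul_I _
  have hexp : ∀ z : ℂ, CoarseEdge.funcCalc (fun x => Complex.exp (z * x)) h =
      NormedSpace.exp (z • h) := by
    intro z
    rw [funcCalc_exp hh (f := fun x => z * x) (by fun_prop),
      funcCalc_const_mul (f := fun x => (x : ℂ)) (by fun_prop), funcCalc_id hh]
  have hpow : ∀ (z : ℂ) (n : ℕ), CoarseEdge.funcCalc (fun x => Complex.exp (z * x)) h ^ n =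
      CoarseEdge.funcCalc (fun x => Complex.exp (z * n * x)) h := by
    intro z n
    rw [hexp, hexp]
    induction n with
    | zero => simp [NormedSpace.exp_zero]
    | succ n ih =>
      have hc : Commute ((z * n) • h) (z • h) := ((Commute.refl h).smul_left _).smul_right _
      let : NormedAlgebra ℚ (𝓗 →L[ℂ] 𝓗) := NormedAlgebra.restrictScalars ℚ ℂ _
      rw [pow_succ, ih, ← NormedSpace.exp_add_of_commute hc]
      congr 1
      rw [← add_smul]
      push_cast
      ring_nf
  have hunit : ∀ n, ‖CoarseEdge.funcCalc (e n) h‖ ≤ 1 := fun n =>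
    norm_funcCalc_le hh zero_le_one fun x _ => (hen n x).le
  -- a bound for the exponentials with nonnegative frequency
  have key : ∀ σ : ℤ, ∃ C, 0 ≤ C ∧ ∀ n : ℕ, HasCommDeriv h η P
      (CoarseEdge.funcCalc (e (σ * n)) h)
      ((Complex.I * ω * (σ * n : ℤ)) • CoarseEdge.funcCalc (e (σ * n)) h) (n * C) := by
    intro σ
    obtain ⟨C, hC⟩ := HasCommDeriv.exp_smul hη hK (Complex.I * ω * σ)
    refine ⟨C, hC.nuclear.nonneg, fun n => ?_⟩
    have hσ : NormedSpace.exp ((Complex.I * ω * σ) • h) = CoarseEdge.funcCalc (e σ) h :=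
      (hexp _).symm
    have hn : ∀ n : ℕ, CoarseEdge.funcCalc (e σ) h ^ n = CoarseEdge.funcCalc (e (σ * n)) h := by
      intro n
      rw [hpow]
      simp only [e]
      congr 1
      funext x
      push_cast
      ring_nf
    rw [hσ] at hC
    match n with
    | 0 =>
      have : e (σ * (0 : ℕ)) = fun _ => 1 := by funext x; simp [e]
      rw [this, funcCalc_const hh]
      simpa using HasCommDeriv.one
    | n + 1 =>
      -- Since the base exponential is a contraction, its powers cost only a factor n; summability
      -- of |n| ‖a n‖ is therefore enough.
      have h1 := hC.pow hη hK n
      rw [hn, mul_smul_comm, ← pow_succ, hn, smul_smul] at h1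
      have e1 : ((n : ℂ) + 1) * (Complex.I * ω * σ) =
          Complex.I * ω * ((σ * (n + 1 : ℕ) : ℤ) : ℂ) := by
        push_cast; ring
      rw [e1] at h1
      refine h1.mono ?_
      have := hC.nuclear.nonneg
      calc ((n : ℝ) + 1) * ‖CoarseEdge.funcCalc (e σ) h‖ ^ n * C ≤ ((n : ℝ) + 1) * 1 ^ n * C := by
            gcongr; exact hunit σ
        _ = ((n + 1 : ℕ) : ℝ) * C := by push_cast; ring
  obtain ⟨C₁, hC₁, h₁⟩ := key 1
  obtain ⟨C₂, hC₂, h₂⟩ := key (-1)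
  have hall : ∀ n : ℤ, HasCommDeriv h η P (CoarseEdge.funcCalc (e n) h)
      ((Complex.I * ω * n) • CoarseEdge.funcCalc (e n) h) (|(n : ℝ)| * (C₁ + C₂)) := by
    intro n
    obtain ⟨m, rfl | rfl⟩ := n.eq_nat_or_neg
    · have := h₁ m
      rw [one_mul] at this
      refine this.mono ?_
      rw [Int.cast_natCast, abs_of_nonneg (by positivity)]
      gcongr
      linarith
    · have := h₂ m
      rw [neg_one_mul] at this
      refine this.mono ?_
      rw [Int.cast_neg, Int.cast_natCast, abs_neg, abs_of_nonneg (by positivity)]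
      gcongr
      linarith
  refine ⟨_, HasCommDeriv.hasSum hK (fun n => (hall n).smul (a n))
    (c := fun n => ‖a n‖ * (|(n : ℝ)| * (C₁ + C₂))) ?_ ?_ ?_⟩
  · refine (ha'.mul_right (C₁ + C₂)).congr fun n => ?_
    ring
  · have := hasSum_funcCalc hh (F := fun n x => a n * e n x) (fun n => (hec n).const_mul _) hf ha
      (fun n x _ => by rw [norm_mul, hen, mul_one]) hfs
    simpa only [funcCalc_const_mul (hec _)] using this
  · have := hasSum_funcCalc hh (F := fun n x => a n * (Complex.I * ω * n) * e n x)
      (fun n => (hec n).const_mul _) hf' (ha'.mul_left |ω|)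
      (fun n x _ => by
        rw [norm_mul, hen, mul_one, norm_mul, norm_mul, norm_mul, Complex.norm_I, one_mul,
          Complex.norm_real, Complex.norm_intCast, Real.norm_eq_abs]
        apply le_of_eq
        ring) hfs'
    simpa only [funcCalc_const_mul (hec _), smul_smul] using this

end CommDeriv

/-! ### Fourier series of smooth functions -/

section FourierSeries

variable {T α : ℝ}

/-- Integration by parts; the boundary terms vanish because f is zero at both ends. -/
theorem fourierCoeffOn_deriv (hT : α < α + T) {f : ℝ → ℂ} (hf : ContDiff ℝ 1 f)
    (h0 : f α = 0) (h1 : f (α + T) = 0) (n : ℤ) :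
    fourierCoeffOn hT (deriv f) n = Complex.I * (2 * Real.pi / T : ℝ) * n * fourierCoeffOn hT f n := by
  have hTpos : 0 < T := by linarith
  have hTC : (T : ℂ) ≠ 0 := by exact_mod_cast hTpos.ne'
  have hd : ∀ x ∈ Set.uIcc α (α + T), HasDerivAt f (deriv f x) x := fun x _ =>
    (hf.differentiable one_ne_zero x).hasDerivAt
  have hc : Continuous (deriv f) := hf.continuous_deriv le_rfl
  by_cases hn : n = 0
  · subst hn
    rw [fourierCoeffOn_eq_integral]
    have := intervalIntegral.integral_eq_sub_of_hasDerivAt hd (hc.intervalIntegrable _ _)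
    simp [this, h0, h1]
  · rw [fourierCoeffOn_of_hasDerivAt hT hn hd (hc.intervalIntegrable _ _), h0, h1]
    have hnC : (n : ℂ) ≠ 0 := by exact_mod_cast hn
    have hpi : (Real.pi : ℂ) ≠ 0 := by exact_mod_cast Real.pi_ne_zero
    push_cast
    field_simp
    ring_nf

theorem exists_norm_fourierCoeffOn_le (hT : α < α + T) {f : ℝ → ℂ} (hf : Continuous f) :
    ∃ C, ∀ n : ℤ, ‖fourierCoeffOn hT f n‖ ≤ C := by
  obtain ⟨B, hB⟩ := (isCompact_uIcc (a := α) (b := α + T)).exists_bound_of_continuousOn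
    hf.continuousOn
  refine ⟨‖(1 / (α + T - α) : ℝ)‖ * (B * |α + T - α|), fun n => ?_⟩
  rw [fourierCoeffOn_eq_integral, norm_smul]
  gcongr
  refine intervalIntegral.norm_integral_le_of_norm_le_const fun x hx => ?_
  rw [norm_smul, fourier_apply, Circle.norm_coe, one_mul]
  exact hB x (Set.uIoc_subset_uIcc hx)

theorem hasSum_fourierCoeffOn (hT : α < α + T) {f : ℝ → ℂ} (hf : Continuous f)
    (h0 : f α = 0) (h1 : f (α + T) = 0) (hs : Summable fun n => ‖fourierCoeffOn hT f n‖)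
    {x : ℝ} (hx : x ∈ Set.Ioc α (α + T)) :
    HasSum (fun n : ℤ => fourierCoeffOn hT f n *
      Complex.exp (Complex.I * (2 * Real.pi / T : ℝ) * n * x)) (f x) := by
  have : Fact (0 < T) := ⟨by linarith⟩
  let F : C(AddCircle T, ℂ) := ⟨AddCircle.liftIoc T α f,
    AddCircle.liftIoc_continuous (h0.trans h1.symm) hf.continuousOn⟩
  have hF : ∀ n, fourierCoeff F n = fourierCoeffOn hT f n := fun n => fourierCoeff_liftIoc_eq f n
  have := has_pointwise_sum_fourier_series_of_summable (f := F) (by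
    rw [funext hF]; exact hs.of_norm) (x : AddCircle T)
  have hFx : F (x : AddCircle T) = f x := AddCircle.liftIoc_coe_apply hx
  rw [hFx] at this
  convert this using 2 with n
  rw [hF, fourier_coe_apply, smul_eq_mul]
  congr 2
  push_cast
  ring

/-- Three derivatives make |n|³ ‖a n‖ bounded, hence ∑ |n| ‖a n‖ finite. This is the reason for
working with steps of class C³. -/
theorem exists_fourierSeries (hT : α < α + T) {f : ℝ → ℂ} (hf : ContDiff ℝ 3 f)
    (hs : tsupport f ⊆ Set.Ioo α (α + T)) :
    ∃ a : ℤ → ℂ, (Summable fun n => ‖a n‖) ∧ (Summable fun n : ℤ => |(n : ℝ)| * ‖a n‖) ∧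
      ∀ x ∈ Set.Ioc α (α + T),
        HasSum (fun n : ℤ => a n * Complex.exp (Complex.I * (2 * Real.pi / T : ℝ) * n * x)) (f x) ∧
        HasSum (fun n : ℤ => a n * (Complex.I * (2 * Real.pi / T : ℝ) * n) *
          Complex.exp (Complex.I * (2 * Real.pi / T : ℝ) * n * x)) (deriv f x) := by
  have hTpos : 0 < T := by linarith
  have hvan : ∀ g : ℝ → ℂ, tsupport g ⊆ Set.Ioo α (α + T) → g α = 0 ∧ g (α + T) = 0 := by
    intro g hg
    refine ⟨?_, ?_⟩ <;> refine image_eq_zero_of_notMem_tsupport fun h => ?_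
    · exact lt_irrefl _ (hg h).1
    · exact lt_irrefl _ (hg h).2
  have hds : ∀ g : ℝ → ℂ, tsupport g ⊆ Set.Ioo α (α + T) →
      tsupport (deriv g) ⊆ Set.Ioo α (α + T) := fun g hg => (tsupport_deriv_subset (𝕜 := ℝ)).trans hg
  have hf1 : ContDiff ℝ 2 (deriv f) := ((contDiff_succ_iff_deriv (n := 2)).1 (by norm_num; exact hf)).2.2
  have hf2 : ContDiff ℝ 1 (deriv (deriv f)) := ((contDiff_succ_iff_deriv (n := 1)).1 (by norm_num; exact hf1)).2.2
  have hc3 : Continuous (deriv (deriv (deriv f))) := hf2.continuous_deriv le_rfl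
  set ω : ℝ := 2 * Real.pi / T with hω
  have hωpos : 0 < ω := by positivity
  set a : ℤ → ℂ := fun n => fourierCoeffOn hT f n with ha
  have e1 : ∀ n, fourierCoeffOn hT (deriv f) n = Complex.I * ω * n * a n :=
    fourierCoeffOn_deriv hT (hf.of_le (by norm_num)) (hvan f hs).1 (hvan f hs).2
  have e2 := fourierCoeffOn_deriv hT (hf1.of_le (by norm_num)) (hvan _ (hds _ hs)).1
    (hvan _ (hds _ hs)).2
  have e3 := fourierCoeffOn_deriv hT hf2 (hvan _ (hds _ (hds _ hs))).1
    (hvan _ (hds _ (hds _ hs))).2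
  simp only [← hω] at e2 e3
  obtain ⟨C, hC⟩ := exists_norm_fourierCoeffOn_le hT hc3
  -- C bounds the Fourier coefficients of the third derivative, which are (iωn)³ a n.
  have hbound : ∀ n : ℤ, |(n : ℝ)| * ‖a n‖ ≤ C / ω ^ 3 * (1 / (n : ℝ) ^ 2) := by
    intro n
    by_cases hn : n = 0
    · simp [hn]
    have hn' : 0 < |(n : ℝ)| := by positivity
    have h1 := hC n
    rw [e3, e2, e1] at h1
    simp only [norm_mul, Complex.norm_I, Complex.norm_real, Complex.norm_intCast,
      Real.norm_eq_abs, abs_of_pos hωpos, one_mul] at h1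
    rw [← sq_abs (n : ℝ), ← div_eq_mul_one_div, div_div, le_div_iff₀ (by positivity)]
    calc |(n : ℝ)| * ‖a n‖ * (ω ^ 3 * |(n : ℝ)| ^ 2) =
        ω * |(n : ℝ)| * (ω * |(n : ℝ)| * (ω * |(n : ℝ)| * ‖a n‖)) := by ring
      _ ≤ C := h1
  have hs2 : Summable fun n : ℤ => |(n : ℝ)| * ‖a n‖ :=
    ((Real.summable_one_div_int_pow.2 one_lt_two).mul_left _).of_nonneg_of_le
      (fun n => by positivity) hbound
  have hs1 : Summable fun n => ‖a n‖ := by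
    refine (hs2.add (summable_of_hasFiniteSupport (f := fun n : ℤ => if n = 0 then ‖a 0‖ else 0)
      (Set.Finite.subset (Set.finite_singleton (0 : ℤ)) ?_))).of_nonneg_of_le
      (fun n => by positivity) fun n => ?_
    · intro n hn
      by_contra h
      exact hn (if_neg h)
    · by_cases hn : n = 0
      · simp [hn]
      · have : (1 : ℝ) ≤ |(n : ℝ)| := by exact_mod_cast Int.one_le_abs hn
        simp only [hn, if_false, add_zero]
        nlinarith [norm_nonneg (a n)]
  refine ⟨a, hs1, hs2, fun x hx => ⟨hasSum_fourierCoeffOn hT hf.continuous (hvan f hs).1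
    (hvan f hs).2 hs1 hx, ?_⟩⟩
  have h3 := hasSum_fourierCoeffOn hT hf1.continuous (hvan _ (hds _ hs)).1
    (hvan _ (hds _ hs)).2 ?_ hx
  · simp only [e1] at h3
    convert h3 using 2 with n
    ring
  · simp only [e1]
    refine (hs2.mul_left ω).congr fun n => ?_
    simp only [norm_mul, Complex.norm_I, Complex.norm_real, Complex.norm_intCast,
      Real.norm_eq_abs, abs_of_pos hωpos, one_mul]
    ring

end FourierSeries

/-! ### The index of compressions as a trace -/

section TraceFormula

variable {𝓗 : Type*} [NormedAddCommGroup 𝓗] [InnerProductSpace ℂ 𝓗] [CompleteSpace 𝓗]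

/-- Fedosov's formula with the compression of u* as parametrix. Cyclicity and P² = P turn the two
defects into Tr(u*[u, P]P) and Tr(u*P[u, P]), and [u, P]P + P[u, P] = [u, P]. -/
theorem fredholmIndex_compression {P u : 𝓗 →L[ℂ] 𝓗} (hP : IsIdempotentElem P)
    (hu : u ∈ unitary (𝓗 →L[ℂ] 𝓗)) (hF : (P * u * P + (1 - P)).IsFredholm)
    (hn : IsNuclear (u * P - P * u)) :
    (fredholmIndex (P * u * P + (1 - P)) : ℂ) = opTrace (star u * (u * P - P * u)) := by
  obtain ⟨h1, h2⟩ := Unitary.mem_iff.1 hu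
  have e1 : 1 - (P * star u * P + (1 - P)) * (P * u * P + (1 - P)) =
      P * star u * (u * P - P * u) * P := one_sub_compression_mul hP h1
  have e2 : 1 - (P * u * P + (1 - P)) * (P * star u * P + (1 - P)) =
      -(P * (u * P - P * u) * star u * P) := by
    rw [one_sub_compression_mul hP h2]
    have : u * (star u * P - P * star u) = -((u * P - P * u) * star u) := by
      rw [mul_sub, sub_mul, ← mul_assoc, h2, mul_assoc P u, h2]
      noncomm_ring
    rw [mul_assoc P u, this]
    noncomm_ring
  have n1 : IsNuclear (star u * (u * P - P * u)) := hn.mul_left _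
  have n2 : IsNuclear (P * star u * (u * P - P * u)) := hn.mul_left _
  have n3 : IsNuclear (P * (u * P - P * u)) := hn.mul_left _
  have hPP := hP.eq
  rw [fredholmIndex_eq_opTrace hF (R := P * star u * P + (1 - P)) (by rw [e1]; exact n2.mul_right P)
    (by rw [e2]; exact ((n3.mul_right _).mul_right _).neg), e1, e2, opTrace_neg, sub_neg_eq_add]
  have t1 : opTrace (P * star u * (u * P - P * u) * P) =
      opTrace (star u * (u * P - P * u) * P) := by
    rw [opTrace_mul_comm n2 P, opTrace_mul_comm n1 P]
    congr 1
    rw [← mul_assoc, ← mul_assoc, hPP, ← mul_assoc]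
  have t2 : opTrace (P * (u * P - P * u) * star u * P) =
      opTrace (star u * P * (u * P - P * u)) := by
    rw [mul_assoc, opTrace_mul_comm n3, ← mul_assoc]
    congr 1
    rw [mul_assoc (star u) P P, hPP]
  rw [t1, t2, ← opTrace_add (n1.mul_right P) (hn.mul_left _)]
  congr 1
  have : (u * P - P * u) * P + P * (u * P - P * u) = u * P - P * u := by
    have : (u * P - P * u) * P + P * (u * P - P * u) = u * (P * P) - P * P * u := by noncomm_ring
    rw [this, hPP]
  calc _ = star u * ((u * P - P * u) * P + P * (u * P - P * u)) := by noncomm_ring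
    _ = _ := by rw [this]

end TraceFormula

/-! ### The trace formula for the index of smooth steps -/

section TraceFormula

open MeasureTheory

variable {𝓗 : Type*} [NormedAddCommGroup 𝓗] [InnerProductSpace ℂ 𝓗] [CompleteSpace 𝓗]

/-- Convergence is only assumed on the range of T. With Q the projection onto the closure of this
range, Q T = T, and by boundedness S Q tends to zero strongly on the whole space. -/
theorem tendsto_opTrace_mul_zero {α : Type*} {l : Filter α} {S : α → 𝓗 →L[ℂ] 𝓗} {T : 𝓗 →L[ℂ] 𝓗}
    (hT : IsNuclear T) {C : ℝ} (hC : ∀ a, ‖S a‖ ≤ C)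
    (hS : ∀ v, Filter.Tendsto (fun a => S a (T v)) l (nhds 0)) :
    Filter.Tendsto (fun a => opTrace (S a * T)) l (nhds 0) := by
  let V : Submodule ℂ 𝓗 := (LinearMap.range (T : 𝓗 →ₗ[ℂ] 𝓗)).topologicalClosure
  have hVc : IsClosed (V : Set 𝓗) := Submodule.isClosed_topologicalClosure _
  have : CompleteSpace V := hVc.completeSpace_coe
  let Q : 𝓗 →L[ℂ] 𝓗 := V.starProjection
  have hQT : Q * T = T := by
    ext v
    have : T v ∈ V := Submodule.le_topologicalClosure _ ⟨v, rfl⟩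
    exact V.starProjection_eq_self_iff.2 this
  have hQ : ∀ v, Filter.Tendsto (fun a => (S a * Q) v) l (nhds ((0 : 𝓗 →L[ℂ] 𝓗) v)) := by
    intro v
    rw [zero_apply, Metric.tendsto_nhds]
    intro ε hε
    have hmem : Q v ∈ closure (Set.range T) := by
      have : Q v ∈ V := V.starProjection_apply_mem v
      exact this
    have hC1 : 0 < |C| + 1 := by positivity
    obtain ⟨_, ⟨w, rfl⟩, hw⟩ := Metric.mem_closure_iff.1 hmem (ε / 2 / (|C| + 1)) (by positivity)
    filter_upwards [Metric.tendsto_nhds.1 (hS w) (ε / 2) (half_pos hε)] with a ha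
    rw [dist_zero_right] at ha ⊢
    have e : (S a * Q) v = S a (Q v - T w) + S a (T w) := by rw [map_sub]; simp
    rw [e]
    have h1 : ‖S a (Q v - T w)‖ ≤ (|C| + 1) * ‖Q v - T w‖ :=
      (S a).le_of_opNorm_le ((hC a).trans ((le_abs_self C).trans (by linarith))) _
    rw [dist_eq_norm] at hw
    have h2 : (|C| + 1) * ‖Q v - T w‖ < ε / 2 := by
      rw [lt_div_iff₀ hC1] at hw
      linarith
    linarith [norm_add_le (S a (Q v - T w)) (S a (T w))]
  have hb : ∀ a, ‖S a * Q‖ ≤ |C| * ‖Q‖ := fun a =>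
    (norm_mul_le _ _).trans (by gcongr; exact (hC a).trans (le_abs_self C))
  have := tendsto_opTrace_mul hT hb hQ
  simp only [mul_assoc, hQT, zero_mul] at this
  have h0 : opTrace (0 : 𝓗 →L[ℂ] 𝓗) = 0 := by simp [opTrace]
  rwa [h0] at this

variable {h P : 𝓗 →L[ℂ] 𝓗}

theorem funcCalc_eq_zero (hh : IsSelfAdjoint h) {f : ℝ → ℂ} (hf : ∀ x, f x = 0) :
    funcCalc f h = 0 := by
  rw [funcCalc_congr hh (g := fun _ => 0) fun x _ => hf x, funcCalc_const hh, zero_smul]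

theorem funcCalc_eq_one (hh : IsSelfAdjoint h) {f : ℝ → ℂ} (hf : ∀ x, f x = 1) :
    funcCalc f h = 1 := by
  rw [funcCalc_congr hh (g := fun _ => 1) fun x _ => hf x, funcCalc_const hh, one_smul]

theorem exists_hasCommDeriv_funcCalc (hh : IsSelfAdjoint h) {η : 𝓗 →L[ℂ] 𝓗} (hη : Commute η h)
    (hK : IsNuclear (η * (h * P - P * h))) {f : ℝ → ℂ} (hf : ContDiff ℝ 3 f)
    (hfc : HasCompactSupport f) :
    ∃ c, HasCommDeriv h η P (funcCalc f h) (funcCalc (deriv f) h) c := by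
  -- The period interval must contain the support of f, for the decay of the coefficients, and the
  -- spectrum of h, for the series to represent f there.
  have hb : Bornology.IsBounded (spectrum ℝ h ∪ tsupport f) :=
    (spectrum.isCompact h).isBounded.union hfc.isCompact.isBounded
  obtain ⟨R, hR⟩ := hb.subset_closedBall 0
  have hR' : ∀ x ∈ spectrum ℝ h ∪ tsupport f, x ∈ Set.Ioo (-(|R| + 1)) (-(|R| + 1) + (2 * |R| + 2)) := by
    intro x hx
    have h1 := hR hx
    rw [Metric.mem_closedBall, Real.dist_eq, sub_zero, abs_le] at h1
    have h2 := le_abs_self R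
    constructor <;> linarith [h1.1, h1.2]
  obtain ⟨a, ha, ha', hs⟩ := exists_fourierSeries (α := -(|R| + 1)) (T := 2 * |R| + 2)
    (by linarith [abs_nonneg R]) hf fun x hx => hR' x (Or.inr hx)
  exact HasCommDeriv.funcCalc hh hη hK ha ha' hf.continuous (hf.continuous_deriv (by norm_num))
    (fun x hx => (hs x (Set.Ioo_subset_Ioc_self (hR' x (Or.inl hx)))).1)
    (fun x hx => (hs x (Set.Ioo_subset_Ioc_self (hR' x (Or.inl hx)))).2)

theorem exists_continuous_cutoff {α β δ : ℝ} (hδ : 0 < δ) : ∃ e : ℝ → ℂ, Continuous e ∧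
    (∀ x ∈ Set.Icc α β, e x = 1) ∧ ∀ x ∉ Set.Icc (α - δ) (β + δ), e x = 0 := by
  refine ⟨fun x => ((max 0 (1 - max 0 (max (α - x) (x - β)) / δ) : ℝ) : ℂ), by fun_prop, ?_, ?_⟩
  · rintro x ⟨h1, h2⟩
    have : max (0 : ℝ) (max (α - x) (x - β)) = 0 :=
      max_eq_left (max_le (by linarith) (by linarith))
    simp [this]
  · intro x hx
    have h1 : δ ≤ max (α - x) (x - β) := by
      by_contra hlt
      rw [not_le, max_lt_iff] at hlt
      exact hx ⟨by linarith [hlt.1], by linarith [hlt.2]⟩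
    have h2 : 1 ≤ max (0 : ℝ) (max (α - x) (x - β)) / δ := by
      rw [le_div_iff₀ hδ, one_mul]
      exact h1.trans (le_max_right _ _)
    have h3 : max (0 : ℝ) (1 - max 0 (max (α - x) (x - β)) / δ) = 0 := max_eq_left (by linarith)
    simp only [h3, Complex.ofReal_zero]

/-- With w = u - 1 supported in [α, β], the commutator [u, P] = [w, P] is split as η(h)[w, P] + (1 -
η(h))[w, P]. The chain rule evaluates the first part, since u* times the derivative of exp(2πi g) is
2πi g'. The second part is off-diagonal with respect to the spectrum of h and does not contribute to
the trace. -/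
theorem fredholmIndex_step (hh : IsSelfAdjoint h) (hP : IsStarProjection P) {α β δ : ℝ}
    (hδ : 0 < δ) {g : ℝ → ℝ} (hg : ContDiff ℝ 3 g) (hα : ∀ x ≤ α, g x = 1)
    (hβ : ∀ x, β ≤ x → g x = 0) {η : ℝ → ℂ} (hηc : Continuous η) (hηr : ∀ x, star (η x) = η x)
    (hη1 : ∀ x ∈ Set.Icc (α - δ) (β + δ), η x = 1)
    (hn : IsNuclear (funcCalc η h * (h * P - P * h)))
    (hF : (P * funcCalc (fun x => Complex.exp (2 * Real.pi * Complex.I * g x)) h * P +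
      (1 - P)).IsFredholm) :
    (fredholmIndex (P * funcCalc (fun x => Complex.exp (2 * Real.pi * Complex.I * g x)) h * P +
      (1 - P)) : ℂ) = 2 * Real.pi * Complex.I *
        opTrace (funcCalc (fun x => ((deriv g x : ℝ) : ℂ)) h *
          (funcCalc η h * (h * P - P * h))) := by
  set υ : ℝ → ℂ := fun x => Complex.exp (2 * Real.pi * Complex.I * g x) with hυ
  have hgC : ContDiff ℝ 3 fun x => ((g x : ℝ) : ℂ) := Complex.ofRealCLM.contDiff.comp hg
  have hυc : ContDiff ℝ 3 υ := (contDiff_const.mul hgC).cexp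
  have hυ1 : ∀ x ∉ Set.Icc α β, υ x = 1 := by
    intro x hx
    rcases lt_or_ge x α with h1 | h1
    · simp [hυ, hα x h1.le, Complex.exp_two_pi_mul_I]
    · have h2 : β ≤ x := by
        by_contra h2
        exact hx ⟨h1, (not_le.1 h2).le⟩
      simp [hυ, hβ x h2]
  have hυu : ∀ x, star (υ x) * υ x = 1 := by
    intro x
    have : ‖υ x‖ = 1 := by
      simp only [hυ]
      rw [show 2 * Real.pi * Complex.I * (g x : ℂ) = ((2 * Real.pi * g x : ℝ) : ℂ) * Complex.I by
        push_cast; ring]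
      exact Complex.norm_exp_ofReal_mul_I _
    rw [Complex.star_def, ← Complex.normSq_eq_conj_mul_self, Complex.normSq_eq_norm_sq, this]
    simp
  let f : ℝ → ℂ := fun x => υ x - 1
  have hf : ContDiff ℝ 3 f := hυc.sub contDiff_const
  have hf0 : ∀ x ∉ Set.Icc α β, f x = 0 := fun x hx => by simp [f, hυ1 x hx]
  have hfc : HasCompactSupport f := HasCompactSupport.intro isCompact_Icc hf0
  let f' : ℝ → ℂ := fun x => star (f x)
  have hf' : ContDiff ℝ 3 f' := Complex.conjCLE.contDiff.comp hf
  have hfc' : HasCompactSupport f' := HasCompactSupport.intro (K := Set.Icc α β) isCompact_Icc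
    fun x hx => by simp [f', hf0 x hx]
  obtain ⟨e, hec, he1, he0⟩ := exists_continuous_cutoff (α := α) (β := β) hδ
  have hsub : Set.Icc α β ⊆ Set.Icc (α - δ) (β + δ) :=
    Set.Icc_subset_Icc (by linarith) (by linarith)
  set u := funcCalc υ h with hu
  set w := funcCalc f h with hw
  set y := funcCalc η h with hy
  set ee := funcCalc e h with hee
  have hstarw : star w = funcCalc f' h := funcCalc_star.symm
  have hstary : star y = y := by
    rw [hy, ← funcCalc_star]
    exact funcCalc_congr hh fun x _ => hηr x
  have huw : u = w + 1 := by
    rw [hw, ← funcCalc_eq_one hh (f := fun _ => 1) fun _ => rfl,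
      ← funcCalc_add hf.continuous continuous_const]
    exact funcCalc_congr hh fun x _ => by simp [f]
  have hyw : y * w = w := by
    rw [hy, hw, ← funcCalc_mul hηc hf.continuous]
    refine funcCalc_congr hh fun x _ => ?_
    by_cases hx : x ∈ Set.Icc α β
    · rw [hη1 x (hsub hx), one_mul]
    · rw [hf0 x hx, mul_zero]
  have hwy : w * y = w := by
    rw [hy, hw, ← funcCalc_mul hf.continuous hηc]
    refine funcCalc_congr hh fun x _ => ?_
    by_cases hx : x ∈ Set.Icc α β
    · rw [hη1 x (hsub hx), mul_one]
    · rw [hf0 x hx, zero_mul]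
  have hwe : w * ee = w := by
    rw [hee, hw, ← funcCalc_mul hf.continuous hec]
    refine funcCalc_congr hh fun x _ => ?_
    by_cases hx : x ∈ Set.Icc α β
    · rw [he1 x hx, mul_one]
    · rw [hf0 x hx, zero_mul]
  have hey : ee * (1 - y) = 0 := by
    rw [mul_sub, mul_one, hee, hy, ← funcCalc_mul hec hηc, ← funcCalc_sub (g := fun x => e x * η x) hec (hec.mul hηc)]
    refine funcCalc_eq_zero hh fun x => ?_
    by_cases hx : x ∈ Set.Icc (α - δ) (β + δ)
    · rw [hη1 x hx, mul_one, sub_self]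
    · rw [he0 x hx, zero_mul, sub_self]
  have hu1 : star u * u = 1 := by
    rw [hu, ← funcCalc_star, ← funcCalc_mul (by fun_prop) hυc.continuous]
    exact funcCalc_eq_one hh hυu
  have hu2 : u * star u = 1 := by
    rw [hu, ← funcCalc_star, ← funcCalc_mul hυc.continuous (by fun_prop)]
    exact funcCalc_eq_one hh fun x => by rw [mul_comm, hυu]
  have huU : u ∈ unitary (𝓗 →L[ℂ] 𝓗) := Unitary.mem_iff.2 ⟨hu1, hu2⟩
  have hyh : Commute y h := commute_funcCalc_self hh η
  obtain ⟨c₁, hc₁⟩ := exists_hasCommDeriv_funcCalc hh hyh hn hf hfc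
  obtain ⟨c₂, hc₂⟩ := exists_hasCommDeriv_funcCalc hh hyh hn hf' hfc'
  rw [← hstarw] at hc₂
  rw [← hw] at hc₁
  have hPs : star P = P := hP.isSelfAdjoint.star_eq
  set N := (w * P - P * w) * y with hN
  -- The hypothesis gives nuclearity only with η on the left. Taking the adjoint of the statement
  -- for w*, with η real, puts η on the right.
  have hNn : IsNuclear N := by
    have := hc₂.nuclear.isNuclear.star.neg
    convert this using 1
    simp only [star_mul, star_sub, star_star, hPs, hstary]
    rw [hN]
    noncomm_ring
  -- Because η = 1 on the support of w, one has (1 - y)w = 0 and w y = w. So (1 - y)[w, P] equals (1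
  -- - y)N and is nuclear.
  have hX : (1 - y) * N = -((1 - y) * P * w) := by
    rw [hN]
    have : (1 - y) * ((w * P - P * w) * y) =
        (w - y * w) * P * y - (1 - y) * P * (w * y) := by noncomm_ring
    rw [this, hyw, hwy]
    noncomm_ring
  have hdec : w * P - P * w = y * (w * P - P * w) + (1 - y) * N := by
    rw [hX]
    have : y * (w * P - P * w) + -((1 - y) * P * w) = y * w * P - P * w := by noncomm_ring
    rw [this, hyw]
  have hcomm : u * P - P * u = w * P - P * w := by rw [huw]; noncomm_ring
  have hnuc : IsNuclear (u * P - P * u) := by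
    rw [hcomm, hdec]
    exact hc₁.nuclear.isNuclear.add (hNn.mul_left _)
  rw [fredholmIndex_compression hP.isIdempotentElem huU hF hnuc, hcomm, hdec, mul_add,
    opTrace_add (hc₁.nuclear.isNuclear.mul_left _) ((hNn.mul_left _).mul_left _)]
  have huh : Commute (star u) h := by
    rw [hu, ← funcCalc_star]
    exact commute_funcCalc_self hh _
  -- The operator ends in w = w e, where e is a cutoff with e(1 - η) = 0. Moving e(h) around the
  -- trace and past u* annihilates the factor 1 - y.
  have hz : opTrace (star u * ((1 - y) * N)) = 0 := by
    have e1 : star u * ((1 - y) * N) = star u * ((1 - y) * N) * ee := by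
      rw [hX, mul_assoc (star u), neg_mul, mul_assoc _ w ee, hwe]
    have hcu : ee * star u = star u * ee := by
      have : Commute (star u) ee := commute_funcCalc hh huh e
      exact this.eq.symm
    rw [e1, opTrace_mul_comm ((hNn.mul_left _).mul_left _) ee]
    have : ee * (star u * ((1 - y) * N)) = 0 := by
      rw [← mul_assoc, hcu, mul_assoc, ← mul_assoc ee, hey, zero_mul, mul_zero]
    rw [this]
    simp [opTrace]
  rw [hz, add_zero, hc₁.trace _ huh, ← opTrace_smul, ← smul_mul_assoc]
  congr 2
  rw [hu, ← funcCalc_star, ← funcCalc_mul (by fun_prop) (hf.continuous_deriv (by norm_num)),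
    ← funcCalc_const_mul (f := fun x => ((deriv g x : ℝ) : ℂ))
      (Complex.continuous_ofReal.comp (hg.continuous_deriv (by norm_num)))]
  refine funcCalc_congr hh fun x _ => ?_
  have hd : HasDerivAt f (υ x * (2 * Real.pi * Complex.I * (deriv g x : ℝ))) x := by
    have h1 : HasDerivAt g (deriv g x) x := (hg.differentiable (by norm_num) x).hasDerivAt
    exact (((h1.ofReal_comp).const_mul _).cexp).sub_const 1
  rw [hd.deriv, ← mul_assoc, hυu, one_mul]

end TraceFormula

/-! ### The index as the trace of the current operator -/

section CurrentFormula

open MeasureTheory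

variable {𝓗 : Type*} [NormedAddCommGroup 𝓗] [InnerProductSpace ℂ 𝓗] [CompleteSpace 𝓗]
  {h P : 𝓗 →L[ℂ] 𝓗}

/-- A smooth step function with prescribed derivative `-ρ`. -/
theorem exists_contDiff_step {α β : ℝ} {ρ : ℝ → ℝ} (hρ : ContDiff ℝ 2 ρ)
    (hs : Function.support ρ ⊆ Set.Ioo α β) (hi : ∫ x, ρ x = 1) :
    ∃ g : ℝ → ℝ, ContDiff ℝ 3 g ∧ (∀ x ≤ α, g x = 1) ∧ (∀ x, β ≤ x → g x = 0) ∧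
      ∀ x, deriv g x = -ρ x := by
  have hd : ∀ x, HasDerivAt (fun x => 1 - ∫ t in α..x, ρ t) (-ρ x) x := fun x =>
    (intervalIntegral.integral_hasDerivAt_right (hρ.continuous.intervalIntegrable _ _)
      (hρ.continuous.stronglyMeasurableAtFilter _ _) hρ.continuous.continuousAt).const_sub 1
  refine ⟨fun x => 1 - ∫ t in α..x, ρ t, ?_, fun x hx => ?_, fun x hx => ?_,
    fun x => (hd x).deriv⟩
  · have e : deriv (fun x => 1 - ∫ t in α..x, ρ t) = fun x => -ρ x := funext fun x => (hd x).deriv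
    have : ContDiff ℝ (2 + 1) (fun x => 1 - ∫ t in α..x, ρ t) :=
      contDiff_succ_iff_deriv.2 ⟨fun x => (hd x).differentiableAt, by simp, by
        rw [e]; exact hρ.neg⟩
    norm_num at this
    exact this
  · have : ∫ t in α..x, ρ t = 0 := by
      rw [intervalIntegral.integral_congr (g := fun _ => 0)]
      · simp
      · intro t ht
        rw [Set.uIcc_of_ge hx] at ht
        by_contra hne
        exact absurd (hs hne).1 (not_lt.2 ht.2)
    simp [this]
  · have : ∫ t in α..x, ρ t = 1 := by
      rw [← hi]
      refine intervalIntegral.integral_eq_integral_of_support_subset fun t ht => ?_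
      exact ⟨(hs ht).1, (hs ht).2.le.trans hx⟩
    simp [this]

/-- A continuous local inverse of `φ` whose product with `φ` is real. -/
theorem exists_local_inverse {φ : ℝ → ℂ} (hφ : Continuous φ) {α β : ℝ}
    (h0 : ∀ x ∈ Set.Icc α β, φ x ≠ 0) :
    ∃ k : ℝ → ℂ, Continuous k ∧ (∀ x ∈ Set.Icc α β, k x * φ x = 1) ∧
      ∀ x, star (k x * φ x) = k x * φ x := by
  -- The inverse will be the conjugate of φ divided by max(ε, |φ|²): the denominator never vanishes,
  -- equals |φ|² on the interval, and makes the product with φ real everywhere.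
  obtain ⟨ε, hε, hεφ⟩ : ∃ ε > 0, ∀ x ∈ Set.Icc α β, ε ≤ ‖φ x‖ ^ 2 := by
    rcases (Set.Icc α β).eq_empty_or_nonempty with he | he
    · exact ⟨1, one_pos, by simp [he]⟩
    · obtain ⟨x₀, hx₀, hmin⟩ := isCompact_Icc.exists_isMinOn he
        (f := fun x => ‖φ x‖ ^ 2) (by fun_prop)
      have := norm_pos_iff.2 (h0 x₀ hx₀)
      exact ⟨‖φ x₀‖ ^ 2, by positivity, fun x hx => hmin hx⟩
  have hm : ∀ x, ((max ε (‖φ x‖ ^ 2) : ℝ) : ℂ) ≠ 0 := fun x => by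
    exact_mod_cast (hε.trans_le (le_max_left _ _)).ne'
  have e : ∀ x, star (φ x) / ((max ε (‖φ x‖ ^ 2) : ℝ) : ℂ) * φ x =
      ((‖φ x‖ ^ 2 / max ε (‖φ x‖ ^ 2) : ℝ) : ℂ) := by
    intro x
    rw [div_mul_eq_mul_div, Complex.star_def, ← Complex.normSq_eq_conj_mul_self,
      Complex.normSq_eq_norm_sq, Complex.ofReal_div]
  refine ⟨fun x => star (φ x) / ((max ε (‖φ x‖ ^ 2) : ℝ) : ℂ), ?_, fun x hx => ?_, fun x => ?_⟩
  · exact (by fun_prop : Continuous fun x => star (φ x)).div (by fun_prop) hm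
  · simp only [e]
    have h1 := hεφ x hx
    rw [max_eq_right h1, div_self (hε.trans_le h1).ne', Complex.ofReal_one]
  · simp only [e]
    rw [Complex.star_def, Complex.conj_ofReal]

/-- For every step `g` from `1` on `(-∞, a]` to `0` on `[b, ∞)` the compression of
`exp(2 π i g(h))` is Fredholm of index `c`. -/
def HasStepIndex (h P : 𝓗 →L[ℂ] 𝓗) (a b : ℝ) (c : ℤ) : Prop :=
  ∀ g : ℝ → ℝ, Continuous g → (∀ x ≤ a, g x = 1) → (∀ x, b ≤ x → g x = 0) →
    (P * funcCalc (fun x => Complex.exp (2 * Real.pi * Complex.I * g x)) h * P +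
      (1 - P)).IsFredholm ∧
    fredholmIndex (P * funcCalc (fun x => Complex.exp (2 * Real.pi * Complex.I * g x)) h * P +
      (1 - P)) = c

/-- The functional `ψ ↦ Tr(ψ(h) D)`. -/
def spectralTrace (h D : 𝓗 →L[ℂ] 𝓗) (ψ : ℝ → ℂ) : ℂ := opTrace (funcCalc ψ h * D)

/-! ### Linearity and continuity of ψ ↦ Tr(ψ(h) D) -/

section SpectralTrace

variable {D : 𝓗 →L[ℂ] 𝓗} {f g : ℝ → ℂ}

theorem spectralTrace_add (hD : IsNuclear D) (hf : Continuous f) (hg : Continuous g) :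
    spectralTrace h D (fun x => f x + g x) = spectralTrace h D f + spectralTrace h D g := by
  rw [spectralTrace, funcCalc_add hf hg, add_mul, opTrace_add (hD.mul_left _) (hD.mul_left _)]
  rfl

theorem spectralTrace_const_mul (hf : Continuous f) (c : ℂ) :
    spectralTrace h D (fun x => c * f x) = c * spectralTrace h D f := by
  rw [spectralTrace, funcCalc_const_mul hf, smul_mul_assoc, opTrace_smul]
  rfl

theorem spectralTrace_sum (hD : IsNuclear D) {κ : Type*} (s : Finset κ) {F : κ → ℝ → ℂ}
    (hF : ∀ i, Continuous (F i)) :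
    spectralTrace h D (fun x => ∑ i ∈ s, F i x) = ∑ i ∈ s, spectralTrace h D (F i) := by
  classical
  induction s using Finset.induction_on with
  | empty =>
    have := spectralTrace_const_mul (h := h) (D := D) (f := fun _ => 0) continuous_const 0
    simpa using this
  | insert i s hi ih =>
    simp only [Finset.sum_insert hi]
    rw [spectralTrace_add hD (hF i) (continuous_finsetSum s fun j _ => hF j), ih]

theorem exists_norm_spectralTrace_le (hh : IsSelfAdjoint h) (hD : IsNuclear D) :
    ∃ C, 0 ≤ C ∧ ∀ (f : ℝ → ℂ) (ε : ℝ), 0 ≤ ε → (∀ x ∈ spectrum ℝ h, ‖f x‖ ≤ ε) →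
      ‖spectralTrace h D f‖ ≤ C * ε := by
  obtain ⟨c, hc⟩ := hD
  refine ⟨c, hc.nonneg, fun f ε hε hf => ?_⟩
  refine (hc.mul_left _).norm_opTrace_le.trans ?_
  rw [mul_comm]
  exact mul_le_mul_of_nonneg_left (norm_funcCalc_le hh hε hf) hc.nonneg

end SpectralTrace

variable {φ : ℝ → ℂ} {a b : ℝ} {c : ℤ}

/-- The step g with derivative -ρ has index c, and kφ serves as the cutoff η, since multiplying D by
k(h) makes it nuclear. The factors 2πi, -1 from g' = -ρ, and -i from D combine to c = -2π Tr((kρ)(h)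
D). -/
theorem spectralTrace_of_contDiff (hh : IsSelfAdjoint h) (hP : IsStarProjection P)
    (hφ : Continuous φ) (hφs : tsupport φ ⊆ Set.Ioo a b)
    (hD : IsNuclear (funcCalc φ h * (Complex.I • (h * P - P * h)))) (hc : HasStepIndex h P a b c)
    {α β δ : ℝ} (hδ : 0 < δ) (hαβ : α < β) {k : ℝ → ℂ} (hk : Continuous k)
    (hk1 : ∀ x ∈ Set.Icc (α - δ) (β + δ), k x * φ x = 1)
    (hkr : ∀ x, star (k x * φ x) = k x * φ x) {ρ : ℝ → ℝ} (hρ : ContDiff ℝ 2 ρ)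
    (hs : Function.support ρ ⊆ Set.Ioo α β) (hi : ∫ x, ρ x = 1) :
    spectralTrace h (funcCalc φ h * (Complex.I • (h * P - P * h))) (fun x => k x * ρ x) =
      -(c / (2 * Real.pi)) := by
  obtain ⟨g, hg, hgα, hgβ, hgd⟩ := exists_contDiff_step hρ hs hi
  have hmem : ∀ x ∈ Set.Icc (α - δ) (β + δ), x ∈ Set.Ioo a b := fun x hx =>
    hφs (subset_tsupport φ fun h0 => by simpa [h0] using hk1 x hx)
  have ha := (hmem (α - δ) ⟨le_rfl, by linarith⟩).1
  have hb := (hmem (β + δ) ⟨by linarith, le_rfl⟩).2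
  obtain ⟨hF, hind⟩ := hc g hg.continuous (fun x hx => hgα x (by linarith))
    fun x hx => hgβ x (by linarith)
  set D := funcCalc φ h * (Complex.I • (h * P - P * h)) with hDdef
  have hkD : funcCalc (fun x => k x * φ x) h * (h * P - P * h) =
      (-Complex.I) • (funcCalc k h * D) := by
    rw [funcCalc_mul hk hφ, hDdef, mul_smul_comm, mul_smul_comm, smul_smul]
    simp [mul_assoc]
  have hkey := fredholmIndex_step hh hP hδ hg hgα hgβ (hk.mul hφ) hkr hk1
    (by
      have : IsNuclear (funcCalc (fun x => k x * φ x) h * (h * P - P * h)) := by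
        rw [hkD]
        exact (hD.mul_left _).smul _
      exact this) hF
  rw [hind] at hkey
  have e1 : funcCalc (fun x => ((deriv g x : ℝ) : ℂ)) h *
      (funcCalc (fun x => k x * φ x) h * (h * P - P * h)) =
      Complex.I • (funcCalc (fun x => k x * ρ x) h * D) := by
    have hρc : Continuous fun x => ((ρ x : ℝ) : ℂ) := Complex.continuous_ofReal.comp hρ.continuous
    have : funcCalc (fun x => ((deriv g x : ℝ) : ℂ)) h = (-1 : ℂ) • funcCalc (fun x => (ρ x : ℂ)) h := by
      rw [← funcCalc_const_mul hρc]
      exact funcCalc_congr hh fun x _ => by rw [hgd]; push_cast; ring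
    rw [hkD, this, smul_mul_assoc, mul_smul_comm, smul_smul, ← mul_assoc, ← funcCalc_mul hρc hk]
    simp [mul_comm]
  have e2 : (c : ℂ) = 2 * Real.pi * Complex.I * (Complex.I *
      spectralTrace h D (fun x => k x * ρ x)) := by
    rw [spectralTrace, ← opTrace_smul, ← e1]
    exact hkey
  have hpi : (Real.pi : ℂ) ≠ 0 := by exact_mod_cast Real.pi_ne_zero
  rw [e2]
  field_simp
  ring_nf
  simp

/-- The normalization of ρ is removed by adding a multiple of a fixed bump of integral 1, and its
smoothness by uniform C² approximation within the same support; both sides are continuous for this.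
-/
theorem spectralTrace_of_real (hh : IsSelfAdjoint h) (hP : IsStarProjection P)
    (hφ : Continuous φ) (hφs : tsupport φ ⊆ Set.Ioo a b)
    (hD : IsNuclear (funcCalc φ h * (Complex.I • (h * P - P * h)))) (hc : HasStepIndex h P a b c)
    {α β δ : ℝ} (hδ : 0 < δ) (hαβ : α < β) {k : ℝ → ℂ} (hk : Continuous k)
    (hk1 : ∀ x ∈ Set.Icc (α - δ) (β + δ), k x * φ x = 1)
    (hkr : ∀ x, star (k x * φ x) = k x * φ x) {ρ : ℝ → ℝ} (hρ : Continuous ρ)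
    (hs : Function.support ρ ⊆ Set.Ioo α β) :
    spectralTrace h (funcCalc φ h * (Complex.I • (h * P - P * h))) (fun x => k x * ρ x) =
      -(c / (2 * Real.pi)) * ((∫ x, ρ x : ℝ) : ℂ) := by
  set D := funcCalc φ h * (Complex.I • (h * P - P * h)) with hDdef
  have hinteg : ∀ σ : ℝ → ℝ, Continuous σ → Function.support σ ⊆ Set.Ioo α β → Integrable σ :=
    fun σ hσ hσs => hσ.integrable_of_hasCompactSupport
      (HasCompactSupport.intro (K := Set.Icc α β) isCompact_Icc fun x hx => by
        by_contra hne
        exact hx (Set.Ioo_subset_Icc_self (hσs hne)))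
  have hkσ : ∀ σ : ℝ → ℝ, Continuous σ → Continuous fun x => k x * (σ x : ℂ) := fun σ hσ =>
    hk.mul (Complex.continuous_ofReal.comp hσ)
  -- smooth functions of arbitrary integral
  have hsmooth : ∀ σ : ℝ → ℝ, ContDiff ℝ 2 σ → Function.support σ ⊆ Set.Ioo α β →
      spectralTrace h D (fun x => k x * σ x) = -(c / (2 * Real.pi)) * ((∫ x, σ x : ℝ) : ℂ) := by
    intro σ hσ hσs
    -- Centre and outer radius are chosen so that the support is exactly (α, β).
    let B : ContDiffBump ((α + β) / 2 : ℝ) := ⟨(β - α) / 4, (β - α) / 2, by linarith, by linarith⟩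
    let σ₀ : ℝ → ℝ := B.normed volume
    have h0 : ContDiff ℝ 2 σ₀ := B.contDiff_normed (n := 2)
    have h0s : Function.support σ₀ ⊆ Set.Ioo α β := by
      rw [B.support_normed_eq, Real.ball_eq_Ioo]
      refine Set.Ioo_subset_Ioo (le_of_eq ?_) (le_of_eq ?_) <;>
      · simp only [B]
        ring
    have h0i : ∫ x, σ₀ x = 1 := B.integral_normed
    set s := ∫ x, σ x with hsdef
    have h1 := spectralTrace_of_contDiff hh hP hφ hφs hD hc hδ hαβ hk hk1 hkr h0 h0s h0i
    -- Adding (1 - s)σ₀ restores integral 1; no sign condition on the density is needed.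
    have h2 := spectralTrace_of_contDiff hh hP hφ hφs hD hc hδ hαβ hk hk1 hkr
      (ρ := fun x => σ x + (1 - s) * σ₀ x) (hσ.add (contDiff_const.mul h0)) (by
        intro x hx
        by_contra hx'
        refine hx ?_
        have e1 : σ x = 0 := by by_contra hne; exact hx' (hσs hne)
        have e2 : σ₀ x = 0 := by by_contra hne; exact hx' (h0s hne)
        simp [e1, e2]) (by
        rw [integral_add (hinteg σ hσ.continuous hσs)
          ((hinteg σ₀ h0.continuous h0s).const_mul _), integral_const_mul, h0i, ← hsdef]
        ring)
    have h3 : (fun x => k x * ((σ x + (1 - s) * σ₀ x : ℝ) : ℂ)) =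
        fun x => k x * σ x + (1 - s : ℂ) * (k x * σ₀ x) := by
      funext x; push_cast; ring
    rw [h3, ← hDdef, spectralTrace_add (g := fun x => (1 - s : ℂ) * (k x * σ₀ x)) hD
      (hkσ σ hσ.continuous) (continuous_const.mul (hkσ σ₀ h0.continuous)),
      spectralTrace_const_mul (hkσ σ₀ h0.continuous), h1] at h2
    rw [eq_sub_of_add_eq h2]
    ring
  obtain ⟨C, hC0, hC⟩ := exists_norm_spectralTrace_le hh hD
  obtain ⟨L, hL⟩ := (spectrum.isCompact (𝕜 := ℝ) h).exists_bound_of_continuousOn hk.continuousOn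
  set lam : ℂ := -(c / (2 * Real.pi)) with hlam
  refine eq_of_forall_dist_le fun ε hε => ?_
  have hM : 0 < C * |L| + ‖lam‖ * (β - α) + 1 := by
    have : 0 ≤ β - α := by linarith
    positivity
  set ε' := ε / (C * |L| + ‖lam‖ * (β - α) + 1) with hε'
  have hε'pos : 0 < ε' := by positivity
  obtain ⟨σ, hσ, hσρ, hσs⟩ := hρ.exists_contDiff_approx 2 (ε := fun _ => ε') continuous_const
    fun _ => hε'pos
  have hσs' := hσs.trans hs
  have e := hsmooth σ hσ hσs'
  have d1 : ‖spectralTrace h D (fun x => k x * ρ x) - spectralTrace h D (fun x => k x * σ x)‖ ≤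
      C * (|L| * ε') := by
    have : (fun x => k x * (ρ x : ℂ)) =
        fun x => k x * ((ρ x - σ x : ℝ) : ℂ) + k x * (σ x : ℂ) := by
      funext x; push_cast; ring
    rw [this, spectralTrace_add hD (hkσ (fun x => ρ x - σ x) (hρ.sub hσ.continuous)) (hkσ σ hσ.continuous),
      add_sub_cancel_right]
    refine hC _ _ (by positivity) fun x hx => ?_
    rw [norm_mul, Complex.norm_real, ← dist_eq_norm, dist_comm]
    exact mul_le_mul ((hL x hx).trans (le_abs_self L)) (hσρ x).le dist_nonneg (abs_nonneg L)
  have d2 : ‖(∫ x, σ x) - ∫ x, ρ x‖ ≤ ε' * (β - α) := by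
    rw [← integral_sub (hinteg σ hσ.continuous hσs') (hinteg ρ hρ hs),
      ← setIntegral_eq_integral_of_forall_compl_eq_zero (s := Set.Ioo α β)]
    · have := norm_setIntegral_le_of_norm_le_const (μ := volume) (s := Set.Ioo α β)
        (f := fun x => σ x - ρ x) (C := ε') (by simp) (fun x _ => by
          rw [← dist_eq_norm]; exact (hσρ x).le)
      simpa [Measure.real, Real.volume_Ioo, ENNReal.toReal_ofReal (by linarith : 0 ≤ β - α)] using this
    · intro x hx
      have e1 : σ x = 0 := by by_contra hne; exact hx (hσs' hne)
      have e2 : ρ x = 0 := by by_contra hne; exact hx (hs hne)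
      rw [e1, e2, sub_zero]
  rw [dist_eq_norm]
  calc ‖spectralTrace h D (fun x => k x * ρ x) - lam * ((∫ x, ρ x : ℝ) : ℂ)‖
      = ‖(spectralTrace h D (fun x => k x * ρ x) - spectralTrace h D (fun x => k x * σ x)) +
        lam * (((∫ x, σ x) - ∫ x, ρ x : ℝ) : ℂ)‖ := by
        rw [e]; congr 1; push_cast; ring
    _ ≤ C * (|L| * ε') + ‖lam‖ * (ε' * (β - α)) := by
        refine (norm_add_le _ _).trans (add_le_add d1 ?_)
        rw [norm_mul, Complex.norm_real]
        exact mul_le_mul_of_nonneg_left d2 (norm_nonneg _)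
    _ = ε' * (C * |L| + ‖lam‖ * (β - α)) := by ring
    _ ≤ ε' * (C * |L| + ‖lam‖ * (β - α) + 1) :=
        mul_le_mul_of_nonneg_left (by linarith) hε'pos.le
    _ = ε := by rw [hε']; field_simp

/-- Writing ψ = kρ with ρ = ψφ reduces the claim to the real and imaginary parts of ρ, because kφ =
1 on the support of ψ. -/
theorem spectralTrace_of_interval (hh : IsSelfAdjoint h) (hP : IsStarProjection P)
    (hφ : Continuous φ) (hφs : tsupport φ ⊆ Set.Ioo a b)
    (hD : IsNuclear (funcCalc φ h * (Complex.I • (h * P - P * h)))) (hc : HasStepIndex h P a b c)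
    {α β δ : ℝ} (hδ : 0 < δ) (hαβ : α < β) (h0 : ∀ x ∈ Set.Icc (α - δ) (β + δ), φ x ≠ 0)
    {ψ : ℝ → ℂ} (hψ : Continuous ψ) (hs : Function.support ψ ⊆ Set.Ioo α β) :
    spectralTrace h (funcCalc φ h * (Complex.I • (h * P - P * h))) ψ =
      -(c / (2 * Real.pi)) * ∫ x, ψ x * φ x := by
  obtain ⟨k, hk, hk1, hkr⟩ := exists_local_inverse hφ h0
  set D := funcCalc φ h * (Complex.I • (h * P - P * h)) with hDdef
  let ρ : ℝ → ℂ := fun x => ψ x * φ x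
  have hρ : Continuous ρ := hψ.mul hφ
  have hρ0 : ∀ x ∉ Set.Ioo α β, ρ x = 0 := fun x hx => by
    have : ψ x = 0 := by by_contra hne; exact hx (hs hne)
    simp [ρ, this]
  have hρi : Integrable ρ := hρ.integrable_of_hasCompactSupport
    (HasCompactSupport.intro (K := Set.Icc α β) isCompact_Icc fun x hx =>
      hρ0 x fun h' => hx (Set.Ioo_subset_Icc_self h'))
  have h1 := spectralTrace_of_real hh hP hφ hφs hD hc hδ hαβ hk hk1 hkr
    (ρ := fun x => (ρ x).re) (by fun_prop) (fun x hx => by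
      by_contra h'; exact hx (by simp [hρ0 x h']))
  have h2 := spectralTrace_of_real hh hP hφ hφs hD hc hδ hαβ hk hk1 hkr
    (ρ := fun x => (ρ x).im) (by fun_prop) (fun x hx => by
      by_contra h'; exact hx (by simp [hρ0 x h']))
  rw [← hDdef] at h1 h2
  have hψk : ψ = fun x => k x * ((ρ x).re : ℂ) + Complex.I * (k x * ((ρ x).im : ℂ)) := by
    funext x
    have : k x * ((ρ x).re : ℂ) + Complex.I * (k x * ((ρ x).im : ℂ)) = k x * ρ x := by
      conv_rhs => rw [← Complex.re_add_im (ρ x)]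
      ring
    rw [this]
    by_cases hx : x ∈ Set.Ioo α β
    · have := hk1 x ⟨by linarith [hx.1], by linarith [hx.2]⟩
      calc ψ x = ψ x * (k x * φ x) := by rw [this, mul_one]
        _ = _ := by simp only [ρ]; ring
    · have : ψ x = 0 := by by_contra hne; exact hx (hs hne)
      rw [hρ0 x hx, this, mul_zero]
  have hinteg : ∫ x, ρ x = ((∫ x, (ρ x).re : ℝ) : ℂ) + ((∫ x, (ρ x).im : ℝ) : ℂ) * Complex.I :=
    (integral_re_add_im hρi).symm
  change _ = _ * ∫ x, ρ x
  rw [hinteg]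
  conv_lhs => rw [hψk]
  rw [spectralTrace_add hD (by fun_prop) (by fun_prop), spectralTrace_const_mul (by fun_prop),
    h1, h2]
  ring

/-- A partition of unity cuts ψ into pieces supported in small intervals around which φ has no zero.
-/
theorem spectralTrace_of_tsupport (hh : IsSelfAdjoint h) (hP : IsStarProjection P)
    (hφ : Continuous φ) (hφs : tsupport φ ⊆ Set.Ioo a b)
    (hD : IsNuclear (funcCalc φ h * (Complex.I • (h * P - P * h)))) (hc : HasStepIndex h P a b c)
    {ψ : ℝ → ℂ} (hψ : Continuous ψ) (hψc : HasCompactSupport ψ)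
    (hs : tsupport ψ ⊆ Function.support φ) :
    spectralTrace h (funcCalc φ h * (Complex.I • (h * P - P * h))) ψ =
      -(c / (2 * Real.pi)) * ∫ x, ψ x * φ x := by
  have hU : IsOpen (Function.support φ) := hφ.isOpen_support
  -- A third of the radius of a ball in {φ ≠ 0}: the interval of radius r carries the piece, and the
  -- further margin r is the δ of the local statement.
  have hr : ∀ x : Function.support φ, ∃ r > 0, ∀ y ∈ Set.Icc (x.1 - r - r) (x.1 + r + r), φ y ≠ 0 := by
    rintro ⟨x, hx⟩
    obtain ⟨ε, hε, hball⟩ := Metric.isOpen_iff.1 hU x hx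
    refine ⟨ε / 3, by positivity, fun y hy => hball ?_⟩
    rw [Metric.mem_ball, Real.dist_eq, abs_lt]
    constructor <;> linarith [hy.1, hy.2]
  choose r hr0 hr using hr
  obtain ⟨t, ht⟩ := hψc.isCompact.elim_finite_subcover
    (fun x : Function.support φ => Set.Ioo (x.1 - r x) (x.1 + r x)) (fun x => isOpen_Ioo)
    fun x hx => Set.mem_iUnion.2 ⟨⟨x, hs hx⟩, by
      constructor <;> linarith [hr0 ⟨x, hs hx⟩]⟩
  obtain ⟨f, hfs, hf1, -, -⟩ := exists_continuous_sum_one_of_isOpen_isCompact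
    (s := fun i : Fin t.card => Set.Ioo ((t.equivFin.symm i).1.1 - r (t.equivFin.symm i).1)
      ((t.equivFin.symm i).1.1 + r (t.equivFin.symm i).1)) (t := tsupport ψ)
    (fun i => isOpen_Ioo) hψc.isCompact (fun x hx => by
      obtain ⟨y, hy, hxy⟩ := Set.mem_iUnion₂.1 (ht hx)
      exact Set.mem_iUnion.2 ⟨t.equivFin ⟨y, hy⟩, by simpa using hxy⟩)
  set D := funcCalc φ h * (Complex.I • (h * P - P * h)) with hDdef
  have hfψ : ∀ i, Continuous fun x => (f i x : ℂ) * ψ x := fun i =>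
    (Complex.continuous_ofReal.comp (f i).continuous).mul hψ
  have hsum : ψ = fun x => ∑ i, (f i x : ℂ) * ψ x := by
    funext x
    rw [← Finset.sum_mul]
    by_cases hx : x ∈ tsupport ψ
    · have := hf1 hx
      simp only [Finset.sum_apply, Pi.one_apply] at this
      rw [← Complex.ofReal_sum, this, Complex.ofReal_one, one_mul]
    · rw [image_eq_zero_of_notMem_tsupport hx, mul_zero]
  have hpiece : ∀ i, spectralTrace h D (fun x => (f i x : ℂ) * ψ x) =
      -(c / (2 * Real.pi)) * ∫ x, (f i x : ℂ) * ψ x * φ x := by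
    intro i
    refine spectralTrace_of_interval hh hP hφ hφs hD hc (hr0 (t.equivFin.symm i).1) ?_
      (hr (t.equivFin.symm i).1) (hfψ i) fun x hx => hfs i (subset_tsupport _ fun h' => hx ?_)
    · linarith [hr0 (t.equivFin.symm i).1]
    · simp [h']
  have hinteg : ∀ i, Integrable fun x => (f i x : ℂ) * ψ x * φ x := fun i =>
    ((hfψ i).mul hφ).integrable_of_hasCompactSupport (hψc.mul_left.mul_right)
  conv_lhs => rw [hsum]
  rw [spectralTrace_sum hD _ hfψ, Finset.sum_congr rfl fun i _ => hpiece i, ← Finset.mul_sum,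
    ← integral_finsetSum _ fun i _ => hinteg i]
  congr 2
  funext x
  rw [← Finset.sum_mul]
  conv_rhs => rw [hsum]

/-- The formula for ψ with compact support in {φ ≠ 0} is applied to cutoffs τ_m tending to 1 on that
set. The integrals tend to ∫ φ = 1 by domination, and the traces to Tr D because D begins with φ(h)
and (1 - τ_m)φ tends to 0 uniformly. -/
theorem index_eq_opTrace (hh : IsSelfAdjoint h) (hP : IsStarProjection P)
    (hφ : Continuous φ) (hφc : HasCompactSupport φ) (hφs : tsupport φ ⊆ Set.Ioo a b)
    (hφi : ∫ x, φ x = 1)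
    (hD : IsNuclear (funcCalc φ h * (Complex.I • (h * P - P * h)))) (hc : HasStepIndex h P a b c) :
    (c : ℂ) = -2 * Real.pi * opTrace (funcCalc φ h * (Complex.I • (h * P - P * h))) := by
  set D := funcCalc φ h * (Complex.I • (h * P - P * h)) with hDdef
  -- τ m is 1 where |φ| ≥ 2/(m + 1) and 0 where |φ| ≤ 1/(m + 1), so its closed support stays inside
  -- {φ ≠ 0}.
  let τ : ℕ → ℝ → ℝ := fun m x => min 1 (max 0 ((m + 1) * ‖φ x‖ - 1))
  have hτc : ∀ m, Continuous (τ m) := fun m => by fun_prop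
  have hτC : ∀ m, Continuous fun x => (τ m x : ℂ) := fun m =>
    Complex.continuous_ofReal.comp (hτc m)
  have hτ0 : ∀ m x, 0 ≤ τ m x := fun m x => le_min zero_le_one (le_max_left _ _)
  have hτ1 : ∀ m x, τ m x ≤ 1 := fun m x => min_le_left _ _
  have hτn : ∀ m x, ‖1 - (τ m x : ℂ)‖ = 1 - τ m x := fun m x => by
    rw [← Complex.ofReal_one, ← Complex.ofReal_sub, Complex.norm_real, Real.norm_eq_abs,
      abs_of_nonneg (by linarith [hτ1 m x])]
  have hτφ : ∀ m : ℕ, ∀ x, ‖(1 - (τ m x : ℂ)) * φ x‖ ≤ 2 / (m + 1) := by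
    intro m x
    rw [norm_mul, hτn]
    have hm' : (0 : ℝ) < m + 1 := by positivity
    rcases le_total 2 ((m + 1) * ‖φ x‖) with h2 | h2
    · have : τ m x = 1 := min_eq_left ((by linarith : (1 : ℝ) ≤ (m + 1) * ‖φ x‖ - 1).trans
        (le_max_right _ _))
      rw [this, sub_self, zero_mul]
      positivity
    · rw [le_div_iff₀ hm', mul_assoc, mul_comm ‖φ x‖]
      exact (mul_le_of_le_one_left (by positivity) (by linarith [hτ0 m x])).trans h2
  have hlim : Filter.Tendsto (fun m : ℕ => (2 : ℝ) / (m + 1)) Filter.atTop (nhds 0) := by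
    have := (tendsto_one_div_add_atTop_nhds_zero_nat (𝕜 := ℝ)).const_mul 2
    simpa [div_eq_mul_inv] using this
  have hτs : ∀ m, tsupport (fun x => (τ m x : ℂ)) ⊆ {x | 1 ≤ (m + 1) * ‖φ x‖} := by
    intro m
    refine closure_minimal (fun x hx => ?_) (isClosed_le continuous_const (by fun_prop))
    by_contra h1
    refine hx ?_
    have h1' : (m + 1) * ‖φ x‖ - 1 ≤ 0 := by
      simp only [Set.mem_ofPred_eq, not_le] at h1
      linarith
    have : τ m x = 0 := by simp only [τ, max_eq_left h1', min_eq_right zero_le_one]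
    simp [this]
  have hτs' : ∀ m, tsupport (fun x => (τ m x : ℂ)) ⊆ Function.support φ := fun m x hx h0 => by
    have := hτs m hx
    simp only [Set.mem_ofPred_eq, h0, norm_zero, mul_zero] at this
    linarith
  have hval : ∀ m, spectralTrace h D (fun x => (τ m x : ℂ)) =
      -(c / (2 * Real.pi)) * ∫ x, (τ m x : ℂ) * φ x := fun m =>
    spectralTrace_of_tsupport hh hP hφ hφs hD hc (hτC m)
      (hφc.isCompact.of_isClosed_subset (isClosed_tsupport _)
        ((hτs' m).trans (subset_tsupport φ))) (hτs' m)
  have hφint : Integrable φ := hφ.integrable_of_hasCompactSupport hφc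
  have hL1 : Filter.Tendsto (fun m => spectralTrace h D (fun x => (τ m x : ℂ))) Filter.atTop
      (nhds (-(c / (2 * Real.pi)) * 1)) := by
    rw [funext hval, ← hφi]
    refine Filter.Tendsto.const_mul _ (tendsto_integral_of_dominated_convergence (fun x => ‖φ x‖)
      (fun m => ((hτC m).mul hφ).aestronglyMeasurable) hφint.norm
      (fun m => Filter.Eventually.of_forall fun x => ?_) (Filter.Eventually.of_forall fun x => ?_))
    · rw [norm_mul, Complex.norm_real, Real.norm_eq_abs, abs_of_nonneg (hτ0 m x)]
      exact mul_le_of_le_one_left (norm_nonneg _) (hτ1 m x)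
    · rw [tendsto_iff_norm_sub_tendsto_zero]
      refine squeeze_zero (fun _ => norm_nonneg _) (fun m => ?_) hlim
      have e : (τ m x : ℂ) * φ x - φ x = -((1 - (τ m x : ℂ)) * φ x) := by ring
      rw [e, norm_neg]
      exact hτφ m x
  have hL2 : Filter.Tendsto (fun m => spectralTrace h D (fun x => (τ m x : ℂ))) Filter.atTop
      (nhds (opTrace D)) := by
    have h1 : Filter.Tendsto (fun m => opTrace (funcCalc (fun x => 1 - (τ m x : ℂ)) h * D))
        Filter.atTop (nhds 0) := by
      -- The operators 1 - τ_m(h) need not tend to zero strongly on all of 𝓗; they do on the range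
      -- of D, which is all that is needed.
      refine tendsto_opTrace_mul_zero (C := 1) hD (fun m => norm_funcCalc_le hh zero_le_one
        fun x _ => ?_) fun v => ?_
      · rw [hτn]
        linarith [hτ0 m x]
      · refine squeeze_zero_norm (a := fun m : ℕ =>
          2 / ((m : ℝ) + 1) * ‖(Complex.I • (h * P - P * h)) v‖) (fun m => ?_) ?_
        · have : funcCalc (fun x => 1 - (τ m x : ℂ)) h (D v) =
              funcCalc (fun x => (1 - (τ m x : ℂ)) * φ x) h ((Complex.I • (h * P - P * h)) v) := by
            rw [funcCalc_mul (f := fun x => 1 - (τ m x : ℂ)) (continuous_const.sub (hτC m)) hφ]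
            rfl
          rw [this]
          exact ContinuousLinearMap.le_of_opNorm_le _ (norm_funcCalc_le hh (by positivity)
            fun x _ => hτφ m x) _
        · simpa using hlim.mul_const ‖(Complex.I • (h * P - P * h)) v‖
    have h2 : ∀ m, spectralTrace h D (fun x => (τ m x : ℂ)) =
        opTrace D - opTrace (funcCalc (fun x => 1 - (τ m x : ℂ)) h * D) := by
      intro m
      rw [← opTrace_sub hD (hD.mul_left _), funcCalc_sub continuous_const (hτC m),
        funcCalc_eq_one hh fun _ => rfl, spectralTrace]
      congr 1
      noncomm_ring
    rw [funext h2]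
    simpa using tendsto_const_nhds.sub h1
  have := tendsto_nhds_unique hL2 hL1
  have hpi : (Real.pi : ℂ) ≠ 0 := by exact_mod_cast Real.pi_ne_zero
  rw [this]
  field_simp

end CurrentFormula

/-! ### Compressions of unitaries with compact commutator -/

section Compression

variable {𝓗 : Type*} [NormedAddCommGroup 𝓗] [InnerProductSpace ℂ 𝓗] [CompleteSpace 𝓗]
  {P u : 𝓗 →L[ℂ] 𝓗}

theorem isCompactOperator_one_sub_compression (hP : IsIdempotentElem P) {v : 𝓗 →L[ℂ] 𝓗}
    (hvu : v * u = 1) (hc : IsCompactOperator (u * P - P * u)) :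
    IsCompactOperator
      (1 - (P * v * P + (1 - P)) * (P * u * P + (1 - P)) : 𝓗 →L[ℂ] 𝓗) := by
  rw [one_sub_compression_mul hP hvu]
  exact IsCompactOperator.mul_right' (IsCompactOperator.mul_left' hc _) _

theorem isFredholm_compression (hP : IsStarProjection P) (hu : u ∈ unitary (𝓗 →L[ℂ] 𝓗))
    (hc : IsCompactOperator (u * P - P * u)) : (P * u * P + (1 - P)).IsFredholm := by
  obtain ⟨h1, h2⟩ := Unitary.mem_iff.1 hu
  exact isFredholm_of_approx (S := P * star u * P + (1 - P))
    (exists_finiteRank_norm_sub_lt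
      (isCompactOperator_one_sub_compression hP.isIdempotentElem h1 hc) one_pos)
    (exists_finiteRank_norm_sub_lt
      (isCompactOperator_one_sub_compression hP.isIdempotentElem h2
        (isCompactOperator_star_commutator hP.isSelfAdjoint hc)) one_pos)

theorem fredholmIndex_one_sub_compact {C : 𝓗 →L[ℂ] 𝓗} (hC : IsCompactOperator C) :
    fredholmIndex (1 - C) = 0 := by
  obtain ⟨F, hF, hlt⟩ := exists_finiteRank_norm_sub_lt hC one_pos
  have h := (fredholmIndex_unit_sub (isUnit_one_sub_of_norm_lt_one hlt) hF).2
  rwa [show 1 - (C - F) - F = 1 - C by abel] at h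

/-- The product of the two compressions is 1 minus a compact operator, which has index zero. -/
theorem fredholmIndex_compression_star (hP : IsStarProjection P) (hu : u ∈ unitary (𝓗 →L[ℂ] 𝓗))
    (hc : IsCompactOperator (u * P - P * u)) :
    fredholmIndex (P * star u * P + (1 - P)) = -fredholmIndex (P * u * P + (1 - P)) := by
  have h1 := isFredholm_compression hP hu hc
  have h2 := isFredholm_compression hP (Unitary.star_mem hu)
    (isCompactOperator_star_commutator hP.isSelfAdjoint hc)
  have h3 := fredholmIndex_one_sub_compact (isCompactOperator_one_sub_compression
    hP.isIdempotentElem (Unitary.mem_iff.1 hu).1 hc)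
  rw [sub_sub_cancel, fredholmIndex_mul h2 h1] at h3
  exact eq_neg_of_add_eq_zero_left h3

theorem fredholmIndex_matrixOp_fin_one (T : Matrix (Fin 1) (Fin 1) (𝓗 →L[ℂ] 𝓗)) :
    fredholmIndex (matrixOp T) = fredholmIndex (T 0 0) := by
  refine linIndex_conj _ _ (LinearEquiv.funUnique (Fin 1) ℂ 𝓗) (LinearEquiv.funUnique (Fin 1) ℂ 𝓗)
    fun x => ?_
  change matrixOp T x 0 = T 0 0 (x 0)
  rw [matrixOp_apply, Fin.sum_univ_one]

end Compression

/-! ### Exponentials -/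

section Exponential

variable {𝓗 : Type*} [NormedAddCommGroup 𝓗] [InnerProductSpace ℂ 𝓗] [CompleteSpace 𝓗]
  {A I : NonUnitalStarSubalgebra ℂ (𝓗 →L[ℂ] 𝓗)}

theorem exp_sub_exp_mem (hI : IsClosed (I : Set (𝓗 →L[ℂ] 𝓗))) (h1 : (1 : 𝓗 →L[ℂ] 𝓗) ∈ A)
    (hAI : ∀ S ∈ A, ∀ T ∈ I, S * T ∈ I ∧ T * S ∈ I) {x y : 𝓗 →L[ℂ] 𝓗} (hx : x ∈ A) (hy : y ∈ A)
    (hxy : x - y ∈ I) : NormedSpace.exp x - NormedSpace.exp y ∈ I := by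
  have hpow : ∀ k : ℕ, x ^ k ∈ A ∧ x ^ k - y ^ k ∈ I := by
    intro k
    induction k with
    | zero => exact ⟨by simpa using h1, by simp⟩
    | succ k ih =>
      refine ⟨by rw [pow_succ]; exact mul_mem ih.1 hx, ?_⟩
      have : x ^ (k + 1) - y ^ (k + 1) = x ^ k * (x - y) + (x ^ k - y ^ k) * y := by
        rw [pow_succ, pow_succ]; noncomm_ring
      rw [this]
      exact add_mem (hAI _ ih.1 _ hxy).1 (hAI _ hy _ ih.2).2
  have h := (NormedSpace.exp_series_hasSum_exp' (𝕂 := ℂ) x).sub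
    (NormedSpace.exp_series_hasSum_exp' (𝕂 := ℂ) y)
  refine hI.mem_of_tendsto h (Filter.Eventually.of_forall fun s => sum_mem fun k _ => ?_)
  rw [← smul_sub]
  exact SMulMemClass.smul_mem _ (hpow k).2

/-- The operator `fst x + snd x` given by an element of the unitalization of `B(𝓗)`. -/
def unitizationEval : Unitization ℂ (𝓗 →L[ℂ] 𝓗) →ₐ[ℂ] (𝓗 →L[ℂ] 𝓗) :=
  Unitization.lift (NonUnitalAlgHom.id ℂ (𝓗 →L[ℂ] 𝓗))

theorem unitizationEval_apply (x : Unitization ℂ (𝓗 →L[ℂ] 𝓗)) :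
    unitizationEval x = x.fst • (1 : 𝓗 →L[ℂ] 𝓗) + x.snd := by
  rw [← Algebra.algebraMap_eq_smul_one]
  rfl

/-- Classes in K₁ live over B(𝓗)⁺, whose unit is a formal one, whereas the index is computed in
B(𝓗). Evaluation is a continuous algebra homomorphism, so it commutes with the exponential. -/
theorem unitizationEval_exp (x : Matrix (Fin 1) (Fin 1) (Unitization ℂ (𝓗 →L[ℂ] 𝓗))) :
    unitizationEval (NormedSpace.exp x 0 0) = NormedSpace.exp (unitizationEval (x 0 0)) := by
  have hpow : ∀ k : ℕ, (x ^ k) 0 0 = (x 0 0) ^ k := by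
    intro k
    induction k with
    | zero => simp
    | succ k ih => rw [pow_succ, pow_succ, Matrix.mul_apply, Fin.sum_univ_one, ih]
  have hc : Continuous fun x : Matrix (Fin 1) (Fin 1) (Unitization ℂ (𝓗 →L[ℂ] 𝓗)) =>
      unitizationEval (x 0 0) := by
    simp only [unitizationEval_apply]
    have h := (continuous_id (X := Matrix (Fin 1) (Fin 1) (Unitization ℂ (𝓗 →L[ℂ] 𝓗)))).matrix_elem
      0 0
    exact ((Unitization.continuous_fst.comp h).smul continuous_const).add
      (Unitization.continuous_snd.comp h)
  let Λ : Matrix (Fin 1) (Fin 1) (Unitization ℂ (𝓗 →L[ℂ] 𝓗)) →+ (𝓗 →L[ℂ] 𝓗) :=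
    AddMonoidHom.mk' (fun x => unitizationEval (x 0 0)) fun x y =>
      unitizationEval.toLinearMap.map_add (x 0 0) (y 0 0)
  have h := (hasSum_exp_matrix x).map Λ hc
  have e : (Λ ∘ fun k : ℕ => ((k.factorial : ℂ)⁻¹) • x ^ k) =
      fun k : ℕ => ((k.factorial : ℂ)⁻¹) • unitizationEval (x 0 0) ^ k := by
    funext k
    change unitizationEval.toLinearMap ((((k.factorial : ℂ)⁻¹) • x ^ k) 0 0) = _
    rw [Matrix.smul_apply, hpow, LinearMap.map_smul]
    congr 1
    exact unitizationEval.toRingHom.map_pow _ _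
  rw [e] at h
  exact h.unique (NormedSpace.exp_series_hasSum_exp' (𝕂 := ℂ) (unitizationEval (x 0 0)))

theorem exp_smul_mem_unitary {x : 𝓗 →L[ℂ] 𝓗} (hx : IsSelfAdjoint x) :
    NormedSpace.exp ((2 * Real.pi * Complex.I : ℂ) • x) ∈ unitary (𝓗 →L[ℂ] 𝓗) := by
  have : NormedAlgebra ℚ (𝓗 →L[ℂ] 𝓗) := NormedAlgebra.restrictScalars ℚ ℂ _
  refine NormedSpace.exp_mem_unitary_of_mem_skewAdjoint ?_
  rw [skewAdjoint.mem_iff, star_smul, hx.star_eq, ← neg_smul]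
  simp

end Exponential

/-! ### The index of the Fermi projection -/

section FermiIndex

variable {X : Type*} [MetricSpace X] [ProperSpace X] [MeasurableSpace X] [BorelSpace X]
  {𝓗 : Type*} [NormedAddCommGroup 𝓗] [InnerProductSpace ℂ 𝓗] [CompleteSpace 𝓗]
  (M : XModule X 𝓗) {Y W : Set X}

theorem isLift_inr {A I₁ I₂ : NonUnitalStarSubalgebra ℂ (𝓗 →L[ℂ] 𝓗)} (e : A)
    (he : IsStarProjection e) (x : I₁) (hxs : IsSelfAdjoint x)
    (hex : (e : 𝓗 →L[ℂ] 𝓗) - (x : 𝓗 →L[ℂ] 𝓗) ∈ I₂) :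
    IsLift I₂ (projMatOfProj e he).1
      (Matrix.of fun _ _ => (Unitization.inr x : Unitization ℂ I₁)) := by
  refine ⟨Matrix.ext fun i j => ?_, fun i j => ⟨rfl, hex⟩⟩
  rw [Matrix.star_apply, Matrix.of_apply, Matrix.of_apply, ← Unitization.inr_star, hxs.star_eq]

theorem isLift_zero {A I₁ I₂ : NonUnitalStarSubalgebra ℂ (𝓗 →L[ℂ] 𝓗)} {n : ℕ} :
    IsLift I₂ (0 : Matrix (Fin n) (Fin n) (Unitization ℂ A))
      (0 : Matrix (Fin n) (Fin n) (Unitization ℂ I₁)) := by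
  refine ⟨star_zero _, fun i j => ⟨rfl, ?_⟩⟩
  have : (((0 : Matrix (Fin n) (Fin n) (Unitization ℂ A)) i j).snd : 𝓗 →L[ℂ] 𝓗) -
      (((0 : Matrix (Fin n) (Fin n) (Unitization ℂ I₁)) i j).snd : 𝓗 →L[ℂ] 𝓗) = 0 := sub_self 0
  rw [this]
  exact zero_mem I₂

theorem eq_one_of_matIncl_eq_exp {J I₁ : NonUnitalStarSubalgebra ℂ (𝓗 →L[ℂ] 𝓗)} {n : ℕ} {z : ℂ}
    {v : UnitaryMat (Unitization ℂ J) n} (hv : matIncl J v.1 =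
      NormedSpace.exp (z • matIncl I₁ (0 : Matrix (Fin n) (Fin n) (Unitization ℂ I₁)))) :
    v = 1 := by
  refine Subtype.ext (matIncl_injective _ ?_)
  have h0 : matIncl I₁ (0 : Matrix (Fin n) (Fin n) (Unitization ℂ I₁)) = 0 :=
    Matrix.map_zero _ (map_zero _)
  rw [hv, h0, smul_zero, NormedSpace.exp_zero]
  exact (matIncl_one _).symm

theorem matLift_eq_exp {J I₁ : NonUnitalStarSubalgebra ℂ (𝓗 →L[ℂ] 𝓗)} {z : ℂ} {x : I₁}
    {u : Matrix (Fin 1) (Fin 1) (Unitization ℂ J)} (hu : matIncl J u =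
      NormedSpace.exp (z • matIncl I₁ (Matrix.of fun _ _ => (Unitization.inr x : Unitization ℂ I₁)))) :
    matLift u 0 0 = NormedSpace.exp (z • (x : 𝓗 →L[ℂ] 𝓗)) := by
  have h1 : matLift u 0 0 = unitizationEval (matIncl _ u 0 0) := by
    rw [unitizationEval_apply, matLift_apply, (matIncl_apply _ u 0 0).1, (matIncl_apply _ u 0 0).2]
  rw [h1, hu, unitizationEval_exp]
  congr 1
  rw [unitizationEval_apply, Matrix.smul_apply, Unitization.fst_smul, Unitization.snd_smul,
    (matIncl_apply _ _ 0 0).1, (matIncl_apply _ _ 0 0).2, Matrix.of_apply, Unitization.fst_inr,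
    Unitization.snd_inr, smul_zero, zero_smul, zero_add]

theorem IsMayerVietorisBoundary.exists_projClass {A I₁ I₂ J : NonUnitalStarSubalgebra ℂ (𝓗 →L[ℂ] 𝓗)}
    {d : K0 A →+ K1 J} (hd : IsMayerVietorisBoundary A I₁ I₂ J d) (e : A) (he : IsStarProjection e)
    (x : I₁) (hxs : IsSelfAdjoint x) (hex : (e : 𝓗 →L[ℂ] 𝓗) - (x : 𝓗 →L[ℂ] 𝓗) ∈ I₂) :
    ∃ u : UnitaryMat (Unitization ℂ J) 1, d (projClass e he) = k1Class u ∧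
      matLift u.1 0 0 = NormedSpace.exp ((2 * Real.pi * Complex.I : ℂ) • (x : 𝓗 →L[ℂ] 𝓗)) := by
  refine (hd.2 1 (projMatOfProj e he) ⟨0, IsStarProjection.zero _⟩ (fun i j => rfl) _ 0
    (isLift_inr e he x hxs hex) isLift_zero).imp fun u h => ?_
  refine h.elim fun v h => ⟨h.2.2.trans ?_, matLift_eq_exp h.1⟩
  have hv : k1Class v = 0 := by rw [eq_one_of_matIncl_eq_exp h.2.1, k1Class_one]
  exact (congrArg (k1Class u - ·) hv).trans (sub_zero _)

/-- For a projection in the algebra itself the class is [e] - [0]; the lift 0 of 0 contributes the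
trivial unitary, and everything happens in 1 × 1 matrices. -/
theorem XModule.theta_mvBoundary_projClass (hY : MeasurableSet Y) (hW : MeasurableSet W)
    (hYW : Transversal Y W) (e : M.roe) (he : IsStarProjection e) {x : 𝓗 →L[ℂ] 𝓗}
    (hx : x ∈ M.localizedRoe (bigFamily Y)) (hxs : IsSelfAdjoint x)
    (hex : (e : 𝓗 →L[ℂ] 𝓗) - x ∈ M.localizedRoe (bigFamily Yᶜ)) :
    M.theta Y W (M.mvBoundary Y (projClass e he)) =
      fredholmIndex (M.chi W * NormedSpace.exp ((2 * Real.pi * Complex.I : ℂ) • x) * M.chi W +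
        (1 - M.chi W)) := by
  refine ((M.isMayerVietorisBoundary hY).exists_projClass e he ⟨x, hx⟩
    (Subtype.ext hxs.star_eq) hex).elim fun u h => ?_
  refine (congrArg (M.theta Y W) h.1).trans ((M.isIndexMap_theta hYW hW 1 u).2.trans ?_)
  rw [M.compression_eq hW, fredholmIndex_matrixOp_fin_one, compressionMat_apply, h.2, if_pos rfl]

/-- Scalars disappear in the commutator, so u may be congruent to different scalars modulo the two
ideals. The commutator is then localized at ∂Y, and also at ∂W. -/
theorem XModule.isCompactOperator_commutator_of_sub_mem (hW : MeasurableSet W)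
    (hYW : Transversal Y W) {u : 𝓗 →L[ℂ] 𝓗} {z z' : ℂ}
    (h1 : u - z • 1 ∈ M.localizedRoe (bigFamily Y))
    (h2 : u - z' • 1 ∈ M.localizedRoe (bigFamily Yᶜ)) :
    IsCompactOperator (u * M.chi W - M.chi W * u) := by
  have hcomm : ∀ z : ℂ, u * M.chi W - M.chi W * u =
      (u - z • 1) * M.chi W - M.chi W * (u - z • 1) := fun z => by
    rw [sub_mul, mul_sub, smul_mul_assoc, mul_smul_comm, one_mul, mul_one]
    abel
  have hb := isBigFamily_bigFamily Y
  have hb' := isBigFamily_bigFamily Yᶜ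
  refine XModule.isCompactOperator_of_mem (M := M) hYW
    ((XModule.mem_localizedRoe_inter hb hb').2 ⟨?_, ?_⟩) ?_
  · rw [hcomm z]
    exact sub_mem (XModule.mul_chi_mem_localizedRoe' hb hW h1)
      (XModule.chi_mul_mem_localizedRoe' hb hW h1)
  · rw [hcomm z']
    exact sub_mem (XModule.mul_chi_mem_localizedRoe' hb' hW h2)
      (XModule.chi_mul_mem_localizedRoe' hb' hW h2)
  · rw [hcomm z]
    exact XModule.commutator_mem_localizedRoe hW (XModule.localizedRoe_le hb h1)

variable {M} {H H' : 𝓗 →L[ℂ] 𝓗}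

/-- Adaptedness speaks of C₀ functions vanishing at 0. Subtracting G(0) and cutting off outside the
bounded spectra produces such a function without changing the operators. -/
theorem XModule.IsAdapted.funcCalc_mem (hsa : IsSelfAdjoint H) (had : M.IsAdapted Y H H')
    {G : ℝ → ℂ} (hG : Continuous G) :
    funcCalc G H' - G 0 • 1 ∈ M.localizedRoe (bigFamily Y) ∧
      funcCalc G H - funcCalc G H' ∈ M.localizedRoe (bigFamily Yᶜ) := by
  have hb : Bornology.IsBounded (spectrum ℝ H ∪ spectrum ℝ H') :=
    (spectrum.isCompact H).isBounded.union (spectrum.isCompact H').isBounded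
  obtain ⟨R, hR⟩ := hb.subset_closedBall 0
  rw [Real.closedBall_eq_Icc] at hR
  obtain ⟨e, hec, he1, he0⟩ := exists_continuous_cutoff (α := 0 - R) (β := 0 + R) one_pos
  let f : C₀(ℝ, ℂ) := ⟨⟨fun x => (G x - G 0) * e x, (hG.sub continuous_const).mul hec⟩,
    HasCompactSupport.is_zero_at_infty (HasCompactSupport.intro
      (K := Set.Icc (0 - R - 1) (0 + R + 1)) isCompact_Icc fun x hx => by simp [he0 x hx])⟩
  have hf : ∀ x, f x = (G x - G 0) * e x := fun _ => rfl
  have hfT : ∀ T : 𝓗 →L[ℂ] 𝓗, IsSelfAdjoint T → spectrum ℝ T ⊆ Set.Icc (0 - R) (0 + R) →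
      funcCalc f T = funcCalc G T - G 0 • 1 := by
    intro T hT hTs
    rw [← funcCalc_const hT, ← funcCalc_sub hG continuous_const]
    exact funcCalc_congr hT fun x hx => by rw [hf, he1 x (hTs hx), mul_one]
  have h := had.2 f (by rw [hf, sub_self, zero_mul])
  rw [hfT H hsa fun x hx => hR (Or.inl hx), hfT H' had.1 fun x hx => hR (Or.inr hx),
    sub_sub_sub_cancel_right] at h
  exact h

theorem funcCalc_sub_mem {A : NonUnitalStarSubalgebra ℂ (𝓗 →L[ℂ] 𝓗)}
    (hA : IsClosed (A : Set (𝓗 →L[ℂ] 𝓗))) (hH : H ∈ A) (hsa : IsSelfAdjoint H) {G : ℝ → ℂ}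
    (hG : Continuous G) : funcCalc G H - G 0 • 1 ∈ A := by
  have hn := hsa.isStarNormal
  rw [← funcCalc_const hsa, ← funcCalc_sub hG continuous_const, funcCalc,
    ← cfcₙ_eq_cfc (f := fun z : ℂ => G z.re - G 0)
      (continuousOn_re (f := fun x => G x - G 0) (hG.sub continuous_const) _) (by simp)]
  exact cfcₙ_mem (𝕜' := ℂ) (hs := hA) _ hH

theorem fermiProj_eq_funcCalc (hsa : IsSelfAdjoint H) {a b E : ℝ} (hab : E ∈ Set.Ioo a b)
    (hgap : Disjoint (Set.Ioo a b) (spectrum ℝ H)) {g : ℝ → ℝ}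
    (ha : ∀ x ≤ a, g x = 1) (hb : ∀ x, b ≤ x → g x = 0) :
    fermiProj H E = funcCalc (fun x => (g x : ℂ)) H := by
  have h1 : fermiProj H E = cfc g H := by
    refine cfc_congr fun x hx => ?_
    rcases le_or_gt x a with h | h
    · rw [ha x h]
      exact if_pos (h.trans_lt hab.1)
    · have hxb : b ≤ x := by
        by_contra hlt
        exact Set.disjoint_left.1 hgap ⟨h, not_le.1 hlt⟩ hx
      rw [hb x hxb]
      exact if_neg (not_lt.2 (hab.2.le.trans hxb))
  rw [h1, cfc_real_eq_complex _ hsa]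
  rfl

theorem exp_smul_fermiProj (hsa : IsSelfAdjoint H) {a b E : ℝ} (hab : E ∈ Set.Ioo a b)
    (hgap : Disjoint (Set.Ioo a b) (spectrum ℝ H)) {g : ℝ → ℝ} (hg : Continuous g)
    (ha : ∀ x ≤ a, g x = 1) (hb : ∀ x, b ≤ x → g x = 0) :
    NormedSpace.exp ((2 * Real.pi * Complex.I : ℂ) • fermiProj H E) = 1 := by
  have hgC : Continuous fun x => (g x : ℂ) := Complex.continuous_ofReal.comp hg
  rw [fermiProj_eq_funcCalc hsa hab hgap ha hb, ← funcCalc_const_mul hgC,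
    ← funcCalc_exp hsa (f := fun x => 2 * Real.pi * Complex.I * (g x : ℂ)) (continuous_const.mul hgC)]
  refine (funcCalc_congr hsa fun x hx => ?_).trans (funcCalc_eq_one hsa fun _ => rfl)
  rcases le_or_gt x a with h | h
  · simp [ha x h, Complex.exp_two_pi_mul_I]
  · have hxb : b ≤ x := by
      by_contra hlt
      exact Set.disjoint_left.1 hgap ⟨h, not_le.1 hlt⟩ hx
    simp [hb x hxb]

/-- A lift of p must lie in I₁, but q does so only after subtracting the scalar γ. If 1 is in the
algebra, then χ_{Yᶜ} lies in I₂, so subtracting γχ_{Yᶜ} instead keeps q congruent to p modulo I₂ and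
moves it into I₁. Scaling the subtracted term by t joins the two through unitaries with compact
commutator, so the index is unchanged. -/
theorem XModule.exists_lift_of_one_mem (hY : MeasurableSet Y) (hW : MeasurableSet W)
    (hYW : Transversal Y W) (h1A : (1 : 𝓗 →L[ℂ] 𝓗) ∈ M.roe) {p q : 𝓗 →L[ℂ] 𝓗} (hp : p ∈ M.roe)
    (hp1 : NormedSpace.exp ((2 * Real.pi * Complex.I : ℂ) • p) = 1) (hqs : IsSelfAdjoint q) {γ : ℝ}
    (hq1 : q - (γ : ℂ) • 1 ∈ M.localizedRoe (bigFamily Y))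
    (hq2 : p - q ∈ M.localizedRoe (bigFamily Yᶜ)) :
    ∃ x ∈ M.localizedRoe (bigFamily Y), IsSelfAdjoint x ∧
      p - x ∈ M.localizedRoe (bigFamily Yᶜ) ∧
      fredholmIndex (M.chi W * NormedSpace.exp ((2 * Real.pi * Complex.I : ℂ) • q) * M.chi W +
        (1 - M.chi W)) =
      fredholmIndex (M.chi W * NormedSpace.exp ((2 * Real.pi * Complex.I : ℂ) • x) * M.chi W +
        (1 - M.chi W)) := by
  have hP := M.isStarProjection_chi hW
  have hχ : M.chi Y ∈ M.localizedRoe (bigFamily Y) := by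
    simpa using M.chi_mul_mem_localizedRoe hY h1A
  have hχ' : M.chi Yᶜ ∈ M.localizedRoe (bigFamily Yᶜ) := by
    simpa using M.chi_mul_mem_localizedRoe hY.compl h1A
  have htri := M.isMayerVietorisTriple hY
  let x : ℝ → 𝓗 →L[ℂ] 𝓗 := fun t => q - ((t * γ : ℝ) : ℂ) • M.chi Yᶜ
  have hxs : ∀ t, IsSelfAdjoint (x t) := fun t => by
    refine hqs.sub ?_
    rw [IsSelfAdjoint, star_smul, (M.isSelfAdjoint_chi hY.compl).star_eq]
    congr 1
    exact Complex.conj_ofReal _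
  have hx1 : ∀ t, x t - (((1 - t) * γ : ℝ) : ℂ) • 1 ∈ M.localizedRoe (bigFamily Y) := fun t => by
    have : x t - (((1 - t) * γ : ℝ) : ℂ) • 1 = (q - (γ : ℂ) • 1) + ((t * γ : ℝ) : ℂ) • M.chi Y := by
      simp only [x]
      rw [M.chi_compl hY]
      push_cast
      module
    rw [this]
    exact add_mem hq1 (SMulMemClass.smul_mem _ hχ)
  have hx2 : ∀ t, p - x t ∈ M.localizedRoe (bigFamily Yᶜ) := fun t => by
    have : p - x t = (p - q) + ((t * γ : ℝ) : ℂ) • M.chi Yᶜ := by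
      simp only [x]
      abel
    rw [this]
    exact add_mem hq2 (SMulMemClass.smul_mem _ hχ')
  have hxA : ∀ t, x t ∈ M.roe := fun t => by
    have := sub_mem hp (M.localizedRoe_le (isBigFamily_bigFamily _) (hx2 t))
    rwa [sub_sub_cancel] at this
  set z : ℂ := 2 * Real.pi * Complex.I with hz
  have hxc : ∀ t, IsCompactOperator (NormedSpace.exp (z • x t) * M.chi W -
      M.chi W * NormedSpace.exp (z • x t)) := by
    intro t
    -- Along the path the exponential is a scalar modulo I₁, depending on t, and 1 modulo I₂.
    have e1 := exp_sub_exp_mem htri.closed₁ h1A htri.ideal₁ (SMulMemClass.smul_mem z (hxA t))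
      (SMulMemClass.smul_mem z (SMulMemClass.smul_mem (((1 - t) * γ : ℝ) : ℂ) h1A))
      (by rw [← smul_sub]; exact SMulMemClass.smul_mem z (hx1 t))
    have e2 := exp_sub_exp_mem htri.closed₂ h1A htri.ideal₂ (SMulMemClass.smul_mem z (hxA t))
      (SMulMemClass.smul_mem z hp)
      (by rw [← smul_sub, ← neg_sub, smul_neg]; exact neg_mem (SMulMemClass.smul_mem z (hx2 t)))
    rw [hp1, ← one_smul ℂ (1 : 𝓗 →L[ℂ] 𝓗)] at e2
    rw [smul_smul, ← Algebra.algebraMap_eq_smul_one, ← NormedSpace.algebraMap_exp_comm,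
      Algebra.algebraMap_eq_smul_one] at e1
    exact M.isCompactOperator_commutator_of_sub_mem hW hYW e1 e2
  have hcont : Continuous fun t : unitInterval => M.chi W * NormedSpace.exp (z • x t) * M.chi W +
      (1 - M.chi W) := by
    have hxcont : Continuous fun t : unitInterval => z • x t := by
      refine Continuous.const_smul (continuous_const.sub ?_) z
      exact (Complex.continuous_ofReal.comp (continuous_subtype_val.mul continuous_const)).smul
        continuous_const
    have : NormedAlgebra ℚ (𝓗 →L[ℂ] 𝓗) := NormedAlgebra.restrictScalars ℚ ℂ _
    have hexp := NormedSpace.exp_continuous.comp hxcont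
    exact ((continuous_const.mul hexp).mul continuous_const).add continuous_const
  have hpath := fredholmIndex_path _ hcont fun t =>
    isFredholm_compression hP (exp_smul_mem_unitary (hxs t)) (hxc t)
  have hx0 : x ((0 : unitInterval) : ℝ) = q := by simp [x]
  rw [hx0] at hpath
  refine ⟨_, ?_, hxs _, hx2 _, hpath⟩
  simpa using hx1 ((1 : unitInterval) : ℝ)

/-- Since exp(2πi) = 1, replacing q by 1 - q conjugates the unitary. The resulting sign of the index
cancels the sign in [p_E] = -[1 - p_E]. -/
theorem exp_smul_one_sub {q : 𝓗 →L[ℂ] 𝓗} (hq : IsSelfAdjoint q) :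
    NormedSpace.exp ((2 * Real.pi * Complex.I : ℂ) • (1 - q)) =
      star (NormedSpace.exp ((2 * Real.pi * Complex.I : ℂ) • q)) := by
  set z : ℂ := 2 * Real.pi * Complex.I with hz
  have e1 := funcCalc_exp hq (f := fun x => z * (1 - (x : ℂ))) (by fun_prop)
  have e2 := funcCalc_exp hq (f := fun x => z * (x : ℂ)) (by fun_prop)
  rw [funcCalc_const_mul (f := fun x => 1 - (x : ℂ)) (by fun_prop),
    funcCalc_sub continuous_const Complex.continuous_ofReal, funcCalc_id hq,
    funcCalc_eq_one hq fun _ => rfl] at e1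
  rw [funcCalc_const_mul Complex.continuous_ofReal, funcCalc_id hq] at e2
  rw [← e1, ← e2, ← funcCalc_star]
  refine funcCalc_congr hq fun x _ => ?_
  rw [Complex.star_def, ← Complex.exp_conj, mul_sub, mul_one, Complex.exp_sub, hz,
    Complex.exp_two_pi_mul_I, one_div, ← Complex.exp_neg]
  congr 1
  simp [Complex.conj_ofNat]

/-- The Fermi projection belongs to the algebra if `0` lies above the lower end of the gap. -/
theorem fermiProj_mem_of_neg {A : NonUnitalStarSubalgebra ℂ (𝓗 →L[ℂ] 𝓗)}
    (hA : IsClosed (A : Set (𝓗 →L[ℂ] 𝓗))) (hH : H ∈ A) (hsa : IsSelfAdjoint H) {a b E : ℝ}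
    (hab : E ∈ Set.Ioo a b) (hgap : Disjoint (Set.Ioo a b) (spectrum ℝ H)) (ha : a < 0) :
    fermiProj H E ∈ A := by
  -- The step descends between a and min b 0, so that it already vanishes at 0 and no scalar has to
  -- be subtracted.
  set d : ℝ := min b 0 - a with hd
  have hd0 : 0 < d := sub_pos.2 (lt_min (hab.1.trans hab.2) ha)
  let g : ℝ → ℝ := fun x => max 0 (min 1 (1 - (x - a) / d))
  have hg : Continuous g := by fun_prop
  have hg1 : ∀ x ≤ a, g x = 1 := fun x hx => by
    have : (x - a) / d ≤ 0 := div_nonpos_of_nonpos_of_nonneg (by linarith) hd0.le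
    have h2 : min 1 (1 - (x - a) / d) = 1 := min_eq_left (by linarith)
    simp [g, h2]
  have hg0 : ∀ x, min b 0 ≤ x → g x = 0 := fun x hx => by
    have : 1 ≤ (x - a) / d := by rw [le_div_iff₀ hd0]; linarith
    exact max_eq_left ((min_le_right _ _).trans (by linarith))
  have h := funcCalc_sub_mem hA hH hsa (G := fun x => (g x : ℂ)) (by fun_prop)
  rw [← fermiProj_eq_funcCalc hsa hab hgap hg1 fun x hx => hg0 x ((min_le_left _ _).trans hx),
    hg0 0 (min_le_right _ _)] at h
  simpa using h

theorem map_fermiClass_eq {A : NonUnitalStarSubalgebra ℂ (𝓗 →L[ℂ] 𝓗)} (Θ : K0 A →+ ℤ)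
    (hA : IsClosed (A : Set (𝓗 →L[ℂ] 𝓗))) (hH : H ∈ A) (hsa : IsSelfAdjoint H) {E : ℝ}
    (hE : E ∉ spectrum ℝ H) {c : ℤ}
    (h1 : ∀ (h : fermiProj H E ∈ A) he, Θ (projClass (⟨fermiProj H E, h⟩ : A) he) = c)
    (h2 : fermiProj H E ∉ A → ∀ (h : 1 - fermiProj H E ∈ A) he,
      Θ (projClass (⟨1 - fermiProj H E, h⟩ : A) he) = -c) :
    Θ (fermiClass hA hH hsa hE) = c := by
  unfold fermiClass
  split_ifs with h
  · exact h1 h _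
  · exact (Θ.map_neg _).trans (by rw [h2 h, neg_neg])

/-- If p_E is in the algebra and γ = 0, then q itself is a lift. If p_E is in the algebra and γ ≠ 0,
the algebra contains 1 and the homotopy argument applies. If p_E is not in the algebra, then γ = 1
and 1 - q lifts 1 - p_E. -/
theorem XModule.theta_mvBoundary_fermiClass (hY : MeasurableSet Y) (hW : MeasurableSet W)
    (hYW : Transversal Y W) (hH : H ∈ M.roe) (hsa : IsSelfAdjoint H) {E : ℝ}
    (hE : E ∉ spectrum ℝ H) {q : 𝓗 →L[ℂ] 𝓗} (hqs : IsSelfAdjoint q) {γ : ℝ}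
    (hp1 : NormedSpace.exp ((2 * Real.pi * Complex.I : ℂ) • fermiProj H E) = 1)
    (hq1 : q - (γ : ℂ) • 1 ∈ M.localizedRoe (bigFamily Y))
    (hq2 : fermiProj H E - q ∈ M.localizedRoe (bigFamily Yᶜ))
    (hpγ : fermiProj H E - (γ : ℂ) • 1 ∈ M.roe) (hγ : fermiProj H E ∉ M.roe → γ = 1)
    (hcomp : IsCompactOperator (NormedSpace.exp ((2 * Real.pi * Complex.I : ℂ) • q) * M.chi W -
      M.chi W * NormedSpace.exp ((2 * Real.pi * Complex.I : ℂ) • q))) :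
    M.theta Y W (M.mvBoundary Y (fermiClass M.isClosed_roe hH hsa hE)) =
      fredholmIndex (M.chi W * NormedSpace.exp ((2 * Real.pi * Complex.I : ℂ) • q) * M.chi W +
        (1 - M.chi W)) := by
  refine map_fermiClass_eq ((M.theta Y W).comp (M.mvBoundary Y)) M.isClosed_roe hH hsa hE
    (fun hmem he => ?_) fun hmem h' he => ?_
  · by_cases hγ0 : γ = 0
    · rw [hγ0, Complex.ofReal_zero, zero_smul, sub_zero] at hq1
      exact M.theta_mvBoundary_projClass hY hW hYW _ he hq1 hqs hq2
    -- Both p_E and p_E - γ are in the algebra, hence so is the nonzero scalar γ.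
    have h1A : (1 : 𝓗 →L[ℂ] 𝓗) ∈ M.roe := by
      have h := sub_mem hmem hpγ
      rw [sub_sub_cancel] at h
      have h' := SMulMemClass.smul_mem ((γ : ℂ)⁻¹) h
      rwa [smul_smul, inv_mul_cancel₀ (by exact_mod_cast hγ0), one_smul] at h'
    exact (XModule.exists_lift_of_one_mem hY hW hYW h1A hmem hp1 hqs hq1 hq2).elim fun x hx =>
      (M.theta_mvBoundary_projClass hY hW hYW _ he hx.1 hx.2.1 hx.2.2.1).trans hx.2.2.2.symm
  · have hq1' : 1 - q ∈ M.localizedRoe (bigFamily Y) := by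
      rw [hγ hmem, Complex.ofReal_one, one_smul] at hq1
      rw [← neg_sub]
      exact neg_mem hq1
    have hq2' : 1 - fermiProj H E - (1 - q) ∈ M.localizedRoe (bigFamily Yᶜ) := by
      have := neg_mem hq2
      rwa [show -(fermiProj H E - q) = 1 - fermiProj H E - (1 - q) by abel] at this
    refine (M.theta_mvBoundary_projClass hY hW hYW _ he hq1'
      ((IsSelfAdjoint.one _).sub hqs) hq2').trans ?_
    rw [exp_smul_one_sub hqs]
    exact fredholmIndex_compression_star (M.isStarProjection_chi hW) (exp_smul_mem_unitary hqs) hcomp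

/-- The gap makes g(H) the Fermi projection for every admissible g, and adaptedness makes g(h) its
lift up to γ = g(0). So one K-theoretic number is the index for all steps at once, the freedom
exploited in the trace computation. -/
theorem XModule.hasStepIndex_theta (hY : MeasurableSet Y) (hW : MeasurableSet W)
    (hYW : Transversal Y W) (hH : H ∈ M.roe) (hsa : IsSelfAdjoint H) {E : ℝ}
    (hE : E ∉ spectrum ℝ H) (had : M.IsAdapted Y H H') {a b : ℝ} (hab : E ∈ Set.Ioo a b)
    (hgap : Disjoint (Set.Ioo a b) (spectrum ℝ H)) {c : ℤ}
    (hc : M.theta Y W (M.mvBoundary Y (fermiClass M.isClosed_roe hH hsa hE)) = c) :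
    HasStepIndex H' (M.chi W) a b c := by
  intro g hg ha hb
  have hgC : Continuous fun x => (g x : ℂ) := Complex.continuous_ofReal.comp hg
  have hfermi := fermiProj_eq_funcCalc hsa hab hgap ha hb
  have hexp1 := exp_smul_fermiProj hsa hab hgap hg ha hb
  obtain ⟨hq1, hq2⟩ := had.funcCalc_mem hsa hgC
  have hqs : IsSelfAdjoint (funcCalc (fun x => (g x : ℂ)) H') := by
    rw [IsSelfAdjoint, ← funcCalc_star]
    exact funcCalc_congr had.1 fun x _ => Complex.conj_ofReal _
  obtain ⟨h1, h2⟩ := had.funcCalc_mem hsa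
    (G := fun x => Complex.exp (2 * Real.pi * Complex.I * g x)) (by fun_prop)
  have hexpT : ∀ {T : 𝓗 →L[ℂ] 𝓗}, IsSelfAdjoint T →
      funcCalc (fun x => Complex.exp (2 * Real.pi * Complex.I * g x)) T =
      NormedSpace.exp ((2 * Real.pi * Complex.I : ℂ) • funcCalc (fun x => (g x : ℂ)) T) :=
    fun hT => by
      rw [← funcCalc_const_mul hgC]
      exact funcCalc_exp hT (continuous_const.mul hgC)
  rw [hexpT had.1] at h1 h2 ⊢
  rw [hexpT hsa, ← hfermi, hexp1] at h2
  rw [← hfermi] at hq2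
  have hcomp := M.isCompactOperator_commutator_of_sub_mem hW hYW h1 (z' := 1) (by
    rw [one_smul, ← neg_sub]
    exact neg_mem h2)
  refine ⟨isFredholm_compression (M.isStarProjection_chi hW) (exp_smul_mem_unitary hqs) hcomp, ?_⟩
  refine (XModule.theta_mvBoundary_fermiClass hY hW hYW hH hsa hE hqs hexp1 hq1 hq2 ?_ ?_
    hcomp).symm.trans hc
  · rw [hfermi]
    exact funcCalc_sub_mem M.isClosed_roe hH hsa hgC
  -- If p_E is outside the algebra then a ≥ 0, for a < 0 would allow a step vanishing at 0; hence
  -- g(0) = 1.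
  · refine fun hmem => ha 0 ?_
    by_contra hlt
    exact hmem (fermiProj_mem_of_neg M.isClosed_roe hH hsa hab hgap (not_le.1 hlt))

end FermiIndex

end CoarseEdge

end

theorem mainTheorem2 {X : Type*} [MetricSpace X] [ProperSpace X] [MeasurableSpace X] [BorelSpace X]
    {𝓗 : Type*} [NormedAddCommGroup 𝓗] [InnerProductSpace ℂ 𝓗] [CompleteSpace 𝓗]
    (M : XModule X 𝓗) (Y W : Set X) (hY : MeasurableSet Y) (hW : MeasurableSet W)
    (hYW : Transversal Y W)
    (H : 𝓗 →L[ℂ] 𝓗) (hH : H ∈ M.roe) (hHsa : IsSelfAdjoint H)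
    (E : ℝ) (hE : E ∉ spectrum ℝ H)
    (H' : 𝓗 →L[ℂ] 𝓗) (hH' : H' ∈ M.localizedRoe (bigFamily Y)) (hadapt : M.IsAdapted Y H H')
    (a b : ℝ) (hab : E ∈ Set.Ioo a b) (hgap : Disjoint (Set.Ioo a b) (spectrum ℝ H))
    (φ : ℝ → ℂ) (hφ : Continuous φ) (hφc : HasCompactSupport φ)
    (hφs : tsupport φ ⊆ Set.Ioo a b) (hφi : ∫ x, φ x = 1) :
    IsMayerVietorisBoundary M.roe (M.localizedRoe (bigFamily Y)) (M.localizedRoe (bigFamily Yᶜ))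
      (M.localizedRoe (coarseBoundary Y)) (M.mvBoundary Y) ∧
    M.IsIndexMap W (M.localizedRoe (coarseBoundary Y)) (M.theta Y W) ∧
    (IsTraceClass (funcCalc φ H' * (Complex.I • (H' * M.chi W - M.chi W * H'))) →
      (M.theta Y W (M.mvBoundary Y (fermiClass M.isClosed_roe hH hHsa hE)) : ℂ) =
        -2 * Real.pi * opTrace (funcCalc φ H' * (Complex.I • (H' * M.chi W - M.chi W * H')))) := by
  refine ⟨M.isMayerVietorisBoundary hY, M.isIndexMap_theta hYW hW, fun htc => ?_⟩
  exact index_eq_opTrace hadapt.1 (M.isStarProjection_chi hW) hφ hφc hφs hφi htc.isNuclear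
    (XModule.hasStepIndex_theta hY hW hYW hH hHsa hE hadapt hab hgap rfl)
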